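/- Let $q\in\mathbb{C}\setminus\{0\}$ be not a root of unity, fix a square root $q^{1/2}$, and put $\hat q=q-q^{-1}$, $[2]=q+q^{-1}$, $\check C^{12}=q^{-1/2}$, $\check C^{21}=-q^{1/2}$, $\check C^{11}=\check C^{22}=0$, $\hat C_{ij}=-\check C^{ij}$. Repeated indices are summed over $\{1,2\}$. Let $\mathcal A=\mathcal O(\mathrm{SL}_q(2))$ with generators $u^i_j$, coproduct $\Delta u^i_j=u^i_k\otimes u^k_j$ and counit $\varepsilon$; the dual of $\mathcal A$ carries the convolution product. Let $E,F,K,K^{-1},\varepsilon_+=\varepsilon,\varepsilon_-$ be the functionals on $\mathcal A$ with coproducts $\Delta E=E\otimes K+K^{-1}\otimes E$, $\Delta F=F\otimes K+K^{-1}\otimes F$, with $K^{\pm1}$ and $\varepsilon_-$ characters, and with matrices $(f(u^i_j))$ $$E=\begin{pmatrix}0&0\\1&0\end{pmatrix},\quad F=\begin{pmatrix}0&1\\0&0\end{pmatrix},\quad K=\begin{pmatrix}q^{-1/2}&0\\0&q^{1/2}\end{pmatrix},\quad \varepsilon_-=\begin{pmatrix}-1&0\\0&-1\end{pmatrix}.$$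 For either sign $\pm$, the $4D_\pm$-calculus is the bimodule $\Gamma=\bigoplus\mathcal A\theta_{ij}$ with $\theta_{ij}a=a_{(1)}f^{ij}_{kl}(a_{(2)})\theta_{kl}$, where, with rows $ij$ and columns $kl$ in the order $11,12,21,22$, $$(f^{ij}_{kl})=\varepsilon_\pm\begin{pmatrix}1&0&q^{-1/2}\hat qFK&0\\-q^{1/2}\hat qK^{-1}E&K^{-2}&-\hat q^2FE&q^{-1/2}\hat qFK^{-1}\\0&0&K^2&0\\0&0&-q^{1/2}\hat qKE&1\end{pmatrix},$$ with differential $\mathrm da=\theta a-a\theta=a_{(1)}X_{ij}(a_{(2)})\theta_{ij}$, $\theta=\frac{q^{1/2}}{\hat q}\check C^{ij}\theta_{ij}$, that is $$X_{11}=-q^{1/2}\varepsilon_\pm K^{-1}E,\quad X_{12}=\tfrac1{\hat q}(\varepsilon_\pm K^{-2}-\varepsilon),\quad X_{21}=-\hat q\,\varepsilon_\pm FE-\tfrac q{\hat q}(\varepsilon_\pm K^2-\varepsilon),\quad X_{22}=q^{-1/2}\varepsilon_\pm FK^{-1}.$$ Let $\mathcal X^{\mathrm{alg}}_\pm$ be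 the unital algebra of functionals generated by the $X_{ij}$. Let $\sigma$ be the left $\mathcal A$-linear map of $\Gamma\otimes_{\mathcal A}\Gamma$ with $\sigma(\theta_{mn}\otimes\theta_{rs})=f^{mn}_{kl}(u^i_ru^j_s)\,\theta_{ij}\otimes\theta_{kl}$; let $c\ne0$, and let $g:\Gamma\otimes_{\mathcal A}\Gamma\to\mathcal A$ be the left $\mathcal A$-linear map with nonzero values $g_{11,22}=-c$, $g_{12,21}=g_{21,12}=c$, $g_{22,11}=-q^2c$, $g_{12,12}=\hat qc$ on the $\theta_{ij}\otimes\theta_{kl}$. The quantum Clifford algebra is the tensor algebra of $\Gamma$ over $\mathcal A$ modulo the ideal generated by all $\rho-g(\rho)$, $\rho\in\ker(\mathrm{id}-\sigma)$. In it put $\psi^+_1=\frac{q}{[2]c}\theta_{11}\theta_{12}\theta_{21}\theta_{22}$, $\psi^+_2=\theta_{21}\theta_{22}$ and $\mathcal S_0^+=\mathcal A\psi^+_1\oplus\mathcal A\psi^+_2$. Let $\tilde{\mathcal A}=\mathcal A\rtimes\mathbb C[\chi,\chi^{-1}]$ with $\chi\triangleright u^i_j=q^{j-i}u^i_j$, and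 let $\Delta_R:\mathcal S_0^+\to\mathcal S_0^+\otimes\tilde{\mathcal A}$ be the coaction $\Delta_R(a\psi^+_i)=a_{(1)}\psi^+_j\otimes a_{(2)}u^j_i\chi$. A linear map $\partial:\mathcal S_0^+\to\mathcal S_0^+$ is an invariant differential operator if there are $p_{i,j}\in\mathcal X^{\mathrm{alg}}_\pm$ with $\partial(a\psi^+_i)=a_{(1)}p_{j,i}(a_{(2)})\psi^+_j$ for all $a\in\mathcal A$, $i=1,2$, and if $\Delta_R\circ\partial=(\partial\otimes\mathrm{id})\circ\Delta_R$. Put $$D^0_{ij}=-\tfrac1{[2]}\check C^{ij}\hat C_{kl}\bigl(X_{kl}+\tfrac{q^{1/2}}{\hat q}\check C^{kl}\varepsilon\bigr),\qquad D^1_{ij}=X_{ij}+\tfrac{q^{1/2}}{\hat q}\check C^{ij}\varepsilon-D^0_{ij},\qquad \partial_m(a\psi^+_i)=a_{(1)}D^m_{kj}(a_{(2)})\hat C_{ji}\psi^+_k\quad(m=0,1).$$ **Theorem.** The coaction $\Delta_R$ and the operators $\partial_0,\partial_1$ are well defined, and the invariant differential operators on $\mathcal S_0^+$ form a unital algebra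 $\mathcal D(\mathcal S_0^+)$ under composition that contains $\partial_0$ and $\partial_1$. This algebra is the commutative unital complex algebra generated by $\partial_0$ and $\partial_1$ subject to the single relation $$\partial_1^2+q^{-1}\hat q\,\partial_0\partial_1-q^{-2}\partial_0^2=-\frac{q^{-1}}{\hat q^2}\,\mathrm{id};$$ that is, $x\mapsto\partial_0$, $y\mapsto\partial_1$ induces an algebra isomorphism $\mathbb C[x,y]/\bigl(y^2+q^{-1}\hat q\,xy-q^{-2}x^2+q^{-1}\hat q^{-2}\bigr)\cong\mathcal D(\mathcal S_0^+)$. -/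

import Mathlib

open scoped TensorProduct

noncomputable section

namespace QSpin

/-! ### The bialgebra `O(SL_q(2))` -/

/-- `m` is a 2×2 matrix over `B` satisfying the defining relations of `O(SL_q(2))`; with
`m = (a, b; c, d)` these are `ab = q ba`, `ac = q ca`, `bd = q db`, `cd = q dc`, `bc = cb`,
`ad - q bc = 1` and `da - q⁻¹ bc = 1`. Equivalently `R̂ (m ⊗ m) = (m ⊗ m) R̂` and
`ad - q bc = 1`. -/
structure IsQMat (q : ℂˣ) {B : Type*} [Ring B] [Algebra ℂ B] (m : Fin 2 → Fin 2 → B) : Prop where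
  ab : m 0 0 * m 0 1 = (q : ℂ) • (m 0 1 * m 0 0)
  ac : m 0 0 * m 1 0 = (q : ℂ) • (m 1 0 * m 0 0)
  bd : m 0 1 * m 1 1 = (q : ℂ) • (m 1 1 * m 0 1)
  cd : m 1 0 * m 1 1 = (q : ℂ) • (m 1 1 * m 1 0)
  bc : m 0 1 * m 1 0 = m 1 0 * m 0 1
  ad : m 0 0 * m 1 1 - (q : ℂ) • (m 0 1 * m 1 0) = 1
  da : m 1 1 * m 0 0 - (q : ℂ)⁻¹ • (m 0 1 * m 1 0) = 1

/-- The free generators used in the presentation of `O(SL_q(2))`. -/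
def gen (i j : Fin 2) : FreeAlgebra ℂ (Fin 2 × Fin 2) := FreeAlgebra.ι ℂ (i, j)

/-- The defining relations of `O(SL_q(2))`. -/
inductive OSL.Rel (q : ℂˣ) :
    FreeAlgebra ℂ (Fin 2 × Fin 2) → FreeAlgebra ℂ (Fin 2 × Fin 2) → Prop
  | ab : OSL.Rel q (gen 0 0 * gen 0 1) ((q : ℂ) • (gen 0 1 * gen 0 0))
  | ac : OSL.Rel q (gen 0 0 * gen 1 0) ((q : ℂ) • (gen 1 0 * gen 0 0))
  | bd : OSL.Rel q (gen 0 1 * gen 1 1) ((q : ℂ) • (gen 1 1 * gen 0 1))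
  | cd : OSL.Rel q (gen 1 0 * gen 1 1) ((q : ℂ) • (gen 1 1 * gen 1 0))
  | bc : OSL.Rel q (gen 0 1 * gen 1 0) (gen 1 0 * gen 0 1)
  | ad : OSL.Rel q (gen 0 0 * gen 1 1 - (q : ℂ) • (gen 0 1 * gen 1 0)) 1
  | da : OSL.Rel q (gen 1 1 * gen 0 0 - (q : ℂ)⁻¹ • (gen 0 1 * gen 1 0)) 1

/-- The algebra `O(SL_q(2))`. -/
def OSL (q : ℂˣ) : Type := RingQuot (OSL.Rel q)

instance (q : ℂˣ) : Ring (OSL q) := inferInstanceAs (Ring (RingQuot (OSL.Rel q)))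

instance (q : ℂˣ) : Algebra ℂ (OSL q) := inferInstanceAs (Algebra ℂ (RingQuot (OSL.Rel q)))

/-- The quotient map from the free algebra. -/
def OSL.mk (q : ℂˣ) : FreeAlgebra ℂ (Fin 2 × Fin 2) →ₐ[ℂ] OSL q := RingQuot.mkAlgHom ℂ (OSL.Rel q)

/-- The generators `u^i_j` (the indices `1, 2` are `0, 1` here). -/
def OSL.u (q : ℂˣ) (i j : Fin 2) : OSL q := OSL.mk q (gen i j)

theorem OSL.mk_rel {q : ℂˣ} {x y} (h : OSL.Rel q x y) : OSL.mk q x = OSL.mk q y :=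
  RingQuot.mkAlgHom_rel ℂ h

theorem OSL.isQMat_u (q : ℂˣ) : IsQMat q (OSL.u q) where
  ab := by simpa [OSL.u] using OSL.mk_rel (OSL.Rel.ab (q := q))
  ac := by simpa [OSL.u] using OSL.mk_rel (OSL.Rel.ac (q := q))
  bd := by simpa [OSL.u] using OSL.mk_rel (OSL.Rel.bd (q := q))
  cd := by simpa [OSL.u] using OSL.mk_rel (OSL.Rel.cd (q := q))
  bc := by simpa [OSL.u] using OSL.mk_rel (OSL.Rel.bc (q := q))
  ad := by simpa [OSL.u] using OSL.mk_rel (OSL.Rel.ad (q := q))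
  da := by simpa [OSL.u] using OSL.mk_rel (OSL.Rel.da (q := q))

/-- The universal property of `O(SL_q(2))`: a matrix satisfying the relations determines an
algebra homomorphism. -/
def OSL.lift {q : ℂˣ} {B : Type*} [Ring B] [Algebra ℂ B] (m : Fin 2 → Fin 2 → B)
    (h : IsQMat q m) : OSL q →ₐ[ℂ] B :=
  RingQuot.liftAlgHom ℂ (s := OSL.Rel q) ⟨FreeAlgebra.lift ℂ (fun p => m p.1 p.2), by
    intro x y hxy
    cases hxy
    · simpa [gen] using h.ab
    · simpa [gen] using h.ac
    · simpa [gen] using h.bd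
    · simpa [gen] using h.cd
    · simpa [gen] using h.bc
    · simpa [gen] using h.ad
    · simpa [gen] using h.da⟩

@[simp]
theorem OSL.lift_u {q : ℂˣ} {B : Type*} [Ring B] [Algebra ℂ B] (m : Fin 2 → Fin 2 → B)
    (h : IsQMat q m) (i j : Fin 2) : OSL.lift m h (OSL.u q i j) = m i j := by
  unfold OSL.lift OSL.u OSL.mk
  erw [RingQuot.liftAlgHom_mkAlgHom_apply]
  simp [gen]

theorem OSL.hom_ext {q : ℂˣ} {B : Type*} [Semiring B] [Algebra ℂ B] {f g : OSL q →ₐ[ℂ] B}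
    (h : ∀ i j, f (OSL.u q i j) = g (OSL.u q i j)) : f = g := by
  apply RingQuot.ringQuot_ext' (S := ℂ)
  apply FreeAlgebra.hom_ext
  funext p
  exact h p.1 p.2

/-- Products in normal order, for a matrix satisfying the relations. -/
theorem IsQMat.normal {q : ℂˣ} {B : Type*} [Ring B] [Algebra ℂ B] {m : Fin 2 → Fin 2 → B}
    (h : IsQMat q m) :
    m 0 1 * m 0 0 = (q : ℂ)⁻¹ • (m 0 0 * m 0 1) ∧ m 1 0 * m 0 0 = (q : ℂ)⁻¹ • (m 0 0 * m 1 0) ∧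
    m 1 1 * m 0 1 = (q : ℂ)⁻¹ • (m 0 1 * m 1 1) ∧ m 1 1 * m 1 0 = (q : ℂ)⁻¹ • (m 1 0 * m 1 1) ∧
    m 1 0 * m 0 1 = m 0 1 * m 1 0 ∧ m 0 0 * m 1 1 = 1 + (q : ℂ) • (m 0 1 * m 1 0) ∧
    m 1 1 * m 0 0 = 1 + (q : ℂ)⁻¹ • (m 0 1 * m 1 0) := by
  have hq : (q : ℂ) ≠ 0 := q.ne_zero
  refine ⟨?_, ?_, ?_, ?_, h.bc.symm, sub_eq_iff_eq_add.mp h.ad, sub_eq_iff_eq_add.mp h.da⟩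
  · rw [h.ab, smul_smul, inv_mul_cancel₀ hq, one_smul]
  · rw [h.ac, smul_smul, inv_mul_cancel₀ hq, one_smul]
  · rw [h.bd, smul_smul, inv_mul_cancel₀ hq, one_smul]
  · rw [h.cd, smul_smul, inv_mul_cancel₀ hq, one_smul]

theorem OSL.isQMat_comul (q : ℂˣ) :
    IsQMat q (fun i j => ∑ k, OSL.u q i k ⊗ₜ[ℂ] OSL.u q k j) := by
  have hq : (q : ℂ) ≠ 0 := q.ne_zero
  obtain ⟨h1, h2, h3, h4, h5, h6, h7⟩ := (OSL.isQMat_u q).normal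
  constructor <;>
  simp only [Fin.sum_univ_two, add_mul, mul_add, Algebra.TensorProduct.tmul_mul_tmul,
    h1, h2, h3, h4, h5, h6, h7, TensorProduct.add_tmul, TensorProduct.tmul_add,
    TensorProduct.tmul_smul, ← TensorProduct.smul_tmul', smul_add,
    Algebra.TensorProduct.one_def] <;>
  match_scalars <;> field_simp <;> ring

/-- The coproduct `Δ(u^i_j) = u^i_k ⊗ u^k_j`. -/
def OSL.comulHom (q : ℂˣ) : OSL q →ₐ[ℂ] OSL q ⊗[ℂ] OSL q := OSL.lift _ (OSL.isQMat_comul q)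

/-- The counit `ε(u^i_j) = δ^i_j`. -/
def OSL.counitHom (q : ℂˣ) : OSL q →ₐ[ℂ] ℂ :=
  OSL.lift (fun i j => if i = j then 1 else 0) (by constructor <;> simp)

instance (q : ℂˣ) : Bialgebra ℂ (OSL q) :=
  Bialgebra.ofAlgHom (OSL.comulHom q) (OSL.counitHom q)
    (by
      apply OSL.hom_ext
      intro i j
      simp [OSL.comulHom, TensorProduct.add_tmul, TensorProduct.tmul_add]
      abel)
    (by
      apply OSL.hom_ext
      intro i j
      fin_cases i <;> fin_cases j <;> simp [OSL.comulHom, OSL.counitHom])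
    (by
      apply OSL.hom_ext
      intro i j
      fin_cases i <;> fin_cases j <;> simp [OSL.comulHom, OSL.counitHom])

/-! ### Functionals on `O(SL_q(2))`, with `q = s²` (so `s` is a fixed square root of `q`) -/

/-- The dual of `O(SL_q(2))` with the convolution product `(fg)(a) = f(a₍₁₎) g(a₍₂₎)`. -/
abbrev Dual (s : ℂˣ) : Type := WithConv (OSL (s ^ 2) →ₗ[ℂ] ℂ)

/-- The character (algebra homomorphism to `ℂ`) `u ↦ diag(x, y)`, where `x y = 1`. -/
def diagChar (q : ℂˣ) (x y : ℂ) (h : x * y = 1) : OSL q →ₐ[ℂ] ℂ :=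
  OSL.lift (fun i j => !![x, 0; 0, y] i j)
    (by constructor <;> simp [h, mul_comm y x])

/-- `K = diag(q^{-1/2}, q^{1/2})`. -/
def fK (s : ℂˣ) : Dual s :=
  WithConv.toConv (diagChar (s ^ 2) (s : ℂ)⁻¹ s (by simp)).toLinearMap

/-- `K⁻¹ = diag(q^{1/2}, q^{-1/2})`. -/
def fKinv (s : ℂˣ) : Dual s :=
  WithConv.toConv (diagChar (s ^ 2) s (s : ℂ)⁻¹ (by simp)).toLinearMap

/-- The sign `ν = ±1` as a complex number. -/
def sgn (ν : ℤˣ) : ℂ := ((ν : ℤ) : ℂ)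

/-- The character `ε_±`, `u ↦ ν · 1`. For `ν = 1` it is the counit. -/
def fEps (s : ℂˣ) (ν : ℤˣ) : Dual s :=
  WithConv.toConv (diagChar (s ^ 2) (sgn ν) (sgn ν)
    (by rw [sgn, ← Int.cast_mul]; simp)).toLinearMap

/-- The algebra homomorphism `a ↦ (K⁻¹(a), E(a); 0, K(a))`. That it is multiplicative says
`Δ(E) = E ⊗ K + K⁻¹ ⊗ E`. On generators `E = (0, 0; 1, 0)`. -/
def homE (s : ℂˣ) : OSL (s ^ 2) →ₐ[ℂ] Matrix (Fin 2) (Fin 2) ℂ :=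
  OSL.lift (fun i j =>
      !![!![(s : ℂ), 0; 0, (s : ℂ)⁻¹] i j, !![0, 0; 1, 0] i j; 0, !![(s : ℂ)⁻¹, 0; 0, (s : ℂ)] i j])
    (by
      have hs : (s : ℂ) ≠ 0 := s.ne_zero
      constructor <;> ext i j <;> fin_cases i <;> fin_cases j <;> simp <;> field_simp)

/-- The functional `E`. -/
def fE (s : ℂˣ) : Dual s :=
  WithConv.toConv (Matrix.entryLinearMap ℂ ℂ (0 : Fin 2) (1 : Fin 2) ∘ₗ (homE s).toLinearMap)

/-- The algebra homomorphism `a ↦ (K⁻¹(a), F(a); 0, K(a))`. That it is multiplicative says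
`Δ(F) = F ⊗ K + K⁻¹ ⊗ F`. On generators `F = (0, 1; 0, 0)`. -/
def homF (s : ℂˣ) : OSL (s ^ 2) →ₐ[ℂ] Matrix (Fin 2) (Fin 2) ℂ :=
  OSL.lift (fun i j =>
      !![!![(s : ℂ), 0; 0, (s : ℂ)⁻¹] i j, !![0, 1; 0, 0] i j; 0, !![(s : ℂ)⁻¹, 0; 0, (s : ℂ)] i j])
    (by
      have hs : (s : ℂ) ≠ 0 := s.ne_zero
      constructor <;> ext i j <;> fin_cases i <;> fin_cases j <;> simp <;> field_simp)

/-- The functional `F`. -/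
def fF (s : ℂˣ) : Dual s :=
  WithConv.toConv (Matrix.entryLinearMap ℂ ℂ (0 : Fin 2) (1 : Fin 2) ∘ₗ (homF s).toLinearMap)

/-- `q = s²` as a complex number. -/
def qq (s : ℂˣ) : ℂ := (s : ℂ) ^ 2

/-- `q̂ = q - q⁻¹`. -/
def qhat (s : ℂˣ) : ℂ := qq s - (qq s)⁻¹

/-- `[2] = q + q⁻¹`. -/
def two (s : ℂˣ) : ℂ := qq s + (qq s)⁻¹

/-- The matrix `Č^{ij} = q^{-1/2} δ^i_1 δ^j_2 - q^{1/2} δ^i_2 δ^j_1`. -/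
def Ccheck (s : ℂˣ) : Matrix (Fin 2) (Fin 2) ℂ := !![0, (s : ℂ)⁻¹; -(s : ℂ), 0]

/-- The matrix `Ĉ_{ij} = -Č^{ij}`. -/
def Chat (s : ℂˣ) : Matrix (Fin 2) (Fin 2) ℂ := -Ccheck s

/-- The map `a ↦ a₍₁₎ f(a₍₂₎)`. -/
def act {s : ℂˣ} (f : Dual s) : OSL (s ^ 2) →ₗ[ℂ] OSL (s ^ 2) :=
  (TensorProduct.rid ℂ (OSL (s ^ 2))).toLinearMap ∘ₗ
    f.ofConv.lTensor (OSL (s ^ 2)) ∘ₗ Coalgebra.comul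

/-! ### The `4D_±`-calculus -/

/-- Double indices `ij`, with `i, j ∈ {1, 2}` written as `0, 1`. -/
abbrev Idx : Type := Fin 2 × Fin 2

/-- The functionals `f^{ij}_{kl}` with `θ_{ij} a = a₍₁₎ f^{ij}_{kl}(a₍₂₎) θ_{kl}`. -/
def fMat (s : ℂˣ) (ν : ℤˣ) : Idx → Idx → Dual s
  | (0, 0), (0, 0) => fEps s ν
  | (0, 0), (1, 0) => ((s : ℂ)⁻¹ * qhat s) • (fEps s ν * (fF s * fK s))
  | (0, 1), (0, 0) => (-((s : ℂ) * qhat s)) • (fEps s ν * (fKinv s * fE s))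
  | (0, 1), (0, 1) => fEps s ν * (fKinv s * fKinv s)
  | (0, 1), (1, 0) => (-(qhat s ^ 2)) • (fEps s ν * (fF s * fE s))
  | (0, 1), (1, 1) => ((s : ℂ)⁻¹ * qhat s) • (fEps s ν * (fF s * fKinv s))
  | (1, 0), (1, 0) => fEps s ν * (fK s * fK s)
  | (1, 1), (1, 0) => (-((s : ℂ) * qhat s)) • (fEps s ν * (fK s * fE s))
  | (1, 1), (1, 1) => fEps s ν
  | _, _ => 0

/-- The basis `X_{ij}` of the quantum tangent space dual to `θ_{ij}`, so that
`d a = a₍₁₎ X_{ij}(a₍₂₎) θ_{ij}`. The unit `1` of the dual is the counit `ε`. -/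
def X (s : ℂˣ) (ν : ℤˣ) : Idx → Dual s
  | (0, 0) => (-(s : ℂ)) • (fEps s ν * (fKinv s * fE s))
  | (0, 1) => (qhat s)⁻¹ • (fEps s ν * (fKinv s * fKinv s) - 1)
  | (1, 0) => (-(qhat s)) • (fEps s ν * (fF s * fE s))
      - (qq s / qhat s) • (fEps s ν * (fK s * fK s) - 1)
  | (1, 1) => (s : ℂ)⁻¹ • (fEps s ν * (fF s * fKinv s))

/-- The unital subalgebra of the dual generated by the quantum tangent space. -/
def Xalg (s : ℂˣ) (ν : ℤˣ) : Subalgebra ℂ (Dual s) := Algebra.adjoin ℂ (Set.range (X s ν))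

/-- The matrix of the braiding, `σ(θ_m ⊗ θ_n) = σ^{p,r}_{m,n} θ_p ⊗ θ_r` with
`σ^{ij,kl}_{mn,rs} = f^{mn}_{kl}(u^i_r u^j_s)`. -/
def sigmaCoeff (s : ℂˣ) (ν : ℤˣ) (p r m n : Idx) : ℂ :=
  (fMat s ν m r).ofConv (OSL.u (s ^ 2) p.1 n.1 * OSL.u (s ^ 2) p.2 n.2)

/-- The metric `g(θ_p ⊗ θ_r)`, with scale `c`. -/
def gMat (s : ℂˣ) (c : ℂ) : Idx → Idx → ℂ
  | (0, 0), (1, 1) => -c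
  | (0, 1), (1, 0) => c
  | (1, 0), (0, 1) => c
  | (1, 1), (0, 0) => -(qq s ^ 2) * c
  | (0, 1), (0, 1) => qhat s * c
  | _, _ => 0

/-! ### The quantum Clifford algebra -/

/-- The free algebra on the elements of `O(SL_q(2))` and the symbols `θ_{ij}`. -/
abbrev Pre (s : ℂˣ) : Type := FreeAlgebra ℂ (OSL (s ^ 2) ⊕ Idx)

/-- An element of `O(SL_q(2))` in the free algebra. -/
def preA (s : ℂˣ) (a : OSL (s ^ 2)) : Pre s := FreeAlgebra.ι ℂ (Sum.inl a)

/-- The symbol `θ_{ij}` in the free algebra. -/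
def preTheta (s : ℂˣ) (p : Idx) : Pre s := FreeAlgebra.ι ℂ (Sum.inr p)

/-- The relations of the quantum Clifford algebra. The first four make `O(SL_q(2))` act and
`θ_{ij}` generate the bimodule `Γ`, so that the quotient by them is the tensor algebra of `Γ`
over `O(SL_q(2))`. The last one is `ρ = g(ρ)` for all `ρ = x_{pr} θ_p ⊗ θ_r` in the kernel of
`id - σ`, where the coefficients `x_{pr}` lie in `O(SL_q(2))`. -/
inductive Cl.Rel (s : ℂˣ) (ν : ℤˣ) (c : ℂ) : Pre s → Pre s → Prop
  | add (a b : OSL (s ^ 2)) : Cl.Rel s ν c (preA s (a + b)) (preA s a + preA s b)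
  | mul (a b : OSL (s ^ 2)) : Cl.Rel s ν c (preA s (a * b)) (preA s a * preA s b)
  | scalar (z : ℂ) : Cl.Rel s ν c (preA s (algebraMap ℂ _ z)) (algebraMap ℂ _ z)
  | bimod (p : Idx) (a : OSL (s ^ 2)) : Cl.Rel s ν c (preTheta s p * preA s a)
      (∑ r, preA s (act (fMat s ν p r) a) * preTheta s r)
  | cliff (x : Idx → Idx → OSL (s ^ 2))
      (hx : ∀ p r, ∑ m, ∑ n, sigmaCoeff s ν p r m n • x m n = x p r) :
      Cl.Rel s ν c (∑ p, ∑ r, preA s (x p r) * preTheta s p * preTheta s r)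
        (∑ p, ∑ r, gMat s c p r • preA s (x p r))

/-- The quantum Clifford algebra `Cl(Γ, σ, g)`. -/
def Cl (s : ℂˣ) (ν : ℤˣ) (c : ℂ) : Type := RingQuot (Cl.Rel s ν c)

instance (s : ℂˣ) (ν : ℤˣ) (c : ℂ) : Ring (Cl s ν c) :=
  inferInstanceAs (Ring (RingQuot (Cl.Rel s ν c)))

instance (s : ℂˣ) (ν : ℤˣ) (c : ℂ) : Algebra ℂ (Cl s ν c) :=
  inferInstanceAs (Algebra ℂ (RingQuot (Cl.Rel s ν c)))

/-- The quotient map. -/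
def Cl.mk (s : ℂˣ) (ν : ℤˣ) (c : ℂ) : Pre s →ₐ[ℂ] Cl s ν c := RingQuot.mkAlgHom ℂ (Cl.Rel s ν c)

theorem Cl.mk_rel {s : ℂˣ} {ν : ℤˣ} {c : ℂ} {x y} (h : Cl.Rel s ν c x y) :
    Cl.mk s ν c x = Cl.mk s ν c y :=
  RingQuot.mkAlgHom_rel ℂ h

/-- The algebra homomorphism `O(SL_q(2)) → Cl(Γ, σ, g)`. -/
def Cl.ofA (s : ℂˣ) (ν : ℤˣ) (c : ℂ) : OSL (s ^ 2) →ₐ[ℂ] Cl s ν c where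
  toFun a := Cl.mk s ν c (preA s a)
  map_one' := by simpa using Cl.mk_rel (Cl.Rel.scalar (s := s) (ν := ν) (c := c) 1)
  map_mul' a b := by simpa using Cl.mk_rel (Cl.Rel.mul (ν := ν) (c := c) a b)
  map_zero' := by simpa using Cl.mk_rel (Cl.Rel.scalar (s := s) (ν := ν) (c := c) 0)
  map_add' a b := by simpa using Cl.mk_rel (Cl.Rel.add (ν := ν) (c := c) a b)
  commutes' z := by simpa using Cl.mk_rel (Cl.Rel.scalar (s := s) (ν := ν) (c := c) z)

/-- The element `θ_{ij}` of the quantum Clifford algebra. -/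
def Cl.theta (s : ℂˣ) (ν : ℤˣ) (c : ℂ) (p : Idx) : Cl s ν c := Cl.mk s ν c (preTheta s p)

/-! ### The spinor module `S₀⁺` -/

/-- `ψ⁺₁ = q/([2]c) θ₁₁θ₁₂θ₂₁θ₂₂` and `ψ⁺₂ = θ₂₁θ₂₂`. -/
def psi (s : ℂˣ) (ν : ℤˣ) (c : ℂ) : Fin 2 → Cl s ν c :=
  ![(qq s / (two s * c)) • (Cl.theta s ν c (0, 0) * Cl.theta s ν c (0, 1) *
      Cl.theta s ν c (1, 0) * Cl.theta s ν c (1, 1)),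
    Cl.theta s ν c (1, 0) * Cl.theta s ν c (1, 1)]

/-- The linear map `a ↦ a ψ⁺_i` into the quantum Clifford algebra. -/
def mulPsi (s : ℂˣ) (ν : ℤˣ) (c : ℂ) (i : Fin 2) : OSL (s ^ 2) →ₗ[ℂ] Cl s ν c :=
  LinearMap.mulRight ℂ (psi s ν c i) ∘ₗ (Cl.ofA s ν c).toLinearMap

/-- `S₀⁺ = A ψ⁺₁ + A ψ⁺₂` inside the quantum Clifford algebra, where `A = O(SL_q(2))`. -/
def S0plus (s : ℂˣ) (ν : ℤˣ) (c : ℂ) : Submodule ℂ (Cl s ν c) :=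
  ⨆ i, LinearMap.range (mulPsi s ν c i)

/-- The linear map `a ↦ a ψ⁺_i` into `S₀⁺`. -/
def toS (s : ℂˣ) (ν : ℤˣ) (c : ℂ) (i : Fin 2) : OSL (s ^ 2) →ₗ[ℂ] S0plus s ν c :=
  (mulPsi s ν c i).codRestrict _ fun a =>
    Submodule.mem_iSup_of_mem i (LinearMap.mem_range_self _ a)

/-! ### The crossed product `Ã = O(SL_q(2)) ⋊ ℂ[χ, χ⁻¹]` and its coaction -/

/-- The algebra endomorphism `u^i_j ↦ t^{j-i} u^i_j`. -/
def scaleHom (q t : ℂˣ) : OSL q →ₐ[ℂ] OSL q :=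
  OSL.lift (fun i j => ((t ^ ((j : ℤ) - (i : ℤ)) : ℂˣ) : ℂ) • OSL.u q i j) (by
    have ht : (t : ℂ) ≠ 0 := t.ne_zero
    have hq : (q : ℂ) ≠ 0 := q.ne_zero
    obtain ⟨h1, h2, h3, h4, h5, h6, h7⟩ := (OSL.isQMat_u q).normal
    constructor <;> simp [h1, h2, h3, h4, h5, h6, h7, smul_smul, ht] <;>
      match_scalars <;> field_simp)

/-- The algebra automorphism `χ ▷ u^i_j = q^{j-i} u^i_j`. -/
def chiAut (q : ℂˣ) : OSL q ≃ₐ[ℂ] OSL q :=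
  AlgEquiv.ofAlgHom (scaleHom q q) (scaleHom q q⁻¹)
    (by
      apply OSL.hom_ext
      intro i j
      fin_cases i <;> fin_cases j <;> simp [scaleHom, smul_smul])
    (by
      apply OSL.hom_ext
      intro i j
      fin_cases i <;> fin_cases j <;> simp [scaleHom, smul_smul])

/-- The action of the powers of `χ` on `O(SL_q(2))`. -/
instance (q : ℂˣ) : MulSemiringAction (Multiplicative ℤ) (OSL q) :=
  MulSemiringAction.compHom (OSL q) (zpowersHom (OSL q ≃ₐ[ℂ] OSL q) (chiAut q))

/-- The left crossed product algebra, with `(a χ^k)(b χ^l) = a (χ^k ▷ b) χ^{k+l}`. -/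
abbrev Atilde (q : ℂˣ) : Type := SkewMonoidAlgebra (OSL q) (Multiplicative ℤ)

/-- The linear map `a ↦ a χ`. -/
def timesChi (q : ℂˣ) : OSL q →ₗ[ℂ] Atilde q where
  toFun a := SkewMonoidAlgebra.single 1 a * SkewMonoidAlgebra.single (Multiplicative.ofAdd 1) 1
  map_add' a b := by simp [SkewMonoidAlgebra.single_add, add_mul]
  map_smul' z a := by simp [SkewMonoidAlgebra.single_mul_single, SkewMonoidAlgebra.smul_single]

/-- `Δ_R` is the right coaction of `Ã` on `S₀⁺`:
`Δ_R(a ψ⁺_i) = a₍₁₎ ψ⁺_j ⊗ a₍₂₎ u^j_i χ`. These values determine `Δ_R`. -/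
def IsSpinCoaction (s : ℂˣ) (ν : ℤˣ) (c : ℂ)
    (ΔR : S0plus s ν c →ₗ[ℂ] S0plus s ν c ⊗[ℂ] Atilde (s ^ 2)) : Prop :=
  ∀ (i : Fin 2) (a : OSL (s ^ 2)), ΔR (toS s ν c i a) =
    ∑ j, TensorProduct.map (toS s ν c j)
      (timesChi (s ^ 2) ∘ₗ LinearMap.mulRight ℂ (OSL.u (s ^ 2) j i)) (Coalgebra.comul a)

/-! ### Invariant differential operators -/

/-- `∂(a ψ⁺_i) = a₍₁₎ p_{j,i}(a₍₂₎) ψ⁺_j`. These values determine `∂`. -/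
def HasSymbol (s : ℂˣ) (ν : ℤˣ) (c : ℂ) (p : Fin 2 → Fin 2 → Dual s)
    (D : Module.End ℂ (S0plus s ν c)) : Prop :=
  ∀ (i : Fin 2) (a : OSL (s ^ 2)), D (toS s ν c i a) = ∑ j, toS s ν c j (act (p j i) a)

/-- Left-invariant differential operators on `S₀⁺` with respect to the `4D_±`-calculus. -/
def IsLeftInvariantDO (s : ℂˣ) (ν : ℤˣ) (c : ℂ) (D : Module.End ℂ (S0plus s ν c)) : Prop :=
  ∃ p : Fin 2 → Fin 2 → Dual s, (∀ i j, p i j ∈ Xalg s ν) ∧ HasSymbol s ν c p D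

/-- Invariant differential operators on `S₀⁺`: left-invariant ones that commute with the right
coaction, `Δ_R(∂ψ) = (∂ ⊗ id) Δ_R(ψ)`. -/
def IsInvariantDO (s : ℂˣ) (ν : ℤˣ) (c : ℂ)
    (ΔR : S0plus s ν c →ₗ[ℂ] S0plus s ν c ⊗[ℂ] Atilde (s ^ 2))
    (D : Module.End ℂ (S0plus s ν c)) : Prop :=
  IsLeftInvariantDO s ν c D ∧ ∀ ψ, ΔR (D ψ) = D.rTensor (Atilde (s ^ 2)) (ΔR ψ)

/-- `X_{ij} + q^{1/2} Č^{ij} / q̂`. -/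
def Xshift (s : ℂˣ) (ν : ℤˣ) (i j : Fin 2) : Dual s :=
  X s ν (i, j) + ((s : ℂ) * Ccheck s i j / qhat s) • 1

/-- `D⁰_{ij} = -1/[2] Č^{ij} Ĉ_{kl} (X_{kl} + q^{1/2} Č^{kl} / q̂)`. -/
def D0 (s : ℂˣ) (ν : ℤˣ) (i j : Fin 2) : Dual s :=
  (-(1 / two s) * Ccheck s i j) • ∑ k, ∑ l, Chat s k l • Xshift s ν k l

/-- `D¹_{ij} = X_{ij} + q^{1/2} Č^{ij} / q̂ - D⁰_{ij}`. -/
def D1 (s : ℂˣ) (ν : ℤˣ) (i j : Fin 2) : Dual s := Xshift s ν i j - D0 s ν i j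

/-- For functionals `D_{kj}`, the symbol of the operator
`a ψ⁺_i ↦ a₍₁₎ D_{kj}(a₍₂₎) Ĉ_{ji} ψ⁺_k`. -/
def symbolOf (s : ℂˣ) (D : Fin 2 → Fin 2 → Dual s) (k i : Fin 2) : Dual s :=
  ∑ j, Chat s j i • D k j

/-- The polynomial `y² + q⁻¹ q̂ x y - q⁻² x² + q⁻¹ / q̂²` in two commuting variables
`x = X 0` and `y = X 1`. -/
def relPoly (s : ℂˣ) : MvPolynomial (Fin 2) ℂ :=
  MvPolynomial.X 1 ^ 2
    + MvPolynomial.C ((qq s)⁻¹ * qhat s) * MvPolynomial.X 0 * MvPolynomial.X 1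
    - MvPolynomial.C ((qq s)⁻¹ ^ 2) * MvPolynomial.X 0 ^ 2
    + MvPolynomial.C ((qq s)⁻¹ / qhat s ^ 2)

end QSpin

end

open scoped TensorProduct

noncomputable section

namespace QSpin

variable {s : ℂˣ}

/-! ### The actions of functionals on `O(SL_q(2))` -/

/-! Write A for O(SL_q(2)). Once ψ⁺₁ and ψ⁺₂ are known to be free over A, an operator `a ψ_i ↦ a₍₁₎
p_{ji}(a₍₂₎) ψ_j` is the same as its 2×2 matrix p of functionals, composition is the matrix product
over the convolution algebra, and commuting with the coaction becomes one identity for p,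
`IsEquivariant` (`opHom_injective`, `opHom_comm_iff`). The theorem is then a statement about
equivariant matrices with entries in the algebra generated by the X_{ij}.

Freeness. The scalar 4×4 matrices `gam` satisfy the Clifford relations. Conjugation by an invertible
matrix of functionals, `twist`, preserves these relations and turns γ_p into Σ_k γ_k f_{pk}, which
has the required commutation rule with A (`twist_mul_thetaMat`). The resulting representation
`clRep` separates Aψ⁺₁ from Aψ⁺₂ (`mulPsi_independent`).

Existence. Let Z be the Casimir functional `eZ`, κ = ε_± K⁻² (`eK`), and W the symbol of ∂₀ + ∂₁
(`symW`). The symbol of ∂₀ is a multiple of the scalar matrix Z. Two exchange identities between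
functionals and generators, `lA_intertwines` and `lH_intertwines`, make W equivariant. A
Cayley–Hamilton identity, W² = q^{-1/2} q̂ Z W - q⁻¹/q̂² (`symW_mul_self`), is the relation of the
theorem in other variables. It also makes Z a linear combination of W and W⁻¹, hence equivariant.

Uniqueness. Equivariance forces the first entry of p to commute with K, so that it is a polynomial
in Z and κ (`mem_torusAlg_of_commute`), and this entry determines p (`IsEquivariant.ext`).
Commutation with E gives a q-difference equation in κ, and since q is not a root of unity its
solutions have degree at most one. Hence p = P₀(Z) + P₁(Z) W (`exists_symNF_of_isEquivariant`). The
coefficients are unique because polynomials in Z and κ stay independent after multiplication by E²,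
as is seen on the vectors Fⁱ v for v an even power of u²₂ (`eq_zero_of_evalZK_mul_eq_zero`). The
quotient of ℂ[x, y] has the same normal form (`exists_polyNF`), so the two algebras agree. -/

theorem act_apply_of_comul (f : Dual s) (a : OSL (s ^ 2)) :
    act f a = TensorProduct.rid ℂ (OSL (s ^ 2))
      (f.ofConv.lTensor (OSL (s ^ 2)) (Coalgebra.comul a)) :=
  rfl

/-- The map `a ↦ f(a₍₁₎) a₍₂₎`. -/
def lact (f : Dual s) : OSL (s ^ 2) →ₗ[ℂ] OSL (s ^ 2) :=
  (TensorProduct.lid ℂ (OSL (s ^ 2))).toLinearMap ∘ₗ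
    f.ofConv.rTensor (OSL (s ^ 2)) ∘ₗ Coalgebra.comul

theorem lact_apply_of_comul (f : Dual s) (a : OSL (s ^ 2)) :
    lact f a = TensorProduct.lid ℂ (OSL (s ^ 2))
      (f.ofConv.rTensor (OSL (s ^ 2)) (Coalgebra.comul a)) :=
  rfl

/-- By coassociativity both sides send a to a₍₁₎ f(a₍₂₎) g(a₍₃₎). -/
theorem act_mul (f g : Dual s) : act (f * g) = act f ∘ₗ act g := by
  have h1 : ∀ t : OSL (s ^ 2) ⊗[ℂ] OSL (s ^ 2),
      act f (TensorProduct.rid ℂ _ (g.ofConv.lTensor _ t)) =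
        TensorProduct.rid ℂ _ ((LinearMap.mul' ℂ ℂ ∘ₗ
          TensorProduct.map f.ofConv g.ofConv).lTensor _
          (TensorProduct.assoc ℂ _ _ _ (Coalgebra.comul.rTensor _ t))) := by
    intro t
    induction t with
    | zero => simp
    | add x y hx hy => simp only [map_add, hx, hy]
    | tmul x y =>
      simp only [LinearMap.lTensor_tmul, TensorProduct.rid_tmul, map_smul, act_apply_of_comul,
        LinearMap.rTensor_tmul]
      induction Coalgebra.comul (R := ℂ) x using TensorProduct.induction_on with
      | zero => simp
      | add x y hx hy => simp only [map_add, hx, hy, smul_add, TensorProduct.add_tmul]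
      | tmul x z => simp [smul_smul, mul_comm]
  ext a
  have h2 := h1 (Coalgebra.comul a)
  rw [Coalgebra.coassoc_apply] at h2
  rw [LinearMap.comp_apply, act_apply_of_comul g, h2,
    ← LinearMap.comp_apply (LinearMap.lTensor _ _),
    ← LinearMap.lTensor_comp]
  rfl

theorem lact_mul (f g : Dual s) : lact (f * g) = lact g ∘ₗ lact f := by
  have h1 : ∀ t : OSL (s ^ 2) ⊗[ℂ] OSL (s ^ 2),
      lact g (TensorProduct.lid ℂ _ (f.ofConv.rTensor _ t)) =
        TensorProduct.lid ℂ _ ((LinearMap.mul' ℂ ℂ ∘ₗ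
          TensorProduct.map f.ofConv g.ofConv).rTensor _
          ((TensorProduct.assoc ℂ _ _ _).symm (Coalgebra.comul.lTensor _ t))) := by
    intro t
    induction t with
    | zero => simp
    | add x y hx hy => simp only [map_add, hx, hy]
    | tmul x y =>
      simp only [LinearMap.rTensor_tmul, TensorProduct.lid_tmul, map_smul, lact_apply_of_comul,
        LinearMap.lTensor_tmul]
      induction Coalgebra.comul (R := ℂ) y using TensorProduct.induction_on with
      | zero => simp
      | add x y hx hy => simp only [map_add, hx, hy, smul_add, TensorProduct.tmul_add]
      | tmul x z => simp [smul_smul]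
  ext a
  have h2 := h1 (Coalgebra.comul a)
  rw [Coalgebra.coassoc_symm_apply] at h2
  rw [LinearMap.comp_apply, lact_apply_of_comul f, h2,
    ← LinearMap.comp_apply (LinearMap.rTensor _ _),
    ← LinearMap.rTensor_comp]
  rfl

/-- By coassociativity both sides are g(a₍₁₎) a₍₂₎ f(a₍₃₎). -/
theorem act_lact_comm (f g : Dual s) (a : OSL (s ^ 2)) :
    act f (lact g a) = lact g (act f a) := by
  have h1 : ∀ t : OSL (s ^ 2) ⊗[ℂ] OSL (s ^ 2),
      lact g (TensorProduct.rid ℂ _ (f.ofConv.lTensor _ t)) =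
        TensorProduct.lid ℂ _ (TensorProduct.map g.ofConv
          ((TensorProduct.rid ℂ (OSL (s ^ 2))).toLinearMap ∘ₗ f.ofConv.lTensor _)
          (TensorProduct.assoc ℂ _ _ _ (Coalgebra.comul.rTensor _ t))) := by
    intro t
    induction t with
    | zero => simp
    | add x y hx hy => simp only [map_add, hx, hy]
    | tmul x y =>
      simp only [LinearMap.lTensor_tmul, TensorProduct.rid_tmul, map_smul, lact_apply_of_comul,
        LinearMap.rTensor_tmul]
      induction Coalgebra.comul (R := ℂ) x using TensorProduct.induction_on with
      | zero => simp
      | add x y hx hy => simp only [map_add, hx, hy, smul_add, TensorProduct.add_tmul]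
      | tmul x z => simp [smul_smul]
  have h3 : ∀ t : OSL (s ^ 2) ⊗[ℂ] OSL (s ^ 2),
      act f (TensorProduct.lid ℂ _ (g.ofConv.rTensor _ t)) =
        TensorProduct.lid ℂ _ (TensorProduct.map g.ofConv
          ((TensorProduct.rid ℂ (OSL (s ^ 2))).toLinearMap ∘ₗ f.ofConv.lTensor _)
          (Coalgebra.comul.lTensor _ t)) := by
    intro t
    induction t with
    | zero => simp
    | add x y hx hy => simp only [map_add, hx, hy]
    | tmul x y => simp [act_apply_of_comul]
  rw [act_apply_of_comul f a, h1, Coalgebra.coassoc_apply, lact_apply_of_comul g a, h3]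

theorem act_add (f g : Dual s) : act (f + g) = act f + act g := by
  ext a; simp [act_apply_of_comul, LinearMap.lTensor_add]

theorem act_smul (x : ℂ) (f : Dual s) : act (x • f) = x • act f := by
  ext a; simp [act_apply_of_comul, LinearMap.lTensor_smul]

theorem lact_add (f g : Dual s) : lact (f + g) = lact f + lact g := by
  ext a; simp [lact_apply_of_comul, LinearMap.rTensor_add]

theorem lact_smul (x : ℂ) (f : Dual s) : lact (x • f) = x • lact f := by
  ext a; simp [lact_apply_of_comul, LinearMap.rTensor_smul]

theorem act_one : act (1 : Dual s) = LinearMap.id := by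
  ext a
  have : (1 : Dual s).ofConv = Coalgebra.counit := by
    ext x; exact LinearMap.convOne_apply (R := ℂ) x
  rw [act_apply_of_comul, this, Coalgebra.lTensor_counit_comul]
  simp

/-- The action of functionals on `O(SL_q(2))` as a homomorphism of algebras. -/
def actHom (s : ℂˣ) : Dual s →ₐ[ℂ] Module.End ℂ (OSL (s ^ 2)) :=
  AlgHom.ofLinearMap
    { toFun := act
      map_add' := act_add
      map_smul' := act_smul } act_one act_mul

@[simp]
theorem actHom_apply (f : Dual s) : actHom s f = act f := rfl

/-- The left action as a linear map. -/
def lactLin (s : ℂˣ) : Dual s →ₗ[ℂ] Module.End ℂ (OSL (s ^ 2)) where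
  toFun := lact
  map_add' := lact_add
  map_smul' := lact_smul

theorem apply_act (g f : Dual s) (a : OSL (s ^ 2)) : g.ofConv (act f a) = (g * f).ofConv a := by
  rw [act_apply_of_comul]
  change _ = LinearMap.mul' ℂ ℂ (TensorProduct.map g.ofConv f.ofConv (Coalgebra.comul a))
  induction Coalgebra.comul (R := ℂ) a using TensorProduct.induction_on with
  | zero => simp
  | add x y hx hy => simp only [map_add, hx, hy]
  | tmul x z => simp [mul_comm]

theorem apply_lact (g f : Dual s) (a : OSL (s ^ 2)) : g.ofConv (lact f a) = (f * g).ofConv a := by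
  rw [lact_apply_of_comul]
  change _ = LinearMap.mul' ℂ ℂ (TensorProduct.map f.ofConv g.ofConv (Coalgebra.comul a))
  induction Coalgebra.comul (R := ℂ) a using TensorProduct.induction_on with
  | zero => simp
  | add x y hx hy => simp only [map_add, hx, hy]
  | tmul x z => simp

/-- The functional is recovered by composing its action with the counit. Identities in the dual can
therefore be checked on operators, where induction over products of generators is available. -/
theorem act_injective : Function.Injective (act : Dual s → _) := by
  intro f g h
  apply WithConv.ofConv_injective
  ext a
  rw [← one_mul f, ← one_mul g, ← apply_act, ← apply_act, h]

theorem comul_u (i j : Fin 2) : Coalgebra.comul (R := ℂ) (OSL.u (s ^ 2) i j) =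
    ∑ k, OSL.u (s ^ 2) i k ⊗ₜ[ℂ] OSL.u (s ^ 2) k j :=
  OSL.lift_u _ _ i j

theorem act_u (f : Dual s) (i j : Fin 2) :
    act f (OSL.u (s ^ 2) i j) = ∑ k, f.ofConv (OSL.u (s ^ 2) k j) • OSL.u (s ^ 2) i k := by
  simp [act_apply_of_comul, comul_u]

theorem lact_u (f : Dual s) (i j : Fin 2) :
    lact f (OSL.u (s ^ 2) i j) = ∑ k, f.ofConv (OSL.u (s ^ 2) i k) • OSL.u (s ^ 2) k j := by
  simp [lact_apply_of_comul, comul_u]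

theorem act_apply_one (f : Dual s) : act f 1 = f.ofConv 1 • 1 := by
  rw [act_apply_of_comul, Bialgebra.comul_one, Algebra.TensorProduct.one_def]
  simp

theorem lact_apply_one (f : Dual s) : lact f 1 = f.ofConv 1 • 1 := by
  rw [lact_apply_of_comul, Bialgebra.comul_one, Algebra.TensorProduct.one_def]
  simp

/-- A coproduct of f becomes a twisted Leibniz rule for its action, because Δ is multiplicative.
This handles the product step in every induction below. -/
theorem act_apply_mul {ι : Type*} (t : Finset ι) (f : Dual s) (g h : ι → Dual s)
    (hf : ∀ a b, f.ofConv (a * b) = ∑ r ∈ t, (g r).ofConv a * (h r).ofConv b)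
    (a b : OSL (s ^ 2)) : act f (a * b) = ∑ r ∈ t, act (g r) a * act (h r) b := by
  simp only [act_apply_of_comul, Bialgebra.comul_mul]
  induction Coalgebra.comul (R := ℂ) a using TensorProduct.induction_on with
  | zero => simp
  | add x y hx hy => simp only [add_mul, map_add, hx, hy, Finset.sum_add_distrib]
  | tmul x z =>
    induction Coalgebra.comul (R := ℂ) b using TensorProduct.induction_on with
    | zero => simp
    | add x y hx hy => simp only [mul_add, map_add, hx, hy, Finset.sum_add_distrib]
    | tmul y w => simp [hf, Finset.sum_smul, smul_smul, mul_comm]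

theorem lact_apply_mul {ι : Type*} (t : Finset ι) (f : Dual s) (g h : ι → Dual s)
    (hf : ∀ a b, f.ofConv (a * b) = ∑ r ∈ t, (g r).ofConv a * (h r).ofConv b)
    (a b : OSL (s ^ 2)) : lact f (a * b) = ∑ r ∈ t, lact (g r) a * lact (h r) b := by
  simp only [lact_apply_of_comul, Bialgebra.comul_mul]
  induction Coalgebra.comul (R := ℂ) a using TensorProduct.induction_on with
  | zero => simp
  | add x y hx hy => simp only [add_mul, map_add, hx, hy, Finset.sum_add_distrib]
  | tmul x z =>
    induction Coalgebra.comul (R := ℂ) b using TensorProduct.induction_on with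
    | zero => simp
    | add x y hx hy => simp only [mul_add, map_add, hx, hy, Finset.sum_add_distrib]
    | tmul y w => simp [hf, Finset.sum_smul, smul_smul, mul_comm]

theorem OSL.adjoin_u (q : ℂˣ) :
    Algebra.adjoin ℂ (Set.range fun p : Fin 2 × Fin 2 => OSL.u q p.1 p.2) = ⊤ := by
  have h : (OSL.mk q).range = ⊤ := by
    rw [AlgHom.range_eq_top]
    exact RingQuot.mkAlgHom_surjective ℂ _
  rw [← h, ← Algebra.map_top, ← FreeAlgebra.adjoin_range_ι, AlgHom.map_adjoin, ← Set.range_comp]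
  rfl

/-- A property of elements of `O(SL_q(2))` holds if it is linear, holds for scalars and the
generators, and is stable under products. -/
theorem OSL.induction {q : ℂˣ} {C : OSL q → Prop} (one : C 1)
    (smul : ∀ (z : ℂ) a, C a → C (z • a)) (add : ∀ a b, C a → C b → C (a + b))
    (mul : ∀ a b, C a → C b → C (a * b)) (u : ∀ i j, C (OSL.u q i j)) (a : OSL q) : C a := by
  have ha : a ∈ Algebra.adjoin ℂ (Set.range fun p : Fin 2 × Fin 2 => OSL.u q p.1 p.2) := by
    rw [OSL.adjoin_u]; trivial
  induction ha using Algebra.adjoin_induction with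
  | mem x hx => obtain ⟨p, rfl⟩ := hx; exact u _ _
  | algebraMap r => rw [Algebra.algebraMap_eq_smul_one]; exact smul _ _ one
  | add x y _ _ hx hy => exact add _ _ hx hy
  | mul x y _ _ hx hy => exact mul _ _ hx hy

/-! ### The relations between the functionals `K`, `E`, `F` and `ε_±` -/

theorem diagChar_u (q : ℂˣ) (x y : ℂ) (h : x * y = 1) (i j : Fin 2) :
    diagChar q x y h (OSL.u q i j) = !![x, 0; 0, y] i j :=
  OSL.lift_u _ _ i j

theorem act_char_mul (φ : OSL (s ^ 2) →ₐ[ℂ] ℂ) (a b : OSL (s ^ 2)) :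
    act (WithConv.toConv φ.toLinearMap) (a * b) =
      act (WithConv.toConv φ.toLinearMap) a * act (WithConv.toConv φ.toLinearMap) b := by
  simpa using act_apply_mul {()} (WithConv.toConv φ.toLinearMap)
    (fun _ => WithConv.toConv φ.toLinearMap) (fun _ => WithConv.toConv φ.toLinearMap)
    (by simp) a b

theorem lact_char_mul (φ : OSL (s ^ 2) →ₐ[ℂ] ℂ) (a b : OSL (s ^ 2)) :
    lact (WithConv.toConv φ.toLinearMap) (a * b) =
      lact (WithConv.toConv φ.toLinearMap) a * lact (WithConv.toConv φ.toLinearMap) b := by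
  simpa using lact_apply_mul {()} (WithConv.toConv φ.toLinearMap)
    (fun _ => WithConv.toConv φ.toLinearMap) (fun _ => WithConv.toConv φ.toLinearMap)
    (by simp) a b

theorem fK_mul (a b : OSL (s ^ 2)) : (fK s).ofConv (a * b) = (fK s).ofConv a * (fK s).ofConv b :=
  map_mul (diagChar _ _ _ _) a b

theorem fKinv_mul (a b : OSL (s ^ 2)) :
    (fKinv s).ofConv (a * b) = (fKinv s).ofConv a * (fKinv s).ofConv b :=
  map_mul (diagChar _ _ _ _) a b

theorem fK_one : (fK s).ofConv 1 = 1 := map_one (diagChar _ _ _ _)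
theorem fKinv_one : (fKinv s).ofConv 1 = 1 := map_one (diagChar _ _ _ _)
theorem fEps_one (ν : ℤˣ) : (fEps s ν).ofConv 1 = 1 := map_one (diagChar _ _ _ _)

theorem fK_u (i j : Fin 2) :
    (fK s).ofConv (OSL.u (s ^ 2) i j) = !![(s : ℂ)⁻¹, 0; 0, (s : ℂ)] i j := diagChar_u _ _ _ _ i j

theorem fKinv_u (i j : Fin 2) :
    (fKinv s).ofConv (OSL.u (s ^ 2) i j) = !![(s : ℂ), 0; 0, (s : ℂ)⁻¹] i j :=
  diagChar_u _ _ _ _ i j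

theorem fEps_u (ν : ℤˣ) (i j : Fin 2) :
    (fEps s ν).ofConv (OSL.u (s ^ 2) i j) = !![sgn ν, 0; 0, sgn ν] i j := diagChar_u _ _ _ _ i j

theorem homE_u (i j : Fin 2) : homE s (OSL.u (s ^ 2) i j) =
    !![!![(s : ℂ), 0; 0, (s : ℂ)⁻¹] i j, !![0, 0; 1, 0] i j;
      0, !![(s : ℂ)⁻¹, 0; 0, (s : ℂ)] i j] := OSL.lift_u _ _ i j

theorem homF_u (i j : Fin 2) : homF s (OSL.u (s ^ 2) i j) =
    !![!![(s : ℂ), 0; 0, (s : ℂ)⁻¹] i j, !![0, 1; 0, 0] i j;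
      0, !![(s : ℂ)⁻¹, 0; 0, (s : ℂ)] i j] := OSL.lift_u _ _ i j

/-- Triangularity holds on generators and is preserved by products, so the diagonal entries are
characters, determined by their values on generators. The upper right entry of the multiplicativity
of `homE` is then the coproduct of E. -/
theorem homE_apply (a : OSL (s ^ 2)) : homE s a =
    !![(fKinv s).ofConv a, (fE s).ofConv a; 0, (fK s).ofConv a] := by
  have h : (homE s a) 0 0 = (fKinv s).ofConv a ∧ (homE s a) 1 0 = 0 ∧
      (homE s a) 1 1 = (fK s).ofConv a := by
    induction a using OSL.induction with
    | one => simp [fK_one, fKinv_one]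
    | smul z a h => simp [h]
    | add a b ha hb => simp [ha, hb]
    | mul a b ha hb =>
      simp [Matrix.mul_apply, ha, hb, fK_mul, fKinv_mul]
    | u i j => simp [homE_u, fK_u, fKinv_u]
  ext i j
  fin_cases i <;> fin_cases j
  exacts [h.1, rfl, h.2.1, h.2.2]

theorem homF_apply (a : OSL (s ^ 2)) : homF s a =
    !![(fKinv s).ofConv a, (fF s).ofConv a; 0, (fK s).ofConv a] := by
  have h : (homF s a) 0 0 = (fKinv s).ofConv a ∧ (homF s a) 1 0 = 0 ∧
      (homF s a) 1 1 = (fK s).ofConv a := by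
    induction a using OSL.induction with
    | one => simp [fK_one, fKinv_one]
    | smul z a h => simp [h]
    | add a b ha hb => simp [ha, hb]
    | mul a b ha hb =>
      simp [Matrix.mul_apply, ha, hb, fK_mul, fKinv_mul]
    | u i j => simp [homF_u, fK_u, fKinv_u]
  ext i j
  fin_cases i <;> fin_cases j
  exacts [h.1, rfl, h.2.1, h.2.2]

theorem fE_mul (a b : OSL (s ^ 2)) : (fE s).ofConv (a * b) =
    (fE s).ofConv a * (fK s).ofConv b + (fKinv s).ofConv a * (fE s).ofConv b := by
  have h := congrFun (congrFun (map_mul (homE s) a b) 0) 1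
  rw [homE_apply, homE_apply, homE_apply] at h
  simpa [add_comm] using h

theorem fF_mul (a b : OSL (s ^ 2)) : (fF s).ofConv (a * b) =
    (fF s).ofConv a * (fK s).ofConv b + (fKinv s).ofConv a * (fF s).ofConv b := by
  have h := congrFun (congrFun (map_mul (homF s) a b) 0) 1
  rw [homF_apply, homF_apply, homF_apply] at h
  simpa [add_comm] using h

theorem fE_one : (fE s).ofConv 1 = 0 := by
  have h := congrFun (congrFun (map_one (homE s)) 0) 1
  rw [homE_apply] at h
  simpa using h

theorem fF_one : (fF s).ofConv 1 = 0 := by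
  have h := congrFun (congrFun (map_one (homF s)) 0) 1
  rw [homF_apply] at h
  simpa using h

theorem fE_u (i j : Fin 2) : (fE s).ofConv (OSL.u (s ^ 2) i j) = !![0, 0; 1, 0] i j := by
  have h := congrFun (congrFun (homE_u (s := s) i j) 0) 1
  rw [homE_apply] at h
  simpa using h

theorem fF_u (i j : Fin 2) : (fF s).ofConv (OSL.u (s ^ 2) i j) = !![0, 1; 0, 0] i j := by
  have h := congrFun (congrFun (homF_u (s := s) i j) 0) 1
  rw [homF_apply] at h
  simpa using h

theorem act_fK_mul (a b : OSL (s ^ 2)) : act (fK s) (a * b) = act (fK s) a * act (fK s) b :=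
  act_char_mul _ a b

theorem act_fKinv_mul (a b : OSL (s ^ 2)) :
    act (fKinv s) (a * b) = act (fKinv s) a * act (fKinv s) b :=
  act_char_mul _ a b

theorem act_fEps_mul (ν : ℤˣ) (a b : OSL (s ^ 2)) :
    act (fEps s ν) (a * b) = act (fEps s ν) a * act (fEps s ν) b :=
  act_char_mul _ a b

theorem act_fE_mul (a b : OSL (s ^ 2)) :
    act (fE s) (a * b) = act (fE s) a * act (fK s) b + act (fKinv s) a * act (fE s) b := by
  simpa using act_apply_mul Finset.univ (fE s) ![fE s, fKinv s] ![fK s, fE s]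
    (by simp [fE_mul]) a b

theorem act_fF_mul (a b : OSL (s ^ 2)) :
    act (fF s) (a * b) = act (fF s) a * act (fK s) b + act (fKinv s) a * act (fF s) b := by
  simpa using act_apply_mul Finset.univ (fF s) ![fF s, fKinv s] ![fK s, fF s]
    (by simp [fF_mul]) a b

theorem act_fK_u (i j : Fin 2) :
    act (fK s) (OSL.u (s ^ 2) i j) = (![(s : ℂ)⁻¹, (s : ℂ)] j) • OSL.u (s ^ 2) i j := by
  rw [act_u]; fin_cases j <;> simp [fK_u]

theorem act_fKinv_u (i j : Fin 2) :
    act (fKinv s) (OSL.u (s ^ 2) i j) = (![(s : ℂ), (s : ℂ)⁻¹] j) • OSL.u (s ^ 2) i j := by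
  rw [act_u]; fin_cases j <;> simp [fKinv_u]

theorem act_fEps_u (ν : ℤˣ) (i j : Fin 2) :
    act (fEps s ν) (OSL.u (s ^ 2) i j) = sgn ν • OSL.u (s ^ 2) i j := by
  rw [act_u]; fin_cases j <;> simp [fEps_u]

theorem act_fE_u_zero (i : Fin 2) : act (fE s) (OSL.u (s ^ 2) i 0) = OSL.u (s ^ 2) i 1 := by
  rw [act_u]; simp [fE_u]

theorem act_fE_u_one (i : Fin 2) : act (fE s) (OSL.u (s ^ 2) i 1) = 0 := by
  rw [act_u]; simp [fE_u]

theorem act_fF_u_zero (i : Fin 2) : act (fF s) (OSL.u (s ^ 2) i 0) = 0 := by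
  rw [act_u]; simp [fF_u]

theorem act_fF_u_one (i : Fin 2) : act (fF s) (OSL.u (s ^ 2) i 1) = OSL.u (s ^ 2) i 0 := by
  rw [act_u]; simp [fF_u]

theorem eq_of_act_eq {f g : Dual s} (h : ∀ a, act f a = act g a) : f = g :=
  act_injective (LinearMap.ext h)

theorem fK_mul_fKinv : fK s * fKinv s = 1 := by
  refine eq_of_act_eq fun a => ?_
  rw [act_mul, act_one, LinearMap.comp_apply, LinearMap.id_apply]
  induction a using OSL.induction with
  | one => simp [act_apply_one, fK_one, fKinv_one]
  | smul z a h => simp [h]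
  | add a b ha hb => simp [ha, hb]
  | mul a b ha hb => simp [act_fK_mul, act_fKinv_mul, ha, hb]
  | u i j => fin_cases j <;> simp [act_fK_u, act_fKinv_u, smul_smul]

theorem fKinv_mul_fK : fKinv s * fK s = 1 := by
  refine eq_of_act_eq fun a => ?_
  rw [act_mul, act_one, LinearMap.comp_apply, LinearMap.id_apply]
  induction a using OSL.induction with
  | one => simp [act_apply_one, fK_one, fKinv_one]
  | smul z a h => simp [h]
  | add a b ha hb => simp [ha, hb]
  | mul a b ha hb => simp [act_fK_mul, act_fKinv_mul, ha, hb]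
  | u i j => fin_cases j <;> simp [act_fK_u, act_fKinv_u, smul_smul]

theorem sgn_mul_self (ν : ℤˣ) : sgn ν * sgn ν = 1 := by
  rw [sgn, ← Int.cast_mul]; simp

theorem fEps_mul_fEps (ν : ℤˣ) : fEps s ν * fEps s ν = 1 := by
  refine eq_of_act_eq fun a => ?_
  rw [act_mul, act_one, LinearMap.comp_apply, LinearMap.id_apply]
  induction a using OSL.induction with
  | one => simp [act_apply_one, fEps_one]
  | smul z a h => simp [h]
  | add a b ha hb => simp [ha, hb]
  | mul a b ha hb => simp [act_fEps_mul, ha, hb]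
  | u i j => simp [act_fEps_u, smul_smul, sgn_mul_self]

/-- Both sides are multiplicative and scale every generator by ν, since ε_± is a scalar matrix
there. This yields the centrality of ε_±. -/
theorem act_fEps_eq_lact (ν : ℤˣ) (a : OSL (s ^ 2)) : act (fEps s ν) a = lact (fEps s ν) a := by
  induction a using OSL.induction with
  | one => rw [act_apply_one, lact_apply_one]
  | smul z a h => simp [h]
  | add a b ha hb => simp [ha, hb]
  | mul a b ha hb => rw [act_fEps_mul, ha, hb]; exact (lact_char_mul _ a b).symm
  | u i j => rw [act_fEps_u, lact_u]; fin_cases i <;> simp [fEps_u]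

theorem fEps_comm (ν : ℤˣ) (f : Dual s) : fEps s ν * f = f * fEps s ν := by
  apply WithConv.ofConv_injective
  ext a
  rw [← apply_act f, ← apply_lact f, act_fEps_eq_lact]

theorem qq_ne_zero (s : ℂˣ) : qq s ≠ 0 := pow_ne_zero _ s.ne_zero

theorem fK_mul_fE : fK s * fE s = qq s • (fE s * fK s) := by
  refine eq_of_act_eq fun a => ?_
  have hs := s.ne_zero
  simp only [act_mul, act_smul, LinearMap.comp_apply, LinearMap.smul_apply]
  induction a using OSL.induction with
  | one => simp [act_apply_one, fK_one, fE_one]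
  | smul z a h => simp only [map_smul, h, smul_comm z]
  | add a b ha hb => simp only [map_add, ha, hb, smul_add]
  | mul a b ha hb =>
    have h1 : act (fK s) (act (fKinv s) a) = act (fKinv s) (act (fK s) a) := by
      rw [← LinearMap.comp_apply, ← LinearMap.comp_apply, ← act_mul, ← act_mul, fK_mul_fKinv,
        fKinv_mul_fK]
    simp only [act_fK_mul, act_fE_mul, map_add, ha, hb, h1, smul_add, smul_mul_assoc,
      mul_smul_comm]
  | u i j =>
    fin_cases j <;> simp [act_fK_u, act_fE_u_zero, act_fE_u_one, smul_smul, qq, pow_two]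

theorem fK_mul_fF : fK s * fF s = (qq s)⁻¹ • (fF s * fK s) := by
  refine eq_of_act_eq fun a => ?_
  have hs := s.ne_zero
  simp only [act_mul, act_smul, LinearMap.comp_apply, LinearMap.smul_apply]
  induction a using OSL.induction with
  | one => simp [act_apply_one, fK_one, fF_one]
  | smul z a h => simp only [map_smul, h, smul_comm z]
  | add a b ha hb => simp only [map_add, ha, hb, smul_add]
  | mul a b ha hb =>
    have h1 : act (fK s) (act (fKinv s) a) = act (fKinv s) (act (fK s) a) := by
      rw [← LinearMap.comp_apply, ← LinearMap.comp_apply, ← act_mul, ← act_mul, fK_mul_fKinv,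
        fKinv_mul_fK]
    simp only [act_fK_mul, act_fF_mul, map_add, ha, hb, h1, smul_add, smul_mul_assoc,
      mul_smul_comm]
  | u i j =>
    fin_cases j <;> simp [act_fK_u, act_fF_u_zero, act_fF_u_one, smul_smul, qq, pow_two]

theorem fKinv_mul_fE : fKinv s * fE s = (qq s)⁻¹ • (fE s * fKinv s) := by
  have h : fE s * fKinv s = fKinv s * (fK s * fE s) * fKinv s := by
    rw [← mul_assoc (fKinv s), fKinv_mul_fK, one_mul]
  rw [h, fK_mul_fE, mul_smul_comm, smul_mul_assoc, smul_smul, inv_mul_cancel₀ (qq_ne_zero s),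
    one_smul, mul_assoc, mul_assoc, fK_mul_fKinv, mul_one]

theorem fKinv_mul_fF : fKinv s * fF s = qq s • (fF s * fKinv s) := by
  have h : fF s * fKinv s = fKinv s * (fK s * fF s) * fKinv s := by
    rw [← mul_assoc (fKinv s), fKinv_mul_fK, one_mul]
  rw [h, fK_mul_fF, mul_smul_comm, smul_mul_assoc, smul_smul, mul_inv_cancel₀ (qq_ne_zero s),
    one_smul, mul_assoc, mul_assoc, fK_mul_fKinv, mul_one]

/-- `q` is not a root of unity. -/
def NotRootOfUnity (s : ℂˣ) : Prop := ∀ n : ℕ, 0 < n → qq s ^ n ≠ 1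

theorem NotRootOfUnity.qhat_ne_zero (h : NotRootOfUnity s) : qhat s ≠ 0 := by
  intro h0
  apply h 2 two_pos
  have hq := qq_ne_zero s
  rw [qhat] at h0
  field_simp at h0
  linear_combination h0

theorem NotRootOfUnity.two_ne_zero (h : NotRootOfUnity s) : two s ≠ 0 := by
  intro h0
  -- Vanishing of q + q⁻¹ means q² = -1, hence q⁴ = 1.
  apply h 4 (by norm_num)
  have hq := qq_ne_zero s
  rw [two] at h0
  field_simp at h0
  linear_combination (qq s ^ 2 - 1) * h0

/-- The identity holds on generators. On a product, the mixed terms of EF - FE cancel because K^{±1}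
q-commute with E and F, and the remainder telescopes: (K² - K⁻²) ⊗ K² + K⁻² ⊗ (K² - K⁻²) = K² ⊗ K² -
K⁻² ⊗ K⁻². -/
theorem fE_mul_fF (h : NotRootOfUnity s) :
    fE s * fF s = fF s * fE s + (qhat s)⁻¹ • (fK s * fK s - fKinv s * fKinv s) := by
  have hh := h.qhat_ne_zero
  refine eq_of_act_eq fun a => ?_
  rw [← actHom_apply, ← actHom_apply]
  simp only [map_mul, map_add, map_sub, map_smul, actHom_apply, LinearMap.add_apply,
    LinearMap.smul_apply, Module.End.mul_apply, LinearMap.sub_apply]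
  have hs := s.ne_zero
  induction a using OSL.induction with
  | one => simp [act_apply_one, fK_one, fE_one, fF_one, fKinv_one]
  | smul z a h => simp only [map_smul, h, ← smul_sub, smul_comm z, smul_add]
  | add a b ha hb => simp only [map_add, ha, hb]; module
  | mul a b ha hb =>
    have c1 (a) : act (fK s) (act (fE s) a) = qq s • act (fE s) (act (fK s) a) := by
      simpa [act_mul, act_smul] using congrArg (fun f => act f a) (fK_mul_fE (s := s))
    have c2 (a) : act (fK s) (act (fF s) a) = (qq s)⁻¹ • act (fF s) (act (fK s) a) := by
      simpa [act_mul, act_smul] using congrArg (fun f => act f a) (fK_mul_fF (s := s))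
    have c3 (a) : act (fKinv s) (act (fE s) a) = (qq s)⁻¹ • act (fE s) (act (fKinv s) a) := by
      simpa [act_mul, act_smul] using congrArg (fun f => act f a) (fKinv_mul_fE (s := s))
    have c4 (a) : act (fKinv s) (act (fF s) a) = qq s • act (fF s) (act (fKinv s) a) := by
      simpa [act_mul, act_smul] using congrArg (fun f => act f a) (fKinv_mul_fF (s := s))
    have hq := qq_ne_zero s
    simp only [act_fK_mul, act_fE_mul, act_fF_mul, act_fKinv_mul, map_add, c1, c2, c3, c4, ha, hb,
      add_mul, mul_add, smul_mul_assoc, mul_smul_comm, smul_sub, sub_mul, mul_sub]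
    match_scalars <;> field_simp
    simp
  | u i j =>
    fin_cases j
    · simp only [Fin.zero_eta, act_fE_u_zero, act_fF_u_zero, act_fF_u_one, act_fK_u, act_fKinv_u,
        map_smul, map_zero, smul_smul, Matrix.cons_val_zero]
      match_scalars
      field_simp
      simp only [qhat, qq]; field_simp; ring
    · simp only [Fin.mk_one, act_fE_u_zero, act_fE_u_one, act_fF_u_one, act_fK_u,
        act_fKinv_u, map_smul, map_zero, smul_smul, Matrix.cons_val_one]
      match_scalars
      field_simp
      simp [qhat, qq]

/-! ### A representation of the quantum Clifford algebra -/

/-- The triangular matrix of functionals governing the first index of `θ_{ij}`. -/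
def lA (s : ℂˣ) : Matrix (Fin 2) (Fin 2) (Dual s) :=
  !![fKinv s, ((s : ℂ)⁻¹ * qhat s) • fF s; 0, fK s]

/-- The triangular matrix of functionals governing the second index of `θ_{ij}`. -/
def lB (s : ℂˣ) : Matrix (Fin 2) (Fin 2) (Dual s) :=
  !![fK s, 0; (-((s : ℂ) * qhat s)) • fE s, fKinv s]

/-- The 4×4 matrix of the calculus splits into two triangular 2×2 matrices, one for each index of
θ_{ij}. Its multiplicativity and the entries of σ then reduce to those of the factors. -/
theorem fMat_eq (ν : ℤˣ) (p r : Idx) :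
    fMat s ν p r = fEps s ν * (lA s p.1 r.1 * lB s p.2 r.2) := by
  obtain ⟨i, j⟩ := p
  obtain ⟨k, l⟩ := r
  fin_cases i <;> fin_cases j <;> fin_cases k <;> fin_cases l <;>
    simp [fMat, lA, lB, fK_mul_fKinv, fKinv_mul_fK, smul_smul, -neg_smul, mul_smul_comm]
  congr 1
  field_simp

theorem act_lA_mul (i k : Fin 2) (a b : OSL (s ^ 2)) :
    act (lA s i k) (a * b) = ∑ r, act (lA s i r) a * act (lA s r k) b := by
  have h0 : act (0 : Dual s) = 0 := map_zero (actHom s)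
  fin_cases i <;> fin_cases k <;>
    simp [lA, h0, act_fK_mul, act_fKinv_mul, act_smul, act_fF_mul, add_comm]

theorem act_lB_mul (i k : Fin 2) (a b : OSL (s ^ 2)) :
    act (lB s i k) (a * b) = ∑ r, act (lB s i r) a * act (lB s r k) b := by
  have h0 : act (0 : Dual s) = 0 := map_zero (actHom s)
  fin_cases i <;> fin_cases k <;>
    simp [lB, h0, act_fK_mul, act_fKinv_mul, act_smul, act_fE_mul, -neg_smul]

/-- Each triangular factor has the coproduct of a matrix corepresentation and ε_± is a character.
The rule is the consistency of θ_p(ab) = (θ_p a)b, and it drives both the bimodule relation in the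
representation and the evaluation of σ. -/
theorem act_fMat_mul (ν : ℤˣ) (p k : Idx) (a b : OSL (s ^ 2)) :
    act (fMat s ν p k) (a * b) = ∑ r, act (fMat s ν p r) a * act (fMat s ν r k) b := by
  simp only [fMat_eq, act_mul, LinearMap.comp_apply, act_lB_mul, map_sum, act_lA_mul,
    act_fEps_mul, Fintype.sum_prod_type]
  exact Finset.sum_comm

theorem counit_eq_one_apply (a : OSL (s ^ 2)) :
    (1 : Dual s).ofConv a = Coalgebra.counit (R := ℂ) a :=
  LinearMap.convOne_apply (R := ℂ) a

theorem fMat_mul (ν : ℤˣ) (p k : Idx) (a b : OSL (s ^ 2)) :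
    (fMat s ν p k).ofConv (a * b) =
      ∑ r, (fMat s ν p r).ofConv a * (fMat s ν r k).ofConv b := by
  have h (f : Dual s) (a) : f.ofConv a = Coalgebra.counit (R := ℂ) (act f a) := by
    rw [← counit_eq_one_apply, apply_act, one_mul]
  rw [h, act_fMat_mul, map_sum]
  refine Finset.sum_congr rfl fun r _ => ?_
  rw [Bialgebra.counit_mul, ← h, ← h]

theorem mul_apply_u (f g : Dual s) (i j : Fin 2) : (f * g).ofConv (OSL.u (s ^ 2) i j) =
    ∑ k, f.ofConv (OSL.u (s ^ 2) i k) * g.ofConv (OSL.u (s ^ 2) k j) := by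
  rw [← apply_act, act_u]
  simp [mul_comm]

theorem fMat_u (ν : ℤˣ) (p r : Idx) (i j : Fin 2) : (fMat s ν p r).ofConv (OSL.u (s ^ 2) i j) =
    sgn ν * ∑ m, (lA s p.1 r.1).ofConv (OSL.u (s ^ 2) i m) *
      (lB s p.2 r.2).ofConv (OSL.u (s ^ 2) m j) := by
  rw [fMat_eq, mul_apply_u]
  simp only [mul_apply_u, fEps_u]
  fin_cases i <;> simp

theorem sigmaCoeff_eq (ν : ℤˣ) (p r m n : Idx) : sigmaCoeff s ν p r m n =
    ∑ k : Idx, (∑ t, (lA s m.1 k.1).ofConv (OSL.u (s ^ 2) p.1 t) *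
      (lB s m.2 k.2).ofConv (OSL.u (s ^ 2) t n.1)) *
      (∑ t, (lA s k.1 r.1).ofConv (OSL.u (s ^ 2) p.2 t) *
      (lB s k.2 r.2).ofConv (OSL.u (s ^ 2) t n.2)) := by
  rw [sigmaCoeff, fMat_mul]
  refine Finset.sum_congr rfl fun k _ => ?_
  rw [fMat_u, fMat_u, mul_mul_mul_comm, sgn_mul_self, one_mul]

theorem lA_u (i k m n : Fin 2) : (lA s i k).ofConv (OSL.u (s ^ 2) m n) =
    (!![!![(s : ℂ), 0; 0, (s : ℂ)⁻¹], !![0, (s : ℂ)⁻¹ * qhat s; 0, 0];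
      0, !![(s : ℂ)⁻¹, 0; 0, (s : ℂ)]] : Matrix _ _ (Matrix (Fin 2) (Fin 2) ℂ)) i k m n := by
  fin_cases i <;> fin_cases k <;> fin_cases m <;> fin_cases n <;>
    simp [lA, fK_u, fKinv_u, fF_u]

theorem lB_u (i k m n : Fin 2) : (lB s i k).ofConv (OSL.u (s ^ 2) m n) =
    (!![!![(s : ℂ)⁻¹, 0; 0, (s : ℂ)], 0; !![0, 0; -((s : ℂ) * qhat s), 0],
      !![(s : ℂ), 0; 0, (s : ℂ)⁻¹]] : Matrix _ _ (Matrix (Fin 2) (Fin 2) ℂ)) i k m n := by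
  fin_cases i <;> fin_cases k <;> fin_cases m <;> fin_cases n <;>
    simp [lB, fK_u, fKinv_u, fE_u]

/-- The coefficients of the elements of the kernel of `id - σ` satisfy six linear equations. -/
theorem kernel_equations {ν : ℤˣ} {M : Type*} [AddCommGroup M] [Module ℂ M] (x : Idx → Idx → M)
    (hx : ∀ p r, ∑ m, ∑ n, sigmaCoeff s ν p r m n • x m n = x p r) :
    x (0, 0) (0, 1) = (qq s ^ 2) • x (0, 1) (0, 0) ∧
    x (0, 0) (1, 0) = qhat s • x (0, 1) (0, 0) + x (1, 0) (0, 0) ∧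
    x (0, 0) (1, 1) = qhat s • x (0, 1) (0, 1) + (qhat s / qq s) • x (0, 1) (1, 0)
      + x (1, 1) (0, 0) ∧
    x (1, 0) (0, 1) = x (0, 1) (1, 0) ∧
    x (0, 1) (1, 1) = (qq s ^ 2) • x (1, 1) (0, 1) ∧
    x (1, 0) (1, 1) = qhat s • x (1, 1) (0, 1) + x (1, 1) (1, 0) := by
  have hs := s.ne_zero
  have h1 := hx (0, 0) (0, 1)
  have h2 := hx (1, 0) (0, 0)
  have h3 := hx (0, 0) (1, 1)
  have h4 := hx (1, 0) (0, 1)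
  have h5 := hx (1, 1) (0, 1)
  have h6 := hx (1, 0) (1, 1)
  simp only [Fintype.sum_prod_type, Fin.sum_univ_two, sigmaCoeff_eq, lA_u, lB_u, Matrix.of_apply,
    Matrix.cons_val', Matrix.cons_val_zero, Matrix.cons_val_one, Matrix.cons_val_fin_one,
    Matrix.zero_apply, mul_zero, zero_mul, add_zero, zero_add, zero_smul] at h1 h2 h3 h4 h5 h6
  refine ⟨?_, ?_, ?_, ?_, ?_, ?_⟩
  · rw [← h1, qq]; congr 1; ring
  · rw [← h2]; match_scalars <;> field_simp; ring
  · rw [← h3, qq]; match_scalars <;> field_simp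
  · rw [← h4]; match_scalars; field_simp
  · rw [← h5, qq]; match_scalars; field_simp
  · rw [← h6, ← h5]; match_scalars <;> field_simp

/-! Normal ordering in the dual. -/

theorem fK_mul_fKinv_assoc (x : Dual s) : fK s * (fKinv s * x) = x := by
  rw [← mul_assoc, fK_mul_fKinv, one_mul]

theorem fKinv_mul_fK_assoc (x : Dual s) : fKinv s * (fK s * x) = x := by
  rw [← mul_assoc, fKinv_mul_fK, one_mul]

theorem fK_mul_fE_assoc (x : Dual s) : fK s * (fE s * x) = qq s • (fE s * (fK s * x)) := by
  rw [← mul_assoc, fK_mul_fE, smul_mul_assoc, mul_assoc]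

theorem fK_mul_fF_assoc (x : Dual s) : fK s * (fF s * x) = (qq s)⁻¹ • (fF s * (fK s * x)) := by
  rw [← mul_assoc, fK_mul_fF, smul_mul_assoc, mul_assoc]

theorem fKinv_mul_fE_assoc (x : Dual s) :
    fKinv s * (fE s * x) = (qq s)⁻¹ • (fE s * (fKinv s * x)) := by
  rw [← mul_assoc, fKinv_mul_fE, smul_mul_assoc, mul_assoc]

theorem fKinv_mul_fF_assoc (x : Dual s) :
    fKinv s * (fF s * x) = qq s • (fF s * (fKinv s * x)) := by
  rw [← mul_assoc, fKinv_mul_fF, smul_mul_assoc, mul_assoc]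

theorem fE_mul_fF' (h : NotRootOfUnity s) :
    fE s * fF s = fF s * fE s + (qhat s)⁻¹ • (fK s * fK s)
      + (-(qhat s)⁻¹) • (fKinv s * fKinv s) := by
  rw [fE_mul_fF h]; module

theorem fE_mul_fF_assoc (h : NotRootOfUnity s) (x : Dual s) :
    fE s * (fF s * x) = fF s * (fE s * x) + (qhat s)⁻¹ • (fK s * (fK s * x))
      + (-(qhat s)⁻¹) • (fKinv s * (fKinv s * x)) := by
  rw [← mul_assoc, fE_mul_fF' h]
  simp only [add_mul, smul_mul_assoc, mul_assoc]

theorem fK_mul_fEps (ν : ℤˣ) : fK s * fEps s ν = fEps s ν * fK s := (fEps_comm ν _).symm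
theorem fKinv_mul_fEps (ν : ℤˣ) : fKinv s * fEps s ν = fEps s ν * fKinv s := (fEps_comm ν _).symm
theorem fE_mul_fEps (ν : ℤˣ) : fE s * fEps s ν = fEps s ν * fE s := (fEps_comm ν _).symm
theorem fF_mul_fEps (ν : ℤˣ) : fF s * fEps s ν = fEps s ν * fF s := (fEps_comm ν _).symm

theorem mul_fEps_assoc (ν : ℤˣ) (f x : Dual s) :
    f * (fEps s ν * x) = fEps s ν * (f * x) := by
  rw [← mul_assoc, ← fEps_comm, mul_assoc]

theorem fEps_mul_fEps_assoc (ν : ℤˣ) (x : Dual s) : fEps s ν * (fEps s ν * x) = x := by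
  rw [← mul_assoc, fEps_mul_fEps, one_mul]

/-- The Clifford multiplication on a four-dimensional space of spinors. -/
def gam (s : ℂˣ) (c : ℂ) : Idx → Matrix (Fin 4) (Fin 4) ℂ
  | (0, 0) => !![0, 0, 0, -((s : ℂ) * two s * c); 0, 0, 0, 0; 0, -(s : ℂ)⁻¹, 0, 0; 0, 0, 0, 0]
  | (0, 1) => !![0, 0, two s * c * qhat s * s, 0; 0, 0, 0, -((s : ℂ)⁻¹ * two s * c);
      (s : ℂ), 0, 0, 0; 0, 0, 0, 0]
  | (1, 0) => !![0, 0, (s : ℂ) * two s * c, 0; 0, 0, 0, 0; 0, 0, 0, 0; 0, -(s : ℂ)⁻¹, 0, 0]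
  | (1, 1) => !![0, 0, 0, 0; 0, 0, (s : ℂ) ^ 3 * two s * c, 0; 0, 0, 0, 0; (s : ℂ), 0, 0, 0]

set_option maxHeartbeats 4000000 in
-- The six equations of `kernel_equations` leave ten of the sixteen coefficients free. Setting one
-- free coefficient to 1 and the others to 0 gives these ten Clifford relations.
theorem gam_relations (s : ℂˣ) (c : ℂ) :
    gam s c (0, 0) * gam s c (0, 0) = 0 ∧
    (qq s ^ 2) • (gam s c (0, 0) * gam s c (0, 1)) + qhat s • (gam s c (0, 0) * gam s c (1, 0))
      + gam s c (0, 1) * gam s c (0, 0) = 0 ∧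
    gam s c (0, 1) * gam s c (0, 1) + qhat s • (gam s c (0, 0) * gam s c (1, 1)) = 0 ∧
    gam s c (0, 0) * gam s c (1, 0) + gam s c (1, 0) * gam s c (0, 0) = 0 ∧
    gam s c (0, 1) * gam s c (1, 0) + gam s c (1, 0) * gam s c (0, 1)
      + (qhat s / qq s) • (gam s c (0, 0) * gam s c (1, 1)) = (2 * c - qhat s / qq s * c) • 1 ∧
    gam s c (1, 0) * gam s c (1, 0) = 0 ∧
    gam s c (0, 0) * gam s c (1, 1) + gam s c (1, 1) * gam s c (0, 0) =
      (-c - qq s ^ 2 * c) • 1 ∧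
    (qq s ^ 2) • (gam s c (0, 1) * gam s c (1, 1)) + qhat s • (gam s c (1, 0) * gam s c (1, 1))
      + gam s c (1, 1) * gam s c (0, 1) = 0 ∧
    gam s c (1, 0) * gam s c (1, 1) + gam s c (1, 1) * gam s c (1, 0) = 0 ∧
    gam s c (1, 1) * gam s c (1, 1) = 0 := by
  have hs := s.ne_zero
  refine ⟨?_, ?_, ?_, ?_, ?_, ?_, ?_, ?_, ?_, ?_⟩ <;> ext i j <;> fin_cases i <;>
    fin_cases j <;>
    simp [gam, Matrix.mul_apply, Fin.sum_univ_four, two, qq, qhat] <;> field_simp <;> ring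

/-- A matrix of functionals intertwining the bimodule structure and the Clifford
multiplication. -/
def twist (s : ℂˣ) (ν : ℤˣ) : Matrix (Fin 4) (Fin 4) (Dual s) :=
  !![fKinv s, ((s : ℂ)⁻¹ * qhat s) • fE s, 0, 0;
    0, fK s, 0, 0;
    0, 0, fEps s ν * fK s, 0;
    0, 0, (-((s : ℂ) * qhat s)) • (fEps s ν * fF s), fEps s ν * fKinv s]

/-- The inverse of `twist`. -/
def twistInv (s : ℂˣ) (ν : ℤˣ) : Matrix (Fin 4) (Fin 4) (Dual s) :=
  !![fK s, (-((s : ℂ) * qhat s)) • fE s, 0, 0;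
    0, fKinv s, 0, 0;
    0, 0, fEps s ν * fKinv s, 0;
    0, 0, ((s : ℂ)⁻¹ * qhat s) • (fEps s ν * fF s), fEps s ν * fK s]

theorem twistInv_mul_twist (s : ℂˣ) (ν : ℤˣ) : twistInv s ν * twist s ν = 1 := by
  have hs := s.ne_zero
  ext1 i j
  fin_cases i <;> fin_cases j <;>
    simp [twist, twistInv, Matrix.mul_apply, Fin.sum_univ_four, mul_assoc, fK_mul_fKinv,
      fKinv_mul_fK, mul_fEps_assoc, fEps_mul_fEps_assoc, fK_mul_fE, fK_mul_fF, smul_smul,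
      -neg_smul, ← add_smul, fEps_mul_fEps] <;>
    (left; rw [qq]; field_simp; ring)

theorem twist_mul_twistInv (s : ℂˣ) (ν : ℤˣ) : twist s ν * twistInv s ν = 1 := by
  have hs := s.ne_zero
  ext1 i j
  fin_cases i <;> fin_cases j <;>
    simp [twist, twistInv, Matrix.mul_apply, Fin.sum_univ_four, mul_assoc, fK_mul_fKinv,
      fKinv_mul_fK, mul_fEps_assoc, fEps_mul_fEps_assoc, fKinv_mul_fE,
      fKinv_mul_fF, smul_smul, -neg_smul, ← add_smul, fEps_mul_fEps] <;>
    (left; rw [qq]; field_simp; ring)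

/-- The matrix of functionals by which `θ_p` acts. -/
def thetaMat (s : ℂˣ) (ν : ℤˣ) (c : ℂ) (p : Idx) : Matrix (Fin 4) (Fin 4) (Dual s) :=
  fun i j => ∑ k, gam s c k i j • fMat s ν p k

theorem thetaMat_expand (ν : ℤˣ) (c : ℂ) (p : Idx) : thetaMat s ν c p =
    !![0, 0, (two s * c * qhat s * s) • fMat s ν p (0, 1) + (s * two s * c) • fMat s ν p (1, 0),
        (-(s * two s * c)) • fMat s ν p (0, 0);
      0, 0, ((s : ℂ) ^ 3 * two s * c) • fMat s ν p (1, 1),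
        (-((s : ℂ)⁻¹ * two s * c)) • fMat s ν p (0, 1);
      (s : ℂ) • fMat s ν p (0, 1), (-(s : ℂ)⁻¹) • fMat s ν p (0, 0), 0, 0;
      (s : ℂ) • fMat s ν p (1, 1), (-(s : ℂ)⁻¹) • fMat s ν p (1, 0), 0, 0] := by
  ext1 i j
  fin_cases i <;> fin_cases j <;> simp [thetaMat, Fintype.sum_prod_type, gam, -neg_smul]

set_option maxHeartbeats 1000000 in
-- The two requirements on the image of θ_p are met by two different expressions: Σ_k γ_k f_{pk}
-- commutes correctly with A, and a conjugate of γ_p satisfies the Clifford relations. The identity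
-- says that these expressions coincide.
theorem twist_mul_thetaMat (h : NotRootOfUnity s) (ν : ℤˣ) (c : ℂ) (p : Idx) :
    twist s ν * thetaMat s ν c p = (gam s c p).map (algebraMap ℂ (Dual s)) * twist s ν := by
  have hs := s.ne_zero
  have hq := qq_ne_zero s
  have hh := h.qhat_ne_zero
  obtain ⟨m, n⟩ := p
  ext1 i j
  fin_cases m <;> fin_cases n <;> fin_cases i <;> fin_cases j <;>
    simp [twist, thetaMat_expand, Matrix.mul_apply, Fin.sum_univ_four, -neg_smul, gam, fMat,
      Algebra.algebraMap_eq_smul_one] <;>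
    simp only [mul_assoc, mul_smul_comm, smul_mul_assoc, fK_mul_fKinv,
      fKinv_mul_fK, mul_fEps_assoc, fEps_mul_fEps_assoc, fK_mul_fE, fKinv_mul_fE,
      smul_smul, fE_mul_fF_assoc h, fK_mul_fKinv_assoc, fKinv_mul_fK_assoc, fK_mul_fE_assoc, fK_mul_fF_assoc,
      fKinv_mul_fE_assoc, fKinv_mul_fF_assoc, fE_mul_fEps, fF_mul_fEps, fK_mul_fEps,
      fKinv_mul_fEps, mul_add, smul_add, mul_one] <;>
    try (match_scalars <;> simp only [qq, qhat] <;> field_simp <;> ring1)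

theorem thetaMat_eq (h : NotRootOfUnity s) (ν : ℤˣ) (c : ℂ) (p : Idx) :
    thetaMat s ν c p =
      twistInv s ν * (gam s c p).map (algebraMap ℂ (Dual s)) * twist s ν := by
  rw [mul_assoc, ← twist_mul_thetaMat h, ← mul_assoc, twistInv_mul_twist, one_mul]

/-- The algebra in which the quantum Clifford algebra is represented. -/
abbrev RepAlg (s : ℂˣ) : Type := Matrix (Fin 4) (Fin 4) (Module.End ℂ (OSL (s ^ 2)))

/-- Left multiplication by an element of `O(SL_q(2))`. -/
def repA (s : ℂˣ) : OSL (s ^ 2) →ₐ[ℂ] RepAlg s :=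
  (Matrix.scalarAlgHom (Fin 4) ℂ).comp (Algebra.lmul ℂ (OSL (s ^ 2)))

/-- Conjugation of scalar matrices by `twist`. -/
def conjTwist (s : ℂˣ) (ν : ℤˣ) : Matrix (Fin 4) (Fin 4) ℂ →ₐ[ℂ] Matrix (Fin 4) (Fin 4) (Dual s) :=
  AlgHom.ofLinearMap
    (LinearMap.mulLeft ℂ (twistInv s ν) ∘ₗ LinearMap.mulRight ℂ (twist s ν) ∘ₗ
      ((Algebra.ofId ℂ (Dual s)).mapMatrix (m := Fin 4)).toLinearMap)
    (by
      simp only [LinearMap.comp_apply, AlgHom.toLinearMap_apply, map_one, LinearMap.mulRight_apply,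
        LinearMap.mulLeft_apply, one_mul, twistInv_mul_twist])
    (by
      intro x y
      simp only [LinearMap.comp_apply, AlgHom.toLinearMap_apply, map_mul, LinearMap.mulRight_apply,
        LinearMap.mulLeft_apply]
      generalize (Algebra.ofId ℂ (Dual s)).mapMatrix x = x
      generalize (Algebra.ofId ℂ (Dual s)).mapMatrix y = y
      simp only [mul_assoc]
      rw [← mul_assoc (twist s ν) (twistInv s ν), twist_mul_twistInv, one_mul])

/-- Clifford multiplication in the representation. -/
def repGam (s : ℂˣ) (ν : ℤˣ) : Matrix (Fin 4) (Fin 4) ℂ →ₐ[ℂ] RepAlg s :=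
  ((actHom s).mapMatrix (m := Fin 4)).comp (conjTwist s ν)

theorem repGam_gam_apply (h : NotRootOfUnity s) (ν : ℤˣ) (c : ℂ) (p : Idx) (i j : Fin 4) :
    repGam s ν (gam s c p) i j = ∑ k, gam s c k i j • act (fMat s ν p k) := by
  have h1 : conjTwist s ν (gam s c p) = thetaMat s ν c p := by
    rw [thetaMat_eq h, mul_assoc]; rfl
  rw [repGam, AlgHom.comp_apply, h1]
  change actHom s (thetaMat s ν c p i j) = _
  rw [thetaMat, map_sum]
  simp only [map_smul, actHom_apply]

theorem repGam_mul_repA (h : NotRootOfUnity s) (ν : ℤˣ) (c : ℂ) (p : Idx) (a : OSL (s ^ 2)) :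
    repGam s ν (gam s c p) * repA s a =
      ∑ r, repA s (act (fMat s ν p r) a) * repGam s ν (gam s c r) := by
  have hA (a : OSL (s ^ 2)) : repA s a = Matrix.diagonal fun _ => LinearMap.mulLeft ℂ a := rfl
  ext i j b
  simp only [hA, Matrix.mul_diagonal, Matrix.sum_apply, Matrix.diagonal_mul,
    repGam_gam_apply h, Module.End.mul_apply,
    LinearMap.sum_apply, LinearMap.smul_apply, LinearMap.mulLeft_apply, act_fMat_mul,
    Finset.smul_sum, Finset.mul_sum, mul_smul_comm]
  -- What remains is the coproduct of f_{pk}, already expanded by `act_fMat_mul`, with the two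
  -- summations in the other order.
  rw [Finset.sum_comm]

theorem repGam_cliff {ν : ℤˣ} {c : ℂ} (x : Idx → Idx → OSL (s ^ 2))
    (hx : ∀ p r, ∑ m, ∑ n, sigmaCoeff s ν p r m n • x m n = x p r) :
    ∑ p, ∑ r, repA s (x p r) * repGam s ν (gam s c p) * repGam s ν (gam s c r) =
      ∑ p, ∑ r, gMat s c p r • repA s (x p r) := by
  obtain ⟨k1, k2, k3, k4, k5, k6⟩ := kernel_equations x hx
  obtain ⟨g1, g2, g3, g4, g5, g6, g7, g8, g9, g10⟩ := gam_relations s c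
  have hR {y z : Matrix (Fin 4) (Fin 4) ℂ} (w : OSL (s ^ 2)) (h : y = z) :
      repA s w * repGam s ν y = repA s w * repGam s ν z := by rw [h]
  have e1 := hR (x (0, 0) (0, 0)) g1
  have e2 := hR (x (0, 1) (0, 0)) g2
  have e3 := hR (x (0, 1) (0, 1)) g3
  have e4 := hR (x (1, 0) (0, 0)) g4
  have e5 := hR (x (0, 1) (1, 0)) g5
  have e6 := hR (x (1, 0) (1, 0)) g6
  have e7 := hR (x (1, 1) (0, 0)) g7
  have e8 := hR (x (1, 1) (0, 1)) g8
  have e9 := hR (x (1, 1) (1, 0)) g9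
  have e10 := hR (x (1, 1) (1, 1)) g10
  simp only [map_add, map_smul, map_mul, map_zero, map_one, mul_add, mul_smul_comm, mul_one,
    mul_zero, ← mul_assoc] at e1 e2 e3 e4 e5 e6 e7 e8 e9 e10
  simp only [Fintype.sum_prod_type, Fin.sum_univ_two, k1, k2, k3, k4, k5, k6, gMat, map_add,
    map_smul, add_mul, smul_mul_assoc]
  have hq := qq_ne_zero s
  -- With the six dependent coefficients eliminated, the terms sort by the ten free ones, and each
  -- contributes exactly its own relation.
  linear_combination (norm := skip) e1 + e2 + e3 + e4 + e5 + e6 + e7 + e8 + e9 + e10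
  match_scalars <;> field_simp <;> ring

/-- The representation of the quantum Clifford algebra. -/
def clRep (h : NotRootOfUnity s) (ν : ℤˣ) (c : ℂ) : Cl s ν c →ₐ[ℂ] RepAlg s :=
  RingQuot.liftAlgHom ℂ (s := Cl.Rel s ν c)
    ⟨FreeAlgebra.lift ℂ (Sum.elim (repA s) fun p => repGam s ν (gam s c p)), by
      intro x y hxy
      cases hxy with
      | add a b => simp [preA]
      | mul a b => simp [preA]
      | scalar z => simp only [preA, FreeAlgebra.lift_ι_apply, Sum.elim_inl, AlgHom.commutes]
      | bimod p a =>
        simpa only [preA, preTheta, map_mul, map_sum, FreeAlgebra.lift_ι_apply, Sum.elim_inl,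
          Sum.elim_inr] using repGam_mul_repA h ν c p a
      | cliff x hx =>
        simpa only [preA, preTheta, map_mul, map_sum, map_smul, FreeAlgebra.lift_ι_apply,
          Sum.elim_inl, Sum.elim_inr] using repGam_cliff x hx⟩

theorem clRep_mk (h : NotRootOfUnity s) (ν : ℤˣ) (c : ℂ) (x : Pre s) :
    clRep h ν c (Cl.mk s ν c x) =
      FreeAlgebra.lift ℂ (Sum.elim (repA s) fun p => repGam s ν (gam s c p)) x := by
  unfold clRep Cl.mk
  erw [RingQuot.liftAlgHom_mkAlgHom_apply]

theorem clRep_ofA (h : NotRootOfUnity s) (ν : ℤˣ) (c : ℂ) (a : OSL (s ^ 2)) :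
    clRep h ν c (Cl.ofA s ν c a) = repA s a := by
  change clRep h ν c (Cl.mk s ν c (preA s a)) = _
  simp [clRep_mk, preA]

theorem clRep_theta (h : NotRootOfUnity s) (ν : ℤˣ) (c : ℂ) (p : Idx) :
    clRep h ν c (Cl.theta s ν c p) = repGam s ν (gam s c p) := by
  simp [Cl.theta, clRep_mk, preTheta]

/-! ### Evaluation at the unit and freeness of the spinor module -/

theorem dual_mul_apply_one (f g : Dual s) : (f * g).ofConv 1 = f.ofConv 1 * g.ofConv 1 := by
  rw [← apply_act, act_apply_one, map_smul, smul_eq_mul, mul_comm]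

/-- Evaluation of functionals at `1` as a homomorphism of algebras. -/
def evalOne (s : ℂˣ) : Dual s →ₐ[ℂ] ℂ :=
  AlgHom.ofLinearMap
    { toFun := fun f => f.ofConv 1
      map_add' := fun _ _ => rfl
      map_smul' := fun _ _ => rfl }
    (by
      change (1 : Dual s).ofConv 1 = 1
      rw [counit_eq_one_apply, Bialgebra.counit_one]) dual_mul_apply_one

theorem evalOne_fK : evalOne s (fK s) = 1 := fK_one
theorem evalOne_fKinv : evalOne s (fKinv s) = 1 := fKinv_one
theorem evalOne_fE : evalOne s (fE s) = 0 := fE_one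
theorem evalOne_fF : evalOne s (fF s) = 0 := fF_one
theorem evalOne_fEps (ν : ℤˣ) : evalOne s (fEps s ν) = 1 := fEps_one ν

theorem evalOne_twist (ν : ℤˣ) : (evalOne s).mapMatrix (twist s ν) = 1 := by
  ext i j
  fin_cases i <;> fin_cases j <;>
    simp [twist, evalOne_fK, evalOne_fKinv, evalOne_fE, evalOne_fF, evalOne_fEps, -neg_smul]

theorem evalOne_twistInv (ν : ℤˣ) : (evalOne s).mapMatrix (twistInv s ν) = 1 := by
  ext i j
  fin_cases i <;> fin_cases j <;>
    simp [twistInv, evalOne_fK, evalOne_fKinv, evalOne_fE, evalOne_fF, evalOne_fEps, -neg_smul]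

theorem evalOne_conjTwist (ν : ℤˣ) (x : Matrix (Fin 4) (Fin 4) ℂ) :
    (evalOne s).mapMatrix (conjTwist s ν x) = x := by
  change (evalOne s).mapMatrix (twistInv s ν * ((Algebra.ofId ℂ (Dual s)).mapMatrix x *
    twist s ν)) = x
  rw [map_mul, map_mul, evalOne_twist, evalOne_twistInv, one_mul, mul_one]
  ext i j
  simp [Algebra.ofId_apply]

/-- At the element 1 of A the twist becomes the identity matrix, so the conjugation disappears and
only the scalar matrix x remains. -/
theorem repA_mul_repGam_apply_one (ν : ℤˣ) (a : OSL (s ^ 2)) (x : Matrix (Fin 4) (Fin 4) ℂ)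
    (i j : Fin 4) : (repA s a * repGam s ν x) i j 1 = x i j • a := by
  have hA : repA s a = Matrix.diagonal fun _ => LinearMap.mulLeft ℂ a := rfl
  have h1 : repGam s ν x i j = act (conjTwist s ν x i j) := rfl
  have h2 := congrFun (congrFun (evalOne_conjTwist (s := s) ν x) i) j
  rw [hA, Matrix.diagonal_mul, h1, Module.End.mul_apply, act_apply_one, LinearMap.mulLeft_apply]
  rw [mul_smul_comm, mul_one]
  congr 1

theorem clRep_ofA_mul_psi (h : NotRootOfUnity s) (ν : ℤˣ) (c : ℂ) (i : Fin 2) (a : OSL (s ^ 2)) :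
    clRep h ν c (Cl.ofA s ν c a * psi s ν c i) = repA s a * repGam s ν
      (![(qq s / (two s * c)) • (gam s c (0, 0) * gam s c (0, 1) *
          gam s c (1, 0) * gam s c (1, 1)), gam s c (1, 0) * gam s c (1, 1)] i) := by
  fin_cases i <;> simp [psi, clRep_ofA, clRep_theta]

/-- The elements `ψ⁺₁` and `ψ⁺₂` are linearly independent over `O(SL_q(2))`. -/
theorem mulPsi_independent (h : NotRootOfUnity s) (ν : ℤˣ) {c : ℂ} (hc : c ≠ 0)
    (x : Fin 2 → OSL (s ^ 2)) (hx : ∑ i, mulPsi s ν c i (x i) = 0) : x = 0 := by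
  have hs := s.ne_zero
  have h2 := h.two_ne_zero
  have hq := qq_ne_zero s
  have h0 := congrArg (clRep h ν c) hx
  change clRep h ν c (∑ i, Cl.ofA s ν c (x i) * psi s ν c i) = _ at h0
  rw [map_sum, map_zero] at h0
  simp only [clRep_ofA_mul_psi] at h0
  -- The third column suffices: the scalar matrices of ψ⁺₁ and ψ⁺₂ send the third basis vector to
  -- nonzero multiples of the third and of the fourth one. Rows 2 and 3 therefore isolate the two
  -- coefficients.
  have e (i : Fin 4) := congrArg (fun m : RepAlg s => m i 2 1) h0
  simp only [Fin.sum_univ_two, Matrix.add_apply, LinearMap.add_apply,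
    repA_mul_repGam_apply_one] at e
  have e2 := e 2
  have e3 := e 3
  simp [gam, h2, hs, hc, hq] at e2 e3
  ext i
  fin_cases i
  · exact e2
  · exact e3

/-! ### Left-invariant operators on the spinor module and the right coaction -/

theorem comul_act (f : Dual s) (a : OSL (s ^ 2)) :
    Coalgebra.comul (R := ℂ) (act f a) = (act f).lTensor _ (Coalgebra.comul a) := by
  have h1 : ∀ t : OSL (s ^ 2) ⊗[ℂ] OSL (s ^ 2),
      Coalgebra.comul (R := ℂ) (TensorProduct.rid ℂ _ (f.ofConv.lTensor _ t)) =
        ((TensorProduct.rid ℂ (OSL (s ^ 2))).toLinearMap ∘ₗ f.ofConv.lTensor _).lTensor _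
          (TensorProduct.assoc ℂ _ _ _ (Coalgebra.comul.rTensor _ t)) := by
    intro t
    induction t with
    | zero => simp
    | add x y hx hy => simp only [map_add, hx, hy]
    | tmul x y =>
      simp only [LinearMap.lTensor_tmul, TensorProduct.rid_tmul, map_smul, LinearMap.rTensor_tmul]
      induction Coalgebra.comul (R := ℂ) x using TensorProduct.induction_on with
      | zero => simp
      | add x y hx hy => simp only [map_add, hx, hy, smul_add, TensorProduct.add_tmul]
      | tmul x z => simp
  rw [act_apply_of_comul, h1, Coalgebra.coassoc_apply,
    ← LinearMap.comp_apply (LinearMap.lTensor _ _),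
    ← LinearMap.lTensor_comp]
  rfl

/-- Both sides are a₍₁₎ ⊗ f(a₍₂₎) a₍₃₎. This is how a functional that acts on the spinor leg of the
coaction moves to the other leg as `lact`. -/
theorem rTensor_act_comul (f : Dual s) (a : OSL (s ^ 2)) :
    (act f).rTensor _ (Coalgebra.comul a) = (lact f).lTensor _ (Coalgebra.comul a) := by
  have h1 : ∀ t : OSL (s ^ 2) ⊗[ℂ] OSL (s ^ 2), (act f).rTensor _ t =
        ((TensorProduct.lid ℂ (OSL (s ^ 2))).toLinearMap ∘ₗ f.ofConv.rTensor _).lTensor _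
          (TensorProduct.assoc ℂ _ _ _ (Coalgebra.comul.rTensor _ t)) := by
    intro t
    induction t with
    | zero => simp
    | add x y hx hy => simp only [map_add, hx, hy]
    | tmul x y =>
      simp only [LinearMap.rTensor_tmul, act_apply_of_comul]
      induction Coalgebra.comul (R := ℂ) x using TensorProduct.induction_on with
      | zero => simp
      | add x y hx hy => simp only [map_add, hx, hy, TensorProduct.add_tmul]
      | tmul x z => simp [TensorProduct.smul_tmul]
  rw [h1, Coalgebra.coassoc_apply, ← LinearMap.comp_apply (LinearMap.lTensor _ _),
    ← LinearMap.lTensor_comp]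
  rfl

/-- The identification of `S₀⁺` with the free module of rank two. -/
def spinEquiv (h : NotRootOfUnity s) (ν : ℤˣ) {c : ℂ} (hc : c ≠ 0) :
    (Fin 2 → OSL (s ^ 2)) ≃ₗ[ℂ] S0plus s ν c :=
  LinearEquiv.ofBijective (∑ i, toS s ν c i ∘ₗ LinearMap.proj i) (by
    constructor
    · rw [injective_iff_map_eq_zero]
      intro x hx
      refine mulPsi_independent h ν hc x ?_
      rw [LinearMap.sum_apply] at hx
      have h1 := congrArg (S0plus s ν c).subtype hx
      rw [map_sum, map_zero] at h1
      exact h1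
    · rw [← LinearMap.range_eq_top, eq_top_iff]
      rintro ⟨y, hy⟩ -
      have key : S0plus s ν c ≤ (LinearMap.range (∑ i, toS s ν c i ∘ₗ
          LinearMap.proj (R := ℂ) (φ := fun _ => OSL (s ^ 2)) i)).map (S0plus s ν c).subtype := by
        refine iSup_le fun i => ?_
        rintro _ ⟨a, rfl⟩
        refine ⟨toS s ν c i a, ⟨Pi.single i a, ?_⟩, rfl⟩
        simp only [LinearMap.sum_apply, LinearMap.comp_apply, LinearMap.proj_apply]
        rw [Finset.sum_eq_single i]
        · simp
        · intro j _ hj; simp [hj]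
        · simp
      obtain ⟨z, hz, hzy⟩ := key hy
      rw [← show z = ⟨y, hy⟩ from Subtype.ext hzy]
      exact hz)

theorem spinEquiv_single (h : NotRootOfUnity s) (ν : ℤˣ) {c : ℂ} (hc : c ≠ 0) (i : Fin 2)
    (a : OSL (s ^ 2)) : spinEquiv h ν hc (Pi.single i a) = toS s ν c i a := by
  change (∑ i, toS s ν c i ∘ₗ LinearMap.proj i : _ →ₗ[ℂ] _) (Pi.single i a) = _
  simp only [LinearMap.sum_apply, LinearMap.comp_apply, LinearMap.proj_apply]
  rw [Finset.sum_eq_single i]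
  · simp
  · intro j _ hj; simp [hj]
  · simp

theorem spinEquiv_symm_toS (h : NotRootOfUnity s) (ν : ℤˣ) {c : ℂ} (hc : c ≠ 0) (i : Fin 2)
    (a : OSL (s ^ 2)) : (spinEquiv h ν hc).symm (toS s ν c i a) = Pi.single i a := by
  rw [← spinEquiv_single h ν hc, LinearEquiv.symm_apply_apply]

/-- Linear maps on `S₀⁺` are determined by their values on the `a ψ⁺_i`. -/
theorem spin_hom_ext (h : NotRootOfUnity s) (ν : ℤˣ) {c : ℂ} (hc : c ≠ 0) {M : Type*}
    [AddCommMonoid M] [Module ℂ M] {f g : S0plus s ν c →ₗ[ℂ] M}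
    (hfg : ∀ i a, f (toS s ν c i a) = g (toS s ν c i a)) : f = g := by
  have : f ∘ₗ (spinEquiv h ν hc).toLinearMap = g ∘ₗ (spinEquiv h ν hc).toLinearMap := by
    apply LinearMap.pi_ext
    intro i a
    simpa [spinEquiv_single] using hfg i a
  ext x
  obtain ⟨y, rfl⟩ := (spinEquiv h ν hc).surjective x
  exact LinearMap.congr_fun this y

/-- The operator on `S₀⁺` with a given symbol. -/
def opHom (h : NotRootOfUnity s) (ν : ℤˣ) {c : ℂ} (hc : c ≠ 0) :
    Matrix (Fin 2) (Fin 2) (Dual s) →ₐ[ℂ] Module.End ℂ (S0plus s ν c) :=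
  ((((endVecAlgEquivMatrixEnd (Fin 2) ℂ ℂ (OSL (s ^ 2))).symm.trans
    ((spinEquiv h ν hc).conjAlgEquiv ℂ)) : _ →ₐ[ℂ] _)).comp ((actHom s).mapMatrix)

theorem opHom_toS (h : NotRootOfUnity s) (ν : ℤˣ) {c : ℂ} (hc : c ≠ 0)
    (p : Matrix (Fin 2) (Fin 2) (Dual s)) (i : Fin 2) (a : OSL (s ^ 2)) :
    opHom h ν hc p (toS s ν c i a) = ∑ j, toS s ν c j (act (p j i) a) := by
  change spinEquiv h ν hc ((endVecAlgEquivMatrixEnd (Fin 2) ℂ ℂ (OSL (s ^ 2))).symm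
    ((actHom s).mapMatrix p) ((spinEquiv h ν hc).symm (toS s ν c i a))) = _
  rw [spinEquiv_symm_toS]
  have h1 : (endVecAlgEquivMatrixEnd (Fin 2) ℂ ℂ (OSL (s ^ 2))).symm
    ((actHom s).mapMatrix p) (Pi.single i a) = fun j => act (p j i) a := by
    obtain ⟨g, hg⟩ := (endVecAlgEquivMatrixEnd (Fin 2) ℂ ℂ (OSL (s ^ 2))).surjective
      ((actHom s).mapMatrix p)
    rw [← hg, AlgEquiv.symm_apply_apply]
    funext j
    exact (LinearMap.congr_fun (congrFun (congrFun hg j) i) a)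
  rw [h1]
  simp [spinEquiv]

theorem hasSymbol_iff (h : NotRootOfUnity s) (ν : ℤˣ) {c : ℂ} (hc : c ≠ 0)
    (p : Matrix (Fin 2) (Fin 2) (Dual s)) (D : Module.End ℂ (S0plus s ν c)) :
    HasSymbol s ν c p D ↔ D = opHom h ν hc p := by
  constructor
  · intro hp
    refine spin_hom_ext h ν hc fun i a => ?_
    rw [hp i a, opHom_toS]
  · rintro rfl i a
    rw [opHom_toS]

theorem opHom_injective (h : NotRootOfUnity s) (ν : ℤˣ) {c : ℂ} (hc : c ≠ 0) :
    Function.Injective (opHom h ν hc) := by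
  intro p p' hp
  ext1 j i
  refine eq_of_act_eq fun a => ?_
  have h1 := congrArg (fun D => (spinEquiv h ν hc).symm (D (toS s ν c i a)) j) hp
  simpa only [opHom_toS, map_sum, spinEquiv_symm_toS, Finset.sum_apply, Finset.sum_pi_single,
    Finset.mem_univ, if_true] using h1

/-- The right coaction on `S₀⁺`. -/
def spinCoaction (h : NotRootOfUnity s) (ν : ℤˣ) {c : ℂ} (hc : c ≠ 0) :
    S0plus s ν c →ₗ[ℂ] S0plus s ν c ⊗[ℂ] Atilde (s ^ 2) :=
  (∑ i, ∑ j, TensorProduct.map (toS s ν c j)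
      (timesChi (s ^ 2) ∘ₗ LinearMap.mulRight ℂ (OSL.u (s ^ 2) j i)) ∘ₗ Coalgebra.comul ∘ₗ
        LinearMap.proj i) ∘ₗ (spinEquiv h ν hc).symm.toLinearMap

theorem isSpinCoaction_spinCoaction (h : NotRootOfUnity s) (ν : ℤˣ) {c : ℂ} (hc : c ≠ 0) :
    IsSpinCoaction s ν c (spinCoaction h ν hc) := by
  intro i a
  simp only [spinCoaction, LinearMap.comp_apply, LinearEquiv.coe_coe, spinEquiv_symm_toS,
    LinearMap.sum_apply, LinearMap.proj_apply]
  rw [Finset.sum_eq_single i]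
  · simp
  · intro j _ hj; simp [hj]
  · simp

theorem timesChi_injective (q : ℂˣ) : Function.Injective (timesChi q) := by
  have hs (x : OSL q) : timesChi q x = SkewMonoidAlgebra.single (Multiplicative.ofAdd 1) x := by
    change SkewMonoidAlgebra.single (1 : Multiplicative ℤ) x *
      SkewMonoidAlgebra.single (Multiplicative.ofAdd 1) (1 : OSL q) = _
    simp [SkewMonoidAlgebra.single_mul_single]
  intro a b hab
  rw [hs, hs] at hab
  exact SkewMonoidAlgebra.single_injective _ hab

/-- Compatibility of a symbol with the right coaction. -/
def IsEquivariant (p : Matrix (Fin 2) (Fin 2) (Dual s)) : Prop :=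
  ∀ (k i : Fin 2) (a : OSL (s ^ 2)), ∑ j, act (p j i) a * OSL.u (s ^ 2) k j =
    ∑ j, lact (p k j) a * OSL.u (s ^ 2) j i

/-- On a ψ_i the two sides have ψ_k-components a₍₁₎ψ_k ⊗ L_{ki}(a₍₂₎)χ and a₍₁₎ψ_k ⊗ R_{ki}(a₍₂₎)χ,
where L and R are the two sides of the equivariance identity. The identity implies the commutation
at once; conversely, freeness, the counit on the first leg and the injectivity of a ↦ aχ extract L =
R. -/
theorem opHom_comm_iff (h : NotRootOfUnity s) (ν : ℤˣ) {c : ℂ} (hc : c ≠ 0)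
    (p : Matrix (Fin 2) (Fin 2) (Dual s)) :
    (∀ ψ, spinCoaction h ν hc (opHom h ν hc p ψ) =
      (opHom h ν hc p).rTensor (Atilde (s ^ 2)) (spinCoaction h ν hc ψ)) ↔ IsEquivariant p := by
  have hΔ := isSpinCoaction_spinCoaction h ν hc
  let L (k i : Fin 2) : OSL (s ^ 2) →ₗ[ℂ] OSL (s ^ 2) :=
    ∑ j, LinearMap.mulRight ℂ (OSL.u (s ^ 2) k j) ∘ₗ act (p j i)
  let R (k i : Fin 2) : OSL (s ^ 2) →ₗ[ℂ] OSL (s ^ 2) :=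
    ∑ j, LinearMap.mulRight ℂ (OSL.u (s ^ 2) j i) ∘ₗ lact (p k j)
  have hL (i : Fin 2) (a : OSL (s ^ 2)) :
      spinCoaction h ν hc (opHom h ν hc p (toS s ν c i a)) =
        ∑ k, TensorProduct.map (toS s ν c k) (timesChi (s ^ 2))
          ((L k i).lTensor _ (Coalgebra.comul a)) := by
    rw [opHom_toS, map_sum]
    simp only [hΔ _ _, comul_act]
    rw [Finset.sum_comm]
    refine Finset.sum_congr rfl fun k _ => ?_
    simp only [L]
    induction Coalgebra.comul (R := ℂ) a using TensorProduct.induction_on with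
    | zero => simp
    | add x y hx hy => simp only [map_add, Finset.sum_add_distrib, hx, hy]
    | tmul x y => simp
  have hR (i : Fin 2) (a : OSL (s ^ 2)) :
      (opHom h ν hc p).rTensor (Atilde (s ^ 2)) (spinCoaction h ν hc (toS s ν c i a)) =
        ∑ k, TensorProduct.map (toS s ν c k) (timesChi (s ^ 2))
          ((R k i).lTensor _ (Coalgebra.comul a)) := by
    have h1 (j : Fin 2) (t : OSL (s ^ 2) ⊗[ℂ] OSL (s ^ 2)) :
        (opHom h ν hc p).rTensor (Atilde (s ^ 2)) (TensorProduct.map (toS s ν c j)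
          (timesChi (s ^ 2) ∘ₗ LinearMap.mulRight ℂ (OSL.u (s ^ 2) j i)) t) =
        ∑ k, TensorProduct.map (toS s ν c k)
          (timesChi (s ^ 2) ∘ₗ LinearMap.mulRight ℂ (OSL.u (s ^ 2) j i))
            ((act (p k j)).rTensor _ t) := by
      induction t with
      | zero => simp
      | add x y hx hy => simp only [map_add, Finset.sum_add_distrib, hx, hy]
      | tmul x y =>
        simp only [TensorProduct.map_tmul, LinearMap.rTensor_tmul, opHom_toS,
          TensorProduct.sum_tmul]
    rw [hΔ, map_sum]
    simp only [h1, rTensor_act_comul]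
    rw [Finset.sum_comm]
    refine Finset.sum_congr rfl fun k _ => ?_
    simp only [R]
    induction Coalgebra.comul (R := ℂ) a using TensorProduct.induction_on with
    | zero => simp
    | add x y hx hy => simp only [map_add, Finset.sum_add_distrib, hx, hy]
    | tmul x y => simp
  constructor
  · intro hD k i a
    have h1 := hD (toS s ν c i a)
    rw [hL, hR] at h1
    obtain ⟨τ, hτ⟩ := LinearMap.exists_leftInverse_of_injective (timesChi (s ^ 2))
      (LinearMap.ker_eq_bot.mpr (timesChi_injective _))
    -- The counit of the coefficient of ψ_k. It collapses a₍₁₎ and discards the other basis element.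
    let π : S0plus s ν c →ₗ[ℂ] ℂ :=
      Coalgebra.counit ∘ₗ LinearMap.proj k ∘ₗ (spinEquiv h ν hc).symm.toLinearMap
    have h2 (m : Fin 2) (f : OSL (s ^ 2) →ₗ[ℂ] OSL (s ^ 2)) (t : OSL (s ^ 2) ⊗[ℂ] OSL (s ^ 2)) :
        TensorProduct.lid ℂ _ (TensorProduct.map π τ (TensorProduct.map (toS s ν c m)
          (timesChi (s ^ 2)) (f.lTensor _ t))) =
        if m = k then f (TensorProduct.lid ℂ _ (Coalgebra.counit.rTensor _ t)) else 0 := by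
      induction t with
      | zero => simp
      | add x y hx hy => simp only [map_add, hx, hy]; split_ifs <;> simp
      | tmul x y =>
        have h3 : τ (timesChi (s ^ 2) (f y)) = f y := LinearMap.congr_fun hτ _
        simp only [LinearMap.lTensor_tmul, TensorProduct.map_tmul, h3, TensorProduct.lid_tmul, π,
          LinearMap.comp_apply, LinearEquiv.coe_coe, spinEquiv_symm_toS, LinearMap.proj_apply,
          LinearMap.rTensor_tmul, map_smul]
        split_ifs with hm
        · subst hm; simp
        · simp [Ne.symm hm]
    have h4 := congrArg (fun t => TensorProduct.lid ℂ _ (TensorProduct.map π τ t)) h1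
    simp only [map_sum, h2, Finset.sum_ite_eq', Finset.mem_univ, if_true,
      Coalgebra.rTensor_counit_comul, TensorProduct.lid_tmul, one_smul] at h4
    simpa [L, R] using h4
  · intro hp ψ
    have hLR (k i : Fin 2) : L k i = R k i := by
      ext a
      simpa [L, R] using hp k i a
    have := spin_hom_ext h ν hc (f := spinCoaction h ν hc ∘ₗ opHom h ν hc p)
      (g := (opHom h ν hc p).rTensor (Atilde (s ^ 2)) ∘ₗ spinCoaction h ν hc) (by
        intro i a
        rw [LinearMap.comp_apply, LinearMap.comp_apply, hL, hR]
        simp only [hLR])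
    exact LinearMap.congr_fun this ψ

/-! ### The basic equivariant symbol -/

theorem apply_mul_of_act_mul {ι : Type*} (t : Finset ι) (f : Dual s) (g h : ι → Dual s)
    (H : ∀ a b, act f (a * b) = ∑ r ∈ t, act (g r) a * act (h r) b) (a b : OSL (s ^ 2)) :
    f.ofConv (a * b) = ∑ r ∈ t, (g r).ofConv a * (h r).ofConv b := by
  have hc (f : Dual s) (a) : f.ofConv a = Coalgebra.counit (R := ℂ) (act f a) := by
    rw [← counit_eq_one_apply, apply_act, one_mul]
  rw [hc, H, map_sum]
  refine Finset.sum_congr rfl fun r _ => ?_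
  rw [Bialgebra.counit_mul, ← hc, ← hc]

/-- The matrix of functionals dual to `lB`. -/
def lH (s : ℂˣ) : Matrix (Fin 2) (Fin 2) (Dual s) :=
  !![fKinv s, ((s : ℂ)⁻¹ * qhat s) • fE s; 0, fK s]

theorem act_lH_mul (i k : Fin 2) (a b : OSL (s ^ 2)) :
    act (lH s i k) (a * b) = ∑ r, act (lH s i r) a * act (lH s r k) b := by
  have h0 : act (0 : Dual s) = 0 := map_zero (actHom s)
  fin_cases i <;> fin_cases k <;>
    simp [lH, h0, act_fK_mul, act_fKinv_mul, act_smul, act_fE_mul, add_comm]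

theorem lact_lH_mul (i k : Fin 2) (a b : OSL (s ^ 2)) :
    lact (lH s i k) (a * b) = ∑ r, lact (lH s i r) a * lact (lH s r k) b :=
  lact_apply_mul _ _ _ _ (apply_mul_of_act_mul _ _ _ _ (act_lH_mul i k)) a b

theorem lact_lA_mul (i k : Fin 2) (a b : OSL (s ^ 2)) :
    lact (lA s i k) (a * b) = ∑ r, lact (lA s i r) a * lact (lA s r k) b :=
  lact_apply_mul _ _ _ _ (apply_mul_of_act_mul _ _ _ _ (act_lA_mul i k)) a b

theorem lH_u (i k m n : Fin 2) : (lH s i k).ofConv (OSL.u (s ^ 2) m n) =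
    (!![!![(s : ℂ), 0; 0, (s : ℂ)⁻¹], !![0, 0; (s : ℂ)⁻¹ * qhat s, 0];
      0, !![(s : ℂ)⁻¹, 0; 0, (s : ℂ)]] : Matrix _ _ (Matrix (Fin 2) (Fin 2) ℂ)) i k m n := by
  fin_cases i <;> fin_cases k <;> fin_cases m <;> fin_cases n <;>
    simp [lH, fK_u, fKinv_u, fE_u]

theorem lH_one (i k : Fin 2) : (lH s i k).ofConv 1 = if i = k then 1 else 0 := by
  fin_cases i <;> fin_cases k <;> simp [lH, fK_one, fKinv_one, fE_one]

theorem lA_one (i k : Fin 2) : (lA s i k).ofConv 1 = if i = k then 1 else 0 := by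
  fin_cases i <;> fin_cases k <;> simp [lA, fK_one, fKinv_one, fF_one]

theorem isQMat_normal_sq (s : ℂˣ) :
    let u := OSL.u (s ^ 2)
    u 0 1 * u 0 0 = (qq s)⁻¹ • (u 0 0 * u 0 1) ∧ u 1 0 * u 0 0 = (qq s)⁻¹ • (u 0 0 * u 1 0) ∧
    u 1 1 * u 0 1 = (qq s)⁻¹ • (u 0 1 * u 1 1) ∧ u 1 1 * u 1 0 = (qq s)⁻¹ • (u 1 0 * u 1 1) ∧
    u 1 0 * u 0 1 = u 0 1 * u 1 0 ∧ u 0 0 * u 1 1 = 1 + qq s • (u 0 1 * u 1 0) ∧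
    u 1 1 * u 0 0 = 1 + (qq s)⁻¹ • (u 0 1 * u 1 0) := by
  have key (q : ℂˣ) (e : (q : ℂ) = qq s) :
      let u := OSL.u q
      u 0 1 * u 0 0 = (qq s)⁻¹ • (u 0 0 * u 0 1) ∧ u 1 0 * u 0 0 = (qq s)⁻¹ • (u 0 0 * u 1 0) ∧
      u 1 1 * u 0 1 = (qq s)⁻¹ • (u 0 1 * u 1 1) ∧ u 1 1 * u 1 0 = (qq s)⁻¹ • (u 1 0 * u 1 1) ∧
      u 1 0 * u 0 1 = u 0 1 * u 1 0 ∧ u 0 0 * u 1 1 = 1 + qq s • (u 0 1 * u 1 0) ∧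
      u 1 1 * u 0 0 = 1 + (qq s)⁻¹ • (u 0 1 * u 1 0) := by
    rw [← e]
    exact (OSL.isQMat_u q).normal
  exact key (s ^ 2) (Units.val_pow_eq_pow_val s 2)

/-- On generators this is an exchange relation that follows from the defining relations of
O(SL_q(2)). It extends to products because the left and right actions of `lH` have the same matrix
coproduct, so u can be moved past one factor at a time. -/
theorem lH_intertwines (k i : Fin 2) (a : OSL (s ^ 2)) :
    ∑ j, lact (lH s k j) a * OSL.u (s ^ 2) j i = ∑ j, OSL.u (s ^ 2) k j * act (lH s j i) a := by
  have hs := s.ne_zero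
  induction a using OSL.induction generalizing k i with
  | one => simp [act_apply_one, lact_apply_one, lH_one]
  | smul z a h =>
    simp only [map_smul, smul_mul_assoc, mul_smul_comm, ← Finset.smul_sum, h]
  | add a b ha hb =>
    simp only [map_add, add_mul, mul_add, Finset.sum_add_distrib, ha, hb]
  | mul a b ha hb =>
    calc ∑ j, lact (lH s k j) (a * b) * OSL.u (s ^ 2) j i
        = ∑ r, lact (lH s k r) a * ∑ j, lact (lH s r j) b * OSL.u (s ^ 2) j i := by
          simp only [lact_lH_mul, Finset.sum_mul, Finset.mul_sum, mul_assoc]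
          exact Finset.sum_comm
      _ = ∑ j, (∑ r, lact (lH s k r) a * OSL.u (s ^ 2) r j) * act (lH s j i) b := by
          simp only [hb, Finset.sum_mul, Finset.mul_sum, mul_assoc]
          exact Finset.sum_comm
      _ = ∑ j, OSL.u (s ^ 2) k j * act (lH s j i) (a * b) := by
          simp only [ha, act_lH_mul, Finset.sum_mul, Finset.mul_sum, mul_assoc]
          exact Finset.sum_comm
  | u m n =>
    obtain ⟨h1, h2, h3, h4, h5, h6, h7⟩ := isQMat_normal_sq s
    fin_cases k <;> fin_cases i <;> fin_cases m <;> fin_cases n <;>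
      simp [act_u, lact_u, lH_u, h1, h2, h3, h4, h5, h6, h7] <;>
      match_scalars <;> simp only [qhat, qq] <;> field_simp <;> ring

/-- The companion exchange relation, with the indices of u contracted on the other side. Its proof
follows the same pattern, and the two are made to be composed in `isEquivariant_symW`. -/
theorem lA_intertwines (k i : Fin 2) (a : OSL (s ^ 2)) :
    ∑ j, act (lA s i j) a * OSL.u (s ^ 2) k j = ∑ j, OSL.u (s ^ 2) j i * lact (lA s j k) a := by
  have hs := s.ne_zero
  induction a using OSL.induction generalizing k i with
  | one => simp [act_apply_one, lact_apply_one, lA_one]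
  | smul z a h =>
    simp only [map_smul, smul_mul_assoc, mul_smul_comm, ← Finset.smul_sum, h]
  | add a b ha hb =>
    simp only [map_add, add_mul, mul_add, Finset.sum_add_distrib, ha, hb]
  | mul a b ha hb =>
    calc ∑ j, act (lA s i j) (a * b) * OSL.u (s ^ 2) k j
        = ∑ r, act (lA s i r) a * ∑ j, act (lA s r j) b * OSL.u (s ^ 2) k j := by
          simp only [act_lA_mul, Finset.sum_mul, Finset.mul_sum, mul_assoc]
          exact Finset.sum_comm
      _ = ∑ j, (∑ r, act (lA s i r) a * OSL.u (s ^ 2) j r) * lact (lA s j k) b := by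
          simp only [hb, Finset.sum_mul, Finset.mul_sum, mul_assoc]
          exact Finset.sum_comm
      _ = ∑ j, OSL.u (s ^ 2) j i * lact (lA s j k) (a * b) := by
          simp only [ha, lact_lA_mul, Finset.sum_mul, Finset.mul_sum, mul_assoc]
          exact Finset.sum_comm
  | u m n =>
    obtain ⟨h1, h2, h3, h4, h5, h6, h7⟩ := isQMat_normal_sq s
    fin_cases k <;> fin_cases i <;> fin_cases m <;> fin_cases n <;>
      simp [act_u, lact_u, lA_u, h1, h2, h3, h4, h5, h6, h7] <;>
      match_scalars <;> simp only [qhat, qq] <;> field_simp <;> ring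

/-- The functional `ε_± K⁻¹ E`. -/
def eE (s : ℂˣ) (ν : ℤˣ) : Dual s := fEps s ν * (fKinv s * fE s)

/-- The functional `ε_± K⁻²`. -/
def eK (s : ℂˣ) (ν : ℤˣ) : Dual s := fEps s ν * (fKinv s * fKinv s)

/-- The functional `ε_± F K⁻¹`. -/
def eF (s : ℂˣ) (ν : ℤˣ) : Dual s := fEps s ν * (fF s * fKinv s)

/-- The Casimir functional, twisted by `ε_±`. -/
def eZ (s : ℂˣ) (ν : ℤˣ) : Dual s :=
  fEps s ν * (fF s * fE s + (qq s / qhat s ^ 2) • (fK s * fK s)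
    + ((qq s)⁻¹ / qhat s ^ 2) • (fKinv s * fKinv s))

/-- The symbol of `∂₀ + ∂₁`. -/
def symW (s : ℂˣ) (ν : ℤˣ) : Matrix (Fin 2) (Fin 2) (Dual s) :=
  !![((s : ℂ) / qhat s) • eK s ν, eE s ν;
    eF s ν, ((s : ℂ)⁻¹ * qhat s) • eZ s ν + (-((s : ℂ)⁻¹ ^ 3 / qhat s)) • eK s ν]

theorem act_sum {ι : Type*} (t : Finset ι) (f : ι → Dual s) :
    act (∑ i ∈ t, f i) = ∑ i ∈ t, act (f i) := map_sum (actHom s) f t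

theorem lact_sum {ι : Type*} (t : Finset ι) (f : ι → Dual s) :
    lact (∑ i ∈ t, f i) = ∑ i ∈ t, lact (f i) := map_sum (lactLin s) f t

/-- The factorization of W as the transpose of `lA` times `lH` is the source of its equivariance. -/
theorem symW_eq (h : NotRootOfUnity s) (ν : ℤˣ) (k i : Fin 2) : symW s ν k i =
    ((s : ℂ) / qhat s) • (fEps s ν * ∑ m, lA s m k * lH s m i) := by
  have hs := s.ne_zero
  have hh := h.qhat_ne_zero
  fin_cases k <;> fin_cases i <;>
    simp [symW, eK, eE, eF, eZ, lA, lH, mul_add, smul_smul, -neg_smul, mul_smul_comm,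
      qq] <;>
    match_scalars <;> field_simp
  ring

/-- `lA_intertwines` moves u to the left and turns the action of the first factor into a `lact`;
`lH_intertwines` moves u back to the right and converts the second factor. Between the two, `act`
and `lact` commute, and ε_± is absorbed into a since its two actions agree. -/
theorem isEquivariant_symW (h : NotRootOfUnity s) (ν : ℤˣ) : IsEquivariant (symW s ν) := by
  intro k i a
  have hL (j : Fin 2) : act (symW s ν j i) a = ((s : ℂ) / qhat s) •
      ∑ m, act (lA s m j) (act (lH s m i) (act (fEps s ν) a)) := by
    rw [symW_eq h, fEps_comm, act_smul, act_mul, act_sum]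
    simp [act_mul]
  have hR (j : Fin 2) : lact (symW s ν k j) a = ((s : ℂ) / qhat s) •
      ∑ m, lact (lH s m j) (lact (lA s m k) (act (fEps s ν) a)) := by
    rw [symW_eq h, lact_smul, lact_mul, lact_sum, act_fEps_eq_lact]
    simp [lact_mul]
  simp only [hL, hR, smul_mul_assoc, ← Finset.smul_sum]
  congr 1
  generalize act (fEps s ν) a = a
  calc ∑ j, (∑ m, act (lA s m j) (act (lH s m i) a)) * OSL.u (s ^ 2) k j
      = ∑ m, ∑ j, act (lA s m j) (act (lH s m i) a) * OSL.u (s ^ 2) k j := by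
        simp only [Finset.sum_mul]; exact Finset.sum_comm
    _ = ∑ j, ∑ m, OSL.u (s ^ 2) j m * act (lH s m i) (lact (lA s j k) a) := by
        simp only [lA_intertwines, act_lact_comm]; exact Finset.sum_comm
    _ = ∑ j, (∑ m, lact (lH s m j) (lact (lA s m k) a)) * OSL.u (s ^ 2) j i := by
        simp only [← lH_intertwines, Finset.sum_mul]; exact Finset.sum_comm

/-! ### The symbols of ∂₀ and ∂₁ in terms of the Casimir functional and W -/

theorem chat_apply (i j : Fin 2) : Chat s i j = !![0, -(s : ℂ)⁻¹; (s : ℂ), 0] i j := by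
  fin_cases i <;> fin_cases j <;> simp [Chat, Ccheck]

theorem xshift_eq (h : NotRootOfUnity s) (ν : ℤˣ) (i j : Fin 2) : Xshift s ν i j =
    !![(-(s : ℂ)) • eE s ν, (qhat s)⁻¹ • eK s ν;
      (-(qhat s)) • eZ s ν + ((qq s)⁻¹ / qhat s) • eK s ν, (s : ℂ)⁻¹ • eF s ν] i j := by
  have hs := s.ne_zero
  have hh := h.qhat_ne_zero
  have hq := qq_ne_zero s
  fin_cases i <;> fin_cases j
  · simp [Xshift, X, eE, Ccheck, -neg_smul]
  · simp only [Xshift, X, eK, Ccheck]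
    simp [hs]
    module
  · simp only [Xshift, X, eK, eZ, Ccheck]
    simp only [Fin.mk_one, Fin.zero_eta, Matrix.of_apply, Matrix.cons_val', Matrix.cons_val_zero,
      Matrix.cons_val_one, Matrix.cons_val_fin_one, mul_add, mul_smul_comm]
    match_scalars <;> field_simp <;> simp [qq]
  · simp [Xshift, X, eF, Ccheck]

/-- In the contraction with Ĉ the terms in κ cancel and only the Casimir functional survives. The
matrix is scalar because Č Ĉ = 1. -/
theorem symbolOf_D0 (h : NotRootOfUnity s) (ν : ℤˣ) :
    (symbolOf s (D0 s ν) : Matrix (Fin 2) (Fin 2) (Dual s)) =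
      ((s : ℂ) * qhat s / two s) • Matrix.scalar (Fin 2) (eZ s ν) := by
  have hs := s.ne_zero
  have hh := h.qhat_ne_zero
  have h2 := h.two_ne_zero
  have hT : ∑ k, ∑ l, Chat s k l • Xshift s ν k l = (-((s : ℂ) * qhat s)) • eZ s ν := by
    simp only [xshift_eq h, chat_apply, Fin.sum_univ_two]
    simp [smul_smul, -neg_smul, qq]
    match_scalars <;> field_simp
    ring
  refine Matrix.ext fun k i => ?_
  simp only [symbolOf, D0, hT]
  simp only [Fin.sum_univ_two, chat_apply, Ccheck, smul_smul]
  fin_cases k <;> fin_cases i <;> simp [-neg_smul] <;> congr 1 <;> field_simp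

theorem symbolOf_D0_add_D1 (h : NotRootOfUnity s) (ν : ℤˣ) :
    (symbolOf s (D0 s ν) + symbolOf s (D1 s ν) : Matrix (Fin 2) (Fin 2) (Dual s)) =
      symW s ν := by
  have hs := s.ne_zero
  have hh := h.qhat_ne_zero
  refine Matrix.ext fun k i => ?_
  have h1 : symbolOf s (D0 s ν) k i + symbolOf s (D1 s ν) k i =
      ∑ j, Chat s j i • Xshift s ν k j := by
    rw [symbolOf, symbolOf, ← Finset.sum_add_distrib]
    refine Finset.sum_congr rfl fun j _ => ?_
    rw [← smul_add, D1, add_sub_cancel]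
  change symbolOf s (D0 s ν) k i + symbolOf s (D1 s ν) k i = _
  rw [h1]
  simp only [xshift_eq h, chat_apply, Fin.sum_univ_two, symW]
  fin_cases k <;> fin_cases i <;> simp [-neg_smul, smul_smul, qq] <;>
    match_scalars <;> field_simp

/-! ### Relations between `eE`, `eK`, `eF`, `eZ` -/

theorem fE_mul_eK (ν : ℤˣ) : fE s * eK s ν = (qq s ^ 2) • (eK s ν * fE s) := by
  have hq := qq_ne_zero s
  simp only [eK, mul_fEps_assoc, mul_assoc, fKinv_mul_fE_assoc, fKinv_mul_fE, mul_smul_comm,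
    smul_smul]
  match_scalars
  field_simp

theorem commute_fK_eK (ν : ℤˣ) : Commute (fK s) (eK s ν) := by
  rw [commute_iff_eq]
  simp only [eK, mul_fEps_assoc, mul_assoc, fKinv_mul_fK, fK_mul_fKinv_assoc, mul_one]

theorem commute_fK_eZ (ν : ℤˣ) : Commute (fK s) (eZ s ν) := by
  have hq := qq_ne_zero s
  rw [commute_iff_eq]
  simp only [eZ, mul_fEps_assoc, mul_assoc, mul_add, add_mul, mul_smul_comm, smul_mul_assoc,
    fK_mul_fKinv_assoc, fK_mul_fE, fK_mul_fF_assoc, fKinv_mul_fK, mul_one,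
    smul_smul]
  match_scalars <;> field_simp

theorem commute_fKinv_of_commute_fK {x : Dual s} (h : Commute (fK s) x) : Commute (fKinv s) x := by
  rw [commute_iff_eq] at h ⊢
  calc fKinv s * x = fKinv s * (x * fK s) * fKinv s := by
        rw [mul_assoc, mul_assoc, fK_mul_fKinv, mul_one]
    _ = x * fKinv s := by rw [← h, fKinv_mul_fK_assoc]

theorem commute_fKinv_eZ (ν : ℤˣ) : Commute (fKinv s) (eZ s ν) :=
  commute_fKinv_of_commute_fK (commute_fK_eZ ν)

theorem commute_fEps (ν : ℤˣ) (x : Dual s) : Commute (fEps s ν) x := fEps_comm ν x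

/-- The terms K^{±2} E created by moving E past F cancel those from moving E past K^{±2}; this fixes
the two coefficients in the Casimir. -/
theorem commute_fE_eZ (h : NotRootOfUnity s) (ν : ℤˣ) : Commute (fE s) (eZ s ν) := by
  have hq := qq_ne_zero s
  have hh := h.qhat_ne_zero
  rw [commute_iff_eq]
  simp only [eZ, mul_fEps_assoc, mul_assoc, mul_add, add_mul, mul_smul_comm, smul_mul_assoc,
    fE_mul_fF_assoc h, fKinv_mul_fE_assoc, fK_mul_fE_assoc, fKinv_mul_fE, fK_mul_fE, smul_smul]
  match_scalars <;> field_simp <;> rw [qhat] <;> field_simp <;> ring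

theorem commute_fF_eZ (h : NotRootOfUnity s) (ν : ℤˣ) : Commute (fF s) (eZ s ν) := by
  have hq := qq_ne_zero s
  have hh := h.qhat_ne_zero
  rw [commute_iff_eq]
  simp only [eZ, mul_fEps_assoc, mul_assoc, mul_add, add_mul, mul_smul_comm, smul_mul_assoc,
    fE_mul_fF' h, fKinv_mul_fF_assoc, fK_mul_fF_assoc, fKinv_mul_fF, fK_mul_fF, smul_smul]
  match_scalars <;> field_simp <;> rw [qhat] <;> field_simp <;> ring

theorem commute_eK_eZ (ν : ℤˣ) : Commute (eK s ν) (eZ s ν) :=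
  (commute_fEps ν _).mul_left ((commute_fKinv_eZ ν).mul_left (commute_fKinv_eZ ν))

theorem commute_eE_eZ (h : NotRootOfUnity s) (ν : ℤˣ) : Commute (eE s ν) (eZ s ν) :=
  (commute_fEps ν _).mul_left ((commute_fKinv_eZ ν).mul_left (commute_fE_eZ h ν))

theorem commute_eF_eZ (h : NotRootOfUnity s) (ν : ℤˣ) : Commute (eF s ν) (eZ s ν) :=
  (commute_fEps ν _).mul_left ((commute_fF_eZ h ν).mul_left (commute_fKinv_eZ ν))

theorem eK_mul_eE (ν : ℤˣ) : eK s ν * eE s ν = ((qq s)⁻¹ ^ 2) • (eE s ν * eK s ν) := by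
  have hq := qq_ne_zero s
  simp only [eK, eE, mul_fEps_assoc, mul_assoc, fKinv_mul_fE_assoc, fKinv_mul_fE, mul_smul_comm,
    smul_mul_assoc, smul_smul]
  match_scalars
  field_simp

theorem eK_mul_eF (ν : ℤˣ) : eK s ν * eF s ν = (qq s ^ 2) • (eF s ν * eK s ν) := by
  have hq := qq_ne_zero s
  simp only [eK, eF, mul_fEps_assoc, mul_assoc, fKinv_mul_fF_assoc, mul_smul_comm,
    smul_smul]
  match_scalars
  ring

theorem eE_mul_eF (h : NotRootOfUnity s) (ν : ℤˣ) : eE s ν * eF s ν = eZ s ν * eK s ν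
    + (-(qq s / qhat s ^ 2)) • (eK s ν * eK s ν) + (-((qq s)⁻¹ / qhat s ^ 2)) • 1 := by
  have hq := qq_ne_zero s
  have hh := h.qhat_ne_zero
  simp only [eK, eE, eF, eZ, mul_fEps_assoc, fEps_mul_fEps_assoc, mul_assoc, mul_add, add_mul,
    mul_smul_comm, smul_mul_assoc, fE_mul_fF_assoc h, fKinv_mul_fF_assoc, fKinv_mul_fE, smul_smul,
    smul_add, fK_mul_fKinv, fK_mul_fKinv_assoc]
  match_scalars <;> field_simp <;> rw [qhat] <;> field_simp <;> ring

theorem eF_mul_eE (h : NotRootOfUnity s) (ν : ℤˣ) : eF s ν * eE s ν =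
    ((qq s)⁻¹ ^ 2) • (eZ s ν * eK s ν)
    + (-((qq s)⁻¹ ^ 3 / qhat s ^ 2)) • (eK s ν * eK s ν)
    + (-((qq s)⁻¹ / qhat s ^ 2)) • 1 := by
  have hq := qq_ne_zero s
  have hh := h.qhat_ne_zero
  simp only [eK, eE, eF, eZ, mul_fEps_assoc, fEps_mul_fEps_assoc, mul_assoc, mul_add, add_mul,
    mul_smul_comm, smul_mul_assoc, fKinv_mul_fE_assoc,
    fKinv_mul_fE, smul_smul, smul_add, fK_mul_fKinv, fK_mul_fKinv_assoc]
  match_scalars <;> field_simp <;> ring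

/-- A Cayley–Hamilton identity with the central Z in the role of the trace. With W = x + y and
q^{-1/2} q̂ Z = (1 + q⁻²) x it is the relation of the theorem. -/
theorem symW_mul_self (h : NotRootOfUnity s) (ν : ℤˣ) : symW s ν * symW s ν =
    ((s : ℂ)⁻¹ * qhat s) • (Matrix.scalar (Fin 2) (eZ s ν) * symW s ν)
      + (-((qq s)⁻¹ / qhat s ^ 2)) • 1 := by
  have hs := s.ne_zero
  have hh := h.qhat_ne_zero
  have hq := qq_ne_zero s
  have cK : eK s ν * eZ s ν = eZ s ν * eK s ν := commute_eK_eZ ν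
  have cE : eE s ν * eZ s ν = eZ s ν * eE s ν := commute_eE_eZ h ν
  have cF : eF s ν * eZ s ν = eZ s ν * eF s ν := commute_eF_eZ h ν
  ext1 i j
  fin_cases i <;> fin_cases j <;>
    simp [symW, Matrix.mul_apply, Fin.sum_univ_two, mul_add, add_mul, mul_smul_comm,
      smul_mul_assoc, eE_mul_eF h, eF_mul_eE h, eK_mul_eE, eK_mul_eF, cK, cE, smul_smul,
      -neg_smul, Matrix.scalar_apply, smul_add, qq] <;>
    match_scalars <;> field_simp <;> ring

/-! ### Linear independence of functionals -/

theorem NotRootOfUnity.pow_injective (h : NotRootOfUnity s) :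
    Function.Injective fun n : ℕ => qq s ^ n := by
  have key : ∀ m n : ℕ, m < n → qq s ^ m ≠ qq s ^ n := by
    intro m n hmn he
    refine h (n - m) (Nat.sub_pos_of_lt hmn) ?_
    have h1 : qq s ^ m * qq s ^ (n - m) = qq s ^ m * 1 := by
      rw [← pow_add, Nat.add_sub_cancel' hmn.le, mul_one, he]
    exact mul_left_cancel₀ (pow_ne_zero _ (qq_ne_zero s)) h1
  intro m n he
  rcases lt_trichotomy m n with hmn | hmn | hmn
  · exact absurd he (key m n hmn)
  · exact hmn
  · exact absurd he.symm (key n m hmn)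

/-- A highest weight vector of weight `2m`. -/
def hwv (s : ℂˣ) (m : ℕ) : OSL (s ^ 2) := OSL.u (s ^ 2) 1 1 ^ (2 * m)

theorem act_pow_of_eigen {f : Dual s} (hf : ∀ a b, act f (a * b) = act f a * act f b)
    (h1 : act f 1 = 1) {a : OSL (s ^ 2)} {z : ℂ} (ha : act f a = z • a) (n : ℕ) :
    act f (a ^ n) = z ^ n • a ^ n := by
  induction n with
  | zero => simp [h1]
  | succ n ih => rw [pow_succ a n, hf, ih, ha, smul_mul_smul_comm, pow_succ z n]

theorem act_fK_hwv (m : ℕ) : act (fK s) (hwv s m) = (qq s ^ m) • hwv s m := by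
  rw [hwv, act_pow_of_eigen act_fK_mul (by rw [act_apply_one, fK_one, one_smul])
    (act_fK_u 1 1), qq, ← pow_mul]
  rfl

theorem act_fKinv_hwv (m : ℕ) : act (fKinv s) (hwv s m) = ((qq s)⁻¹ ^ m) • hwv s m := by
  rw [hwv, act_pow_of_eigen act_fKinv_mul (by rw [act_apply_one, fKinv_one, one_smul])
    (act_fKinv_u 1 1), qq, ← inv_pow, ← pow_mul]
  rfl

theorem act_fEps_hwv (ν : ℤˣ) (m : ℕ) : act (fEps s ν) (hwv s m) = hwv s m := by
  rw [hwv, act_pow_of_eigen (act_fEps_mul ν) (by rw [act_apply_one, fEps_one, one_smul])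
    (act_fEps_u ν 1 1), pow_mul (sgn ν), pow_two (sgn ν), sgn_mul_self, one_pow,
    one_smul]

theorem act_fE_hwv (m : ℕ) : act (fE s) (hwv s m) = 0 := by
  rw [hwv]
  induction 2 * m with
  | zero => simp [act_apply_one, fE_one]
  | succ n ih => rw [pow_succ _ n, act_fE_mul, ih, act_fE_u_one, zero_mul, mul_zero, add_zero]

theorem hwv_ne_zero (m : ℕ) : hwv s m ≠ 0 := by
  intro h0
  have h1 : (fK s).ofConv (hwv s m) = (s : ℂ) ^ (2 * m) := by
    rw [hwv]
    induction 2 * m with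
    | zero => simp [fK_one]
    | succ n ih => rw [pow_succ _ n, fK_mul, ih, fK_u, pow_succ (s : ℂ) n]; rfl
  rw [h0, map_zero] at h1
  exact pow_ne_zero _ s.ne_zero h1.symm

/-- The vectors `F^i v` for the highest weight vector `v`. -/
def wv (s : ℂˣ) (m i : ℕ) : OSL (s ^ 2) := (act (fF s) ^ i) (hwv s m)

theorem wv_succ (m i : ℕ) : wv s m (i + 1) = act (fF s) (wv s m i) := by
  rw [wv, wv, pow_succ' (act (fF s)) i, Module.End.mul_apply]

theorem act_mul_apply (f g : Dual s) (a : OSL (s ^ 2)) : act (f * g) a = act f (act g a) := by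
  rw [act_mul, LinearMap.comp_apply]

theorem act_smul_apply (z : ℂ) (f : Dual s) (a : OSL (s ^ 2)) : act (z • f) a = z • act f a := by
  rw [act_smul, LinearMap.smul_apply]

theorem act_add_apply (f g : Dual s) (a : OSL (s ^ 2)) : act (f + g) a = act f a + act g a := by
  rw [act_add, LinearMap.add_apply]

theorem act_fK_wv (m i : ℕ) :
    act (fK s) (wv s m i) = (qq s ^ m * (qq s)⁻¹ ^ i) • wv s m i := by
  induction i with
  | zero => simpa [wv] using act_fK_hwv m
  | succ i ih =>
    rw [wv_succ, ← act_mul_apply, fK_mul_fF, act_smul_apply, act_mul_apply, ih, map_smul,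
      smul_smul]
    congr 1
    ring

theorem act_fKinv_wv (m i : ℕ) :
    act (fKinv s) (wv s m i) = ((qq s)⁻¹ ^ m * qq s ^ i) • wv s m i := by
  induction i with
  | zero => simpa [wv] using act_fKinv_hwv m
  | succ i ih =>
    rw [wv_succ, ← act_mul_apply, fKinv_mul_fF, act_smul_apply, act_mul_apply, ih, map_smul,
      smul_smul]
    congr 1
    ring

theorem act_fEps_wv (ν : ℤˣ) (m i : ℕ) : act (fEps s ν) (wv s m i) = wv s m i := by
  induction i with
  | zero => simpa [wv] using act_fEps_hwv ν m
  | succ i ih => rw [wv_succ, ← act_mul_apply, fEps_comm, act_mul_apply, ih]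

/-- The eigenvalue of the Casimir functional on `wv s m i`. -/
def zval (s : ℂˣ) (m : ℕ) : ℂ :=
  (qq s * qq s ^ (2 * m) + (qq s)⁻¹ * (qq s)⁻¹ ^ (2 * m)) / qhat s ^ 2

/-- Z commutes with F, so its eigenvalue is that on the highest weight vector, where E vanishes. The
exponent 2m of u²₂ is even, which makes ε_± act trivially. -/
theorem act_eZ_wv (h : NotRootOfUnity s) (ν : ℤˣ) (m i : ℕ) :
    act (eZ s ν) (wv s m i) = zval s m • wv s m i := by
  induction i with
  | zero =>
    have h0 : wv s m 0 = hwv s m := by simp [wv]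
    rw [h0, eZ]
    simp only [act_mul_apply, act_add_apply, act_smul_apply, act_fE_hwv, act_fK_hwv,
      act_fKinv_hwv, map_zero, map_smul, map_add, act_fEps_hwv]
    rw [zval]
    match_scalars
    ring
  | succ i ih => rw [wv_succ, ← act_mul_apply, ← (commute_fF_eZ h ν).eq, act_mul_apply, ih,
      map_smul]

theorem act_eK_wv (ν : ℤˣ) (m i : ℕ) :
    act (eK s ν) (wv s m i) = ((qq s)⁻¹ ^ (2 * m) * qq s ^ (2 * i)) • wv s m i := by
  rw [eK]
  simp only [act_mul_apply, act_fKinv_wv, map_smul, act_fEps_wv, smul_smul]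
  congr 1
  ring

theorem fEps_one_eq : fEps s 1 = 1 := by
  refine eq_of_act_eq fun a => ?_
  rw [act_one, LinearMap.id_apply]
  induction a using OSL.induction with
  | one => simp [act_apply_one, fEps_one]
  | smul z a h => simp [h]
  | add a b ha hb => simp [ha, hb]
  | mul a b ha hb => simp [act_fEps_mul, ha, hb]
  | u i j => simp [act_fEps_u, sgn]

theorem fE_mul_fF_eq (h : NotRootOfUnity s) : fE s * fF s = eZ s 1
    + (-((qq s)⁻¹ / qhat s ^ 2)) • (fK s * fK s)
    + (-(qq s / qhat s ^ 2)) • (fKinv s * fKinv s) := by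
  have hh := h.qhat_ne_zero
  have hq := qq_ne_zero s
  rw [fE_mul_fF' h, eZ, fEps_one_eq, one_mul]
  match_scalars <;> field_simp <;> rw [qhat] <;> field_simp <;> ring

theorem act_fE_wv_succ (h : NotRootOfUnity s) (m i j : ℕ) (hij : i + j + 1 = 2 * m) :
    ∃ z : ℂ, z ≠ 0 ∧ act (fE s) (wv s m (i + 1)) = z • wv s m i := by
  have hh := h.qhat_ne_zero
  have hq := qq_ne_zero s
  have hne (n : ℕ) : qq s ^ (n + 1) - (qq s)⁻¹ ^ (n + 1) ≠ 0 := by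
    intro h0
    refine h (2 * (n + 1)) (by omega) ?_
    have : qq s ^ (n + 1) * (qq s)⁻¹ ^ (n + 1) = 1 := by
      rw [← mul_pow, mul_inv_cancel₀ hq, one_pow]
    linear_combination (qq s) ^ (n + 1) * h0 + this
  -- The constant is [i + 1][2m - i] in q-integers, nonzero since q is not a root of unity. It comes
  -- from writing EF as the Casimir minus terms in K^{±2}, which act diagonally.
  refine ⟨(qq s ^ (j + 1) - (qq s)⁻¹ ^ (j + 1)) * (qq s ^ (i + 1) - (qq s)⁻¹ ^ (i + 1)) /
    qhat s ^ 2, div_ne_zero (mul_ne_zero (hne j) (hne i)) (pow_ne_zero _ hh), ?_⟩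
  rw [wv_succ, ← act_mul_apply, fE_mul_fF_eq h]
  simp only [act_mul_apply, act_add_apply, act_smul_apply, act_fK_wv, act_fKinv_wv, map_smul,
    act_eZ_wv h, smul_smul, ← add_smul]
  congr 1
  have e1 : (qq s ^ m) * (qq s ^ m) = qq s * qq s ^ i * qq s ^ j := by
    rw [← pow_add, ← two_mul, ← hij]; ring
  have e2 : ((qq s)⁻¹ ^ m) * ((qq s)⁻¹ ^ m) = (qq s)⁻¹ * (qq s)⁻¹ ^ i * (qq s)⁻¹ ^ j := by
    rw [← pow_add, ← two_mul, ← hij]; ring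
  rw [zval, ← hij]
  have e3 : qq s ^ m * (qq s)⁻¹ ^ i * (qq s ^ m * (qq s)⁻¹ ^ i) =
      qq s * qq s ^ i * qq s ^ j * (qq s)⁻¹ ^ i * (qq s)⁻¹ ^ i := by rw [← e1]; ring
  have e4 : (qq s)⁻¹ ^ m * qq s ^ i * ((qq s)⁻¹ ^ m * qq s ^ i) =
      (qq s)⁻¹ * (qq s)⁻¹ ^ i * (qq s)⁻¹ ^ j * qq s ^ i * qq s ^ i := by rw [← e2]; ring
  rw [e3, e4]
  simp only [inv_pow, pow_succ, pow_add]
  field_simp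
  ring

theorem wv_ne_zero (h : NotRootOfUnity s) (m i : ℕ) (hi : i ≤ 2 * m) : wv s m i ≠ 0 := by
  induction i with
  | zero => simpa [wv] using hwv_ne_zero m
  | succ i ih =>
    obtain ⟨z, hz, he⟩ := act_fE_wv_succ h m i (2 * m - i - 1) (by omega)
    intro h0
    rw [h0, map_zero] at he
    exact smul_ne_zero hz (ih (by omega)) he.symm

/-- If t + t⁻¹ = t' + t'⁻¹ then t = t' or t t' = 1. For t and t' odd positive powers of q the second
case would make q a root of unity. -/
theorem zval_injective (h : NotRootOfUnity s) : Function.Injective (zval s) := by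
  intro m n he
  have hh := h.qhat_ne_zero
  have hq := qq_ne_zero s
  have a0 : qq s ^ (2 * m + 1) ≠ 0 := pow_ne_zero _ hq
  have b0 : qq s ^ (2 * n + 1) ≠ 0 := pow_ne_zero _ hq
  have h1 : qq s ^ (2 * m + 1) + (qq s ^ (2 * m + 1))⁻¹ =
      qq s ^ (2 * n + 1) + (qq s ^ (2 * n + 1))⁻¹ := by
    rw [zval, zval, div_left_inj' (pow_ne_zero _ hh)] at he
    rw [← inv_pow, ← inv_pow]
    linear_combination he
  have h2 : (qq s ^ (2 * m + 1) - qq s ^ (2 * n + 1)) *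
      (qq s ^ (2 * m + 1) * qq s ^ (2 * n + 1) - 1) = 0 := by
    field_simp at h1
    linear_combination h1
  rcases mul_eq_zero.mp h2 with h3 | h3
  · have := h.pow_injective (sub_eq_zero.mp h3)
    omega
  · rw [← pow_add, sub_eq_zero] at h3
    exact absurd h3 (h _ (by omega))

open Polynomial in
/-- The functional `∑_j p_j(Z) K^j` for a polynomial `p` in two variables, where `Z` and `K` stand
for `eZ` and `eK`. -/
def evalZK (s : ℂˣ) (ν : ℤˣ) (p : ℂ[X][X]) : Dual s :=
  p.sum fun j P => aeval (eZ s ν) P * eK s ν ^ j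

open Polynomial in
theorem act_aeval_eZ_wv (h : NotRootOfUnity s) (ν : ℤˣ) (P : ℂ[X]) (m i : ℕ)
    (hi : i ≤ 2 * m) : act (aeval (eZ s ν) P) (wv s m i) = P.eval (zval s m) • wv s m i := by
  rw [← actHom_apply, ← aeval_algHom_apply]
  exact Module.End.aeval_apply_of_hasEigenvector
    ⟨Module.End.mem_eigenspace_iff.mpr (act_eZ_wv h ν m i), wv_ne_zero h m i hi⟩

open Polynomial in
theorem act_evalZK_wv (h : NotRootOfUnity s) (ν : ℤˣ) (p : ℂ[X][X]) (m i : ℕ) (hi : i ≤ 2 * m) :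
    act (evalZK s ν p) (wv s m i) =
      (p.map (evalRingHom (zval s m))).eval ((qq s)⁻¹ ^ (2 * m) * qq s ^ (2 * i)) • wv s m i := by
  have hK (j : ℕ) : act (eK s ν ^ j) (wv s m i) =
      ((qq s)⁻¹ ^ (2 * m) * qq s ^ (2 * i)) ^ j • wv s m i := by
    induction j with
    | zero => simp [act_one]
    | succ j ih => rw [pow_succ (eK s ν) j, act_mul_apply, act_eK_wv, map_smul, ih, smul_smul,
        ← pow_succ']
  rw [evalZK, Polynomial.sum, act_sum, LinearMap.sum_apply, eval_map, eval₂_eq_sum,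
    Polynomial.sum, Finset.sum_smul]
  refine Finset.sum_congr rfl fun j _ => ?_
  rw [act_mul_apply, hK, map_smul, act_aeval_eZ_wv h ν _ m i hi, smul_smul, mul_comm]
  rfl

open Polynomial in
-- On F^{i+2} v the factor E² gives a nonzero multiple of Fⁱ v, a joint eigenvector of Z and κ. So p
-- vanishes at enough pairs of eigenvalues to be zero. The factor E² is kept because the equation
-- for equivariant symbols arises with it.
theorem eq_zero_of_evalZK_mul_eq_zero (h : NotRootOfUnity s) (ν : ℤˣ) (p : ℂ[X][X])
    (hp : evalZK s ν p * (fE s * fE s) = 0) : p = 0 := by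
  have hq := qq_ne_zero s
  have h1 (m i : ℕ) (hi : i + 2 ≤ 2 * m) :
      (p.map (evalRingHom (zval s m))).eval ((qq s)⁻¹ ^ (2 * m) * qq s ^ (2 * i)) = 0 := by
    obtain ⟨z, hz, he⟩ := act_fE_wv_succ h m i (2 * m - i - 1) (by omega)
    obtain ⟨z', hz', he'⟩ := act_fE_wv_succ h m (i + 1) (2 * m - i - 2) (by omega)
    have h2 : act (evalZK s ν p * (fE s * fE s)) (wv s m (i + 1 + 1)) = 0 := by
      rw [hp]; exact LinearMap.congr_fun (map_zero (actHom s)) _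
    rw [act_mul_apply, act_mul_apply, he', map_smul, he, map_smul, map_smul,
      act_evalZK_wv h ν p m i (by omega)] at h2
    simpa [hz, hz', wv_ne_zero h m i (by omega)] using h2
  have h2 (m : ℕ) (hm : p.natDegree + 2 ≤ 2 * m) : p.map (evalRingHom (zval s m)) = 0 := by
    -- The indices 0 ≤ i ≤ 2m - 2 give 2m - 1 distinct eigenvalues of κ, more than the degree of p.
    refine eq_zero_of_natDegree_lt_card_of_eval_eq_zero _ (ι := Fin (2 * m - 1))
      (f := fun i => (qq s)⁻¹ ^ (2 * m) * qq s ^ (2 * (i : ℕ))) ?_ (fun i => h1 m i (by omega)) ?_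
    · intro i j hij
      have h3 := h.pow_injective (mul_left_cancel₀ (pow_ne_zero _ (inv_ne_zero hq)) hij)
      exact Fin.ext (by omega)
    · rw [Fintype.card_fin]
      exact lt_of_le_of_lt natDegree_map_le (by omega)
  ext1 j
  rw [coeff_zero]
  -- Each coefficient is a polynomial in Z that vanishes at the eigenvalue of Z for every large m.
  refine eq_zero_of_natDegree_lt_card_of_eval_eq_zero _
    (ι := Fin ((p.coeff j).natDegree + 1)) (f := fun i => zval s (p.natDegree + 2 + i)) ?_ ?_ ?_
  · intro i i' hii
    have := zval_injective h hii
    exact Fin.ext (by omega)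
  · intro i
    have h3 := congrArg (fun g => g.coeff j) (h2 (p.natDegree + 2 + i) (by omega))
    simpa using h3
  · simp

/-! ### The weight zero part of the algebra generated by the quantum tangent space -/

/-- The commutative algebra generated by `eZ` and `eK`. -/
def torusAlg (s : ℂˣ) (ν : ℤˣ) : Subalgebra ℂ (Dual s) := Algebra.adjoin ℂ {eZ s ν, eK s ν}

theorem eZ_mem_torusAlg (s : ℂˣ) (ν : ℤˣ) : eZ s ν ∈ torusAlg s ν :=
  Algebra.subset_adjoin (by simp)

theorem eK_mem_torusAlg (s : ℂˣ) (ν : ℤˣ) : eK s ν ∈ torusAlg s ν :=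
  Algebra.subset_adjoin (by simp)

open Polynomial in
/-- The ring homomorphism underlying `evalZK`. -/
def evalZKHom (s : ℂˣ) (ν : ℤˣ) : ℂ[X][X] →+* Dual s :=
  eval₂RingHom' (aeval (eZ s ν) : ℂ[X] →ₐ[ℂ] Dual s).toRingHom (eK s ν) (by
    intro P
    induction P using Polynomial.induction_on' with
    | add p q hp hq => rw [map_add]; exact hp.add_left hq
    | monomial n z =>
      change Commute (aeval (eZ s ν) (monomial n z)) _
      rw [aeval_monomial]
      exact (Algebra.commute_algebraMap_left _ _).mul_left ((commute_eK_eZ ν).symm.pow_left n))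

open Polynomial in
theorem evalZKHom_apply (ν : ℤˣ) (p : ℂ[X][X]) : evalZKHom s ν p = evalZK s ν p :=
  eval₂_eq_sum

open Polynomial in
theorem exists_evalZK_of_mem_torusAlg {ν : ℤˣ} {x : Dual s} (hx : x ∈ torusAlg s ν) :
    ∃ p : ℂ[X][X], evalZK s ν p = x := by
  suffices ∃ p, evalZKHom s ν p = x by
    obtain ⟨p, hp⟩ := this
    exact ⟨p, by rw [← evalZKHom_apply, hp]⟩
  induction hx using Algebra.adjoin_induction with
  | mem x hx =>
    rcases hx with rfl | rfl
    · exact ⟨C Polynomial.X, by simp [evalZKHom]⟩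
    · exact ⟨Polynomial.X, by simp [evalZKHom]⟩
  | algebraMap z => exact ⟨C (C z), by simp [evalZKHom]⟩
  | add x y _ _ hx hy =>
    obtain ⟨p, rfl⟩ := hx
    obtain ⟨p', rfl⟩ := hy
    exact ⟨p + p', map_add _ _ _⟩
  | mul x y _ _ hx hy =>
    obtain ⟨p, rfl⟩ := hx
    obtain ⟨p', rfl⟩ := hy
    exact ⟨p * p', map_mul _ _ _⟩

/-- Moving g across a polynomial in Z and κ only rescales κ. This applies to g = `eE` and g = `eF`.
-/
theorem exists_shift_of_mem_torusAlg {ν : ℤˣ} {g : Dual s} (hZ : Commute (eZ s ν) g) {z : ℂ}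
    (hK : eK s ν * g = z • (g * eK s ν)) {m : Dual s} (hm : m ∈ torusAlg s ν) (a : ℕ) :
    ∃ m' ∈ torusAlg s ν, m * g ^ a = g ^ a * m' := by
  have h1 {m : Dual s} (hm : m ∈ torusAlg s ν) : ∃ m' ∈ torusAlg s ν, m * g = g * m' := by
    induction hm using Algebra.adjoin_induction with
    | mem x hx =>
      rcases hx with rfl | rfl
      · exact ⟨_, eZ_mem_torusAlg s ν, hZ⟩
      · exact ⟨z • eK s ν, Subalgebra.smul_mem _ (eK_mem_torusAlg s ν) z, by
          rw [hK, mul_smul_comm]⟩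
    | algebraMap z => exact ⟨_, Subalgebra.algebraMap_mem _ z, Algebra.commutes z g⟩
    | add x y _ _ hx hy =>
      obtain ⟨p, hp, e⟩ := hx
      obtain ⟨p', hp', e'⟩ := hy
      exact ⟨p + p', add_mem hp hp', by rw [add_mul, e, e', mul_add]⟩
    | mul x y _ _ hx hy =>
      obtain ⟨p, hp, e⟩ := hx
      obtain ⟨p', hp', e'⟩ := hy
      exact ⟨p * p', mul_mem hp hp', by rw [mul_assoc, e', ← mul_assoc, e, mul_assoc]⟩
  induction a with
  | zero => exact ⟨m, hm, by rw [pow_zero, mul_one, one_mul]⟩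
  | succ a ih =>
    obtain ⟨m', hm', e⟩ := ih
    obtain ⟨m'', hm'', e'⟩ := h1 hm'
    exact ⟨m'', hm'', by rw [pow_succ g a, ← mul_assoc, e, mul_assoc, e', mul_assoc]⟩

/-- The span of the elements `eE ^ a * m` and `eF ^ a * m`, with `m` in `torusAlg`. -/
def weightSpan (s : ℂˣ) (ν : ℤˣ) : Submodule ℂ (Dual s) :=
  Submodule.span ℂ {x | ∃ (a : ℕ), ∃ m ∈ torusAlg s ν, x = eE s ν ^ a * m ∨ x = eF s ν ^ a * m}

theorem eE_mul_mem_weightSpan {ν : ℤˣ} (a : ℕ) {m : Dual s} (hm : m ∈ torusAlg s ν) :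
    eE s ν ^ a * m ∈ weightSpan s ν :=
  Submodule.subset_span ⟨a, m, hm, Or.inl rfl⟩

theorem eF_mul_mem_weightSpan {ν : ℤˣ} (a : ℕ) {m : Dual s} (hm : m ∈ torusAlg s ν) :
    eF s ν ^ a * m ∈ weightSpan s ν :=
  Submodule.subset_span ⟨a, m, hm, Or.inr rfl⟩

theorem mul_mem_weightSpan_of_generators {ν : ℤˣ} {g : Dual s}
    (hg : ∀ a, ∀ m ∈ torusAlg s ν, g * (eE s ν ^ a * m) ∈ weightSpan s ν ∧
      g * (eF s ν ^ a * m) ∈ weightSpan s ν)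
    {x : Dual s} (hx : x ∈ weightSpan s ν) : g * x ∈ weightSpan s ν := by
  have h1 : weightSpan s ν ≤ (weightSpan s ν).comap (LinearMap.mulLeft ℂ g) := by
    rw [weightSpan, Submodule.span_le]
    rintro _ ⟨a, m, hm, rfl | rfl⟩
    · exact (hg a m hm).1
    · exact (hg a m hm).2
  exact h1 hx

theorem torusAlg_mul_mem_weightSpan (h : NotRootOfUnity s) {ν : ℤˣ} {t : Dual s}
    (ht : t ∈ torusAlg s ν) {x : Dual s} (hx : x ∈ weightSpan s ν) : t * x ∈ weightSpan s ν := by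
  refine mul_mem_weightSpan_of_generators (fun a m hm => ⟨?_, ?_⟩) hx
  · obtain ⟨t', ht', e⟩ := exists_shift_of_mem_torusAlg (commute_eE_eZ h ν).symm (eK_mul_eE ν) ht a
    rw [← mul_assoc, e, mul_assoc]
    exact eE_mul_mem_weightSpan a (mul_mem ht' hm)
  · obtain ⟨t', ht', e⟩ := exists_shift_of_mem_torusAlg (commute_eF_eZ h ν).symm (eK_mul_eF ν) ht a
    rw [← mul_assoc, e, mul_assoc]
    exact eF_mul_mem_weightSpan a (mul_mem ht' hm)

/-- This and its counterpart for the opposite order collapse mixed words, so that pure powers of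
`eE` or of `eF` suffice in `weightSpan`. -/
theorem eE_mul_eF_mem (h : NotRootOfUnity s) (ν : ℤˣ) : eE s ν * eF s ν ∈ torusAlg s ν := by
  have hZ := eZ_mem_torusAlg s ν
  have hK := eK_mem_torusAlg s ν
  rw [eE_mul_eF h]
  exact add_mem (add_mem (mul_mem hZ hK) (Subalgebra.smul_mem _ (mul_mem hK hK) _))
    (Subalgebra.smul_mem _ (one_mem _) _)

theorem eF_mul_eE_mem (h : NotRootOfUnity s) (ν : ℤˣ) : eF s ν * eE s ν ∈ torusAlg s ν := by
  have hZ := eZ_mem_torusAlg s ν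
  have hK := eK_mem_torusAlg s ν
  rw [eF_mul_eE h]
  exact add_mem (add_mem (Subalgebra.smul_mem _ (mul_mem hZ hK) _)
    (Subalgebra.smul_mem _ (mul_mem hK hK) _)) (Subalgebra.smul_mem _ (one_mem _) _)

theorem eE_mul_mem (h : NotRootOfUnity s) {ν : ℤˣ} {x : Dual s} (hx : x ∈ weightSpan s ν) :
    eE s ν * x ∈ weightSpan s ν := by
  refine mul_mem_weightSpan_of_generators (fun a m hm => ⟨?_, ?_⟩) hx
  · rw [← mul_assoc, ← pow_succ']
    exact eE_mul_mem_weightSpan _ hm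
  · cases a with
    | zero => simpa using eE_mul_mem_weightSpan 1 hm
    | succ a =>
      rw [pow_succ' (eF s ν) a, ← mul_assoc, ← mul_assoc, mul_assoc]
      exact torusAlg_mul_mem_weightSpan h (eE_mul_eF_mem h ν) (eF_mul_mem_weightSpan a hm)

theorem eF_mul_mem (h : NotRootOfUnity s) {ν : ℤˣ} {x : Dual s} (hx : x ∈ weightSpan s ν) :
    eF s ν * x ∈ weightSpan s ν := by
  refine mul_mem_weightSpan_of_generators (fun a m hm => ⟨?_, ?_⟩) hx
  · cases a with
    | zero => simpa using eF_mul_mem_weightSpan 1 hm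
    | succ a =>
      rw [pow_succ' (eE s ν) a, ← mul_assoc, ← mul_assoc, mul_assoc]
      exact torusAlg_mul_mem_weightSpan h (eF_mul_eE_mem h ν) (eE_mul_mem_weightSpan a hm)
  · rw [← mul_assoc, ← pow_succ']
    exact eF_mul_mem_weightSpan _ hm

theorem X_eq (ν : ℤˣ) (i j : Fin 2) :
    X s ν (i, j) = Xshift s ν i j + (-((s : ℂ) * Ccheck s i j / qhat s)) • 1 := by
  rw [Xshift]; module

theorem X_mul_mem (h : NotRootOfUnity s) {ν : ℤˣ} (p : Idx) {x : Dual s}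
    (hx : x ∈ weightSpan s ν) : X s ν p * x ∈ weightSpan s ν := by
  obtain ⟨i, j⟩ := p
  have hZ := torusAlg_mul_mem_weightSpan h (eZ_mem_torusAlg s ν) hx
  have hK := torusAlg_mul_mem_weightSpan h (eK_mem_torusAlg s ν) hx
  have hE := eE_mul_mem h hx
  have hF := eF_mul_mem h hx
  rw [X_eq, add_mul, smul_mul_assoc, one_mul, xshift_eq h]
  refine add_mem ?_ (Submodule.smul_mem _ _ hx)
  fin_cases i <;> fin_cases j
  · simpa [smul_mul_assoc, -neg_smul] using Submodule.smul_mem _ (-(s : ℂ)) hE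
  · simpa [smul_mul_assoc] using Submodule.smul_mem _ (qhat s)⁻¹ hK
  · simpa [smul_mul_assoc, add_mul, -neg_smul] using add_mem
      (Submodule.smul_mem _ (-(qhat s)) hZ) (Submodule.smul_mem _ ((qq s)⁻¹ / qhat s) hK)
  · simpa [smul_mul_assoc] using Submodule.smul_mem _ (s : ℂ)⁻¹ hF

/-- The span contains 1 and is stable under left multiplication by the generators X_{ij}. -/
theorem Xalg_le_weightSpan (h : NotRootOfUnity s) {ν : ℤˣ} {x : Dual s} (hx : x ∈ Xalg s ν) :
    x ∈ weightSpan s ν := by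
  suffices ∀ y ∈ weightSpan s ν, x * y ∈ weightSpan s ν by
    have h1 := this _ (eE_mul_mem_weightSpan 0 (one_mem _))
    simpa using h1
  induction hx using Algebra.adjoin_induction with
  | mem x hx =>
    obtain ⟨p, rfl⟩ := hx
    exact fun y hy => X_mul_mem h p hy
  | algebraMap z =>
    intro y hy
    rw [← Algebra.smul_def]
    exact Submodule.smul_mem _ _ hy
  | add x x' _ _ hx hx' =>
    intro y hy
    rw [add_mul]
    exact add_mem (hx y hy) (hx' y hy)
  | mul x x' _ _ hx hx' =>
    intro y hy
    rw [mul_assoc]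
    exact hx _ (hx' y hy)

/-- Conjugation by `K`. -/
def adK (s : ℂˣ) : Module.End ℂ (Dual s) :=
  LinearMap.mulLeft ℂ (fK s) ∘ₗ LinearMap.mulRight ℂ (fKinv s)

theorem adK_eq_smul_iff (x : Dual s) (z : ℂ) : adK s x = z • x ↔ fK s * x = z • (x * fK s) := by
  change fK s * (x * fKinv s) = z • x ↔ _
  constructor
  · intro h1
    have h2 := congrArg (· * fK s) h1
    simpa only [mul_assoc, fKinv_mul_fK, mul_one, smul_mul_assoc] using h2
  · intro h1
    rw [← mul_assoc, h1, smul_mul_assoc, mul_assoc, fK_mul_fKinv, mul_one]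

theorem fK_mul_of_mem_torusAlg {ν : ℤˣ} {m : Dual s} (hm : m ∈ torusAlg s ν) :
    fK s * m = m * fK s := by
  induction hm using Algebra.adjoin_induction with
  | mem x hx =>
    rcases hx with rfl | rfl
    · exact commute_fK_eZ ν
    · exact commute_fK_eK ν
  | algebraMap z => exact (Algebra.commutes z _).symm
  | add x y _ _ hx hy => rw [mul_add, hx, hy, add_mul]
  | mul x y _ _ hx hy => rw [← mul_assoc, hx, mul_assoc, hy, mul_assoc]

theorem fK_mul_pow_mul {ν : ℤˣ} {g : Dual s} {z : ℂ} (hg : fK s * g = z • (g * fK s))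
    {m : Dual s} (hm : m ∈ torusAlg s ν) (a : ℕ) :
    fK s * (g ^ a * m) = z ^ a • (g ^ a * m * fK s) := by
  induction a with
  | zero => simp [fK_mul_of_mem_torusAlg hm]
  | succ a ih =>
    rw [pow_succ' g a, mul_assoc g, ← mul_assoc, hg, smul_mul_assoc, mul_assoc, ih, mul_smul_comm,
      smul_smul, ← pow_succ', mul_assoc g]

theorem fK_mul_eE (ν : ℤˣ) : fK s * eE s ν = qq s • (eE s ν * fK s) := by
  simp only [eE, mul_fEps_assoc, mul_assoc, fKinv_mul_fE_assoc, fKinv_mul_fK, fK_mul_fKinv_assoc,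
    mul_one, mul_smul_comm, smul_smul, mul_inv_cancel₀ (qq_ne_zero s), one_smul]

theorem fK_mul_eF (ν : ℤˣ) : fK s * eF s ν = (qq s)⁻¹ • (eF s ν * fK s) := by
  simp only [eF, mul_fEps_assoc, mul_assoc, fK_mul_fF_assoc, fK_mul_fKinv, fKinv_mul_fK,
    mul_smul_comm]

/-- Conjugation by K scales the a-th powers of `eE` and `eF` by q^a and q^{-a}, which differ from 1
for a > 0. Independence of eigenspaces then leaves only the part with a = 0. -/
theorem mem_torusAlg_of_commute (h : NotRootOfUnity s) {ν : ℤˣ} {x : Dual s}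
    (hx : x ∈ Xalg s ν) (hc : fK s * x = x * fK s) : x ∈ torusAlg s ν := by
  have key : weightSpan s ν ≤ Subalgebra.toSubmodule (torusAlg s ν) ⊔
      ⨆ μ : ℂ, ⨆ _ : μ ≠ 1, (adK s).eigenspace μ := by
    rw [weightSpan, Submodule.span_le]
    rintro _ ⟨a, m, hm, hx⟩
    rcases Nat.eq_zero_or_pos a with rfl | ha
    · refine Submodule.mem_sup_left ?_
      rcases hx with rfl | rfl <;> simpa using hm
    · refine Submodule.mem_sup_right ?_
      rcases hx with rfl | rfl
      · refine Submodule.mem_iSup_of_mem (qq s ^ a) (Submodule.mem_iSup_of_mem (h a ha) ?_)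
        rw [Module.End.mem_eigenspace_iff, adK_eq_smul_iff]
        exact fK_mul_pow_mul (fK_mul_eE ν) hm a
      · refine Submodule.mem_iSup_of_mem ((qq s)⁻¹ ^ a) (Submodule.mem_iSup_of_mem ?_ ?_)
        · rw [inv_pow, ne_eq, inv_eq_one]
          exact h a ha
        · rw [Module.End.mem_eigenspace_iff, adK_eq_smul_iff]
          exact fK_mul_pow_mul (fK_mul_eF ν) hm a
  obtain ⟨y, hy, t, ht, rfl⟩ := Submodule.mem_sup.mp (key (Xalg_le_weightSpan h hx))
  have ht1 : t ∈ (adK s).eigenspace 1 := by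
    rw [Module.End.mem_eigenspace_iff, adK_eq_smul_iff, one_smul]
    have hy1 := fK_mul_of_mem_torusAlg hy
    rw [mul_add, add_mul, hy1] at hc
    exact add_left_cancel hc
  have ht0 := (Submodule.disjoint_def.mp ((Module.End.eigenspaces_iSupIndep (adK s)) 1)) t ht1 ht
  rw [ht0, add_zero]
  exact hy

/-! ### Equivariant symbols -/

theorem IsEquivariant.add {p p' : Matrix (Fin 2) (Fin 2) (Dual s)} (hp : IsEquivariant p)
    (hp' : IsEquivariant p') : IsEquivariant (p + p') := by
  intro k i a
  simp only [Matrix.add_apply, act_add, lact_add, LinearMap.add_apply, add_mul,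
    Finset.sum_add_distrib,
    hp k i a, hp' k i a]

theorem IsEquivariant.smul {p : Matrix (Fin 2) (Fin 2) (Dual s)} (hp : IsEquivariant p) (z : ℂ) :
    IsEquivariant (z • p) := by
  intro k i a
  simp only [Matrix.smul_apply, act_smul, lact_smul, LinearMap.smul_apply, smul_mul_assoc,
    ← Finset.smul_sum, hp k i a]

theorem IsEquivariant.mul {p p' : Matrix (Fin 2) (Fin 2) (Dual s)} (hp : IsEquivariant p)
    (hp' : IsEquivariant p') : IsEquivariant (p * p') := by
  intro k i a
  simp only [Matrix.mul_apply, act_sum, lact_sum, act_mul, lact_mul, LinearMap.sum_apply,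
    LinearMap.comp_apply, Finset.sum_mul]
  rw [Finset.sum_comm]
  simp only [hp k]
  rw [Finset.sum_comm]
  simp only [← act_lact_comm]
  rw [Finset.sum_comm (f := fun x y => lact (p' y x) (lact (p k y) a) * OSL.u (s ^ 2) x i)]
  exact Finset.sum_congr rfl fun j _ => hp' j i _

theorem isEquivariant_one : IsEquivariant (1 : Matrix (Fin 2) (Fin 2) (Dual s)) := by
  intro k i a
  have h0 : act (0 : Dual s) = 0 := map_zero (actHom s)
  have h0' : lact (0 : Dual s) = 0 := map_zero (lactLin s)
  have h1 : lact (1 : Dual s) a = a := by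
    have h2 := act_fEps_eq_lact (s := s) 1
    rw [fEps_one_eq] at h2
    rw [← h2, act_one, LinearMap.id_apply]
  rw [Finset.sum_eq_single i, Finset.sum_eq_single k, Matrix.one_apply_eq, Matrix.one_apply_eq,
    act_one, h1, LinearMap.id_apply]
  · intro j _ hj
    rw [Matrix.one_apply_ne hj.symm, h0', LinearMap.zero_apply, zero_mul]
  · simp
  · intro j _ hj
    rw [Matrix.one_apply_ne hj, h0, LinearMap.zero_apply, zero_mul]
  · simp

/-- The inverse of an operator commuting with the coaction commutes with it too, so the argument
passes through the operators. -/
theorem IsEquivariant.of_mul_eq_one (h : NotRootOfUnity s)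
    {p p' : Matrix (Fin 2) (Fin 2) (Dual s)} (hp : IsEquivariant p) (h1 : p * p' = 1)
    (h2 : p' * p = 1) : IsEquivariant p' := by
  -- Equivariance involves neither the sign nor the scale of the metric, so both are set to 1 to
  -- have an operator realization.
  have hc : (1 : ℂ) ≠ 0 := one_ne_zero
  rw [← opHom_comm_iff h 1 hc] at hp ⊢
  have e1 := congrArg (opHom h 1 hc) h1
  have e2 := congrArg (opHom h 1 hc) h2
  rw [map_mul, map_one] at e1 e2
  intro ψ
  have h3 := hp (opHom h 1 hc p' ψ)
  have h4 : opHom h 1 hc p (opHom h 1 hc p' ψ) = ψ := LinearMap.congr_fun e1 ψ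
  rw [h4] at h3
  have h5 := LinearMap.rTensor_comp_apply (Atilde (s ^ 2)) (opHom h 1 hc p') (opHom h 1 hc p)
    (spinCoaction h 1 hc (opHom h 1 hc p' ψ))
  rw [h3, ← h5, ← Module.End.mul_eq_comp, e2]
  exact (LinearMap.congr_fun (LinearMap.rTensor_id _ _) _).symm

theorem commute_scalar_symW (h : NotRootOfUnity s) (ν : ℤˣ) {t : Dual s}
    (ht : t ∈ Algebra.adjoin ℂ {eZ s ν}) :
    Commute (Matrix.scalar (Fin 2) t) (symW s ν) := by
  have hz {g : Dual s} (hg : Commute (eZ s ν) g) : t * g = g * t := by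
    induction ht using Algebra.adjoin_induction with
    | mem x hx => rcases hx with rfl; exact hg
    | algebraMap z => exact Algebra.commutes z g
    | add x y _ _ hx hy => rw [add_mul, hx, hy, mul_add]
    | mul x y _ _ hx hy => rw [mul_assoc, hy, ← mul_assoc, hx, mul_assoc]
  have hE := hz (commute_eE_eZ h ν).symm
  have hF := hz (commute_eF_eZ h ν).symm
  have hK := hz (commute_eK_eZ ν).symm
  have hZ := hz (Commute.refl _)
  rw [commute_iff_eq]
  ext1 i j
  fin_cases i <;> fin_cases j <;>
    simp [symW, Matrix.mul_apply, hE, hF, hK, hZ, mul_smul_comm, smul_mul_assoc, mul_add,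
      add_mul, -neg_smul]

/-- By the quadratic identity W is invertible and its inverse is a combination of Z and W. Solving
for Z expresses it through the equivariant matrices W⁻¹ and W. -/
theorem isEquivariant_scalar_eZ (h : NotRootOfUnity s) (ν : ℤˣ) :
    IsEquivariant (Matrix.scalar (Fin 2) (eZ s ν)) := by
  have hs := s.ne_zero
  have hh := h.qhat_ne_zero
  have hq := qq_ne_zero s
  have hW := isEquivariant_symW h ν
  have hcomm := commute_scalar_symW h ν (Algebra.subset_adjoin rfl)
  have hsq := symW_mul_self h ν
  set Z := Matrix.scalar (Fin 2) (eZ s ν)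
  set W := symW s ν
  set V := (qhat s ^ 3 * qq s * (s : ℂ)⁻¹) • Z + (-(qq s * qhat s ^ 2)) • W with hV
  have h1 : V * W = 1 := by
    rw [hV, add_mul, smul_mul_assoc, smul_mul_assoc, hsq]
    match_scalars <;> field_simp
    ring
  have h2 : W * V = 1 := by
    rw [hV, mul_add, mul_smul_comm, mul_smul_comm, ← hcomm.eq, hsq]
    match_scalars <;> field_simp
    ring
  have hVe := hW.of_mul_eq_one h h2 h1
  have h3 : Z = ((s : ℂ) / (qhat s ^ 3 * qq s)) • V + ((s : ℂ) / qhat s) • W := by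
    rw [hV]
    match_scalars <;> field_simp
    ring
  rw [h3]
  exact (hVe.smul _).add (hW.smul _)

open Polynomial in
/-- The matrix `P₀(Z) + P₁(Z) W`, where `Z` is the scalar matrix of the Casimir functional and
`W` is the symbol of `∂₀ + ∂₁`. -/
def symNF (s : ℂˣ) (ν : ℤˣ) (P₀ P₁ : ℂ[X]) : Matrix (Fin 2) (Fin 2) (Dual s) :=
  Matrix.scalar (Fin 2) (aeval (eZ s ν) P₀) + Matrix.scalar (Fin 2) (aeval (eZ s ν) P₁) * symW s ν

open Polynomial in
theorem isEquivariant_scalar_aeval (h : NotRootOfUnity s) (ν : ℤˣ) (P : ℂ[X]) :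
    IsEquivariant (Matrix.scalar (Fin 2) (aeval (eZ s ν) P)) := by
  induction P using Polynomial.induction_on with
  | C z =>
    have h1 : Matrix.scalar (Fin 2) (aeval (eZ s ν) (C z)) = z • 1 := by
      rw [aeval_C, Algebra.algebraMap_eq_smul_one]
      ext1 i j
      fin_cases i <;> fin_cases j <;> simp
    rw [h1]
    exact isEquivariant_one.smul z
  | add P Q hP hQ => rw [map_add, map_add]; exact hP.add hQ
  | monomial n z hP =>
    rw [pow_succ _ n, ← mul_assoc, map_mul, map_mul, aeval_X]
    exact hP.mul (isEquivariant_scalar_eZ h ν)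

open Polynomial in
theorem isEquivariant_symNF (h : NotRootOfUnity s) (ν : ℤˣ) (P₀ P₁ : ℂ[X]) :
    IsEquivariant (symNF s ν P₀ P₁) :=
  (isEquivariant_scalar_aeval h ν P₀).add
    ((isEquivariant_scalar_aeval h ν P₁).mul (isEquivariant_symW h ν))

/-! ### Consequences of equivariance for the entries -/

/-- K is multiplicative and diagonal on generators, so applying it to the equivariance identity
keeps one term of each sum. Applying E and F in the same way gives the next two lemmas. -/
theorem IsEquivariant.apply_fK {p : Matrix (Fin 2) (Fin 2) (Dual s)} (hp : IsEquivariant p) :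
    fK s * p 0 0 = p 0 0 * fK s := by
  have hs := s.ne_zero
  ext a
  have h1 := congrArg (fK s).ofConv (hp 0 0 a)
  simp only [Fin.sum_univ_two, map_add, fK_mul, apply_act, apply_lact, fK_u] at h1
  simpa [hs] using h1

theorem IsEquivariant.apply_fE {p : Matrix (Fin 2) (Fin 2) (Dual s)} (hp : IsEquivariant p) :
    fE s * p 0 0 = p 0 0 * fE s + (s : ℂ) • (p 0 1 * fKinv s) ∧
    fE s * p 0 1 = qq s • (p 0 1 * fE s) ∧
    p 1 1 * fKinv s = fKinv s * p 0 0 + (s : ℂ) • (fE s * p 1 0)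
      + (-(s : ℂ)⁻¹) • (p 1 0 * fE s) := by
  have hs := s.ne_zero
  refine ⟨?_, ?_, ?_⟩ <;> ext a
  · have h1 := congrArg (fE s).ofConv (hp 0 0 a)
    simp only [Fin.sum_univ_two, map_add, fE_mul, apply_act, apply_lact, fK_u, fE_u] at h1
    simp at h1 ⊢
    field_simp at h1
    linear_combination h1
  · have h1 := congrArg (fE s).ofConv (hp 0 1 a)
    simp only [Fin.sum_univ_two, map_add, fE_mul, apply_act, apply_lact, fK_u, fE_u] at h1
    simp [qq] at h1 ⊢
    field_simp at h1
    linear_combination h1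
  · have h1 := congrArg (fE s).ofConv (hp 1 0 a)
    simp only [Fin.sum_univ_two, map_add, fE_mul, apply_act, apply_lact, fK_u, fE_u] at h1
    simp at h1 ⊢
    linear_combination -h1

theorem IsEquivariant.apply_fF {p : Matrix (Fin 2) (Fin 2) (Dual s)} (hp : IsEquivariant p) :
    p 0 0 * fF s = fF s * p 0 0 + (s : ℂ) • (fKinv s * p 1 0) := by
  have hs := s.ne_zero
  ext a
  have h1 := congrArg (fF s).ofConv (hp 0 0 a)
  simp only [Fin.sum_univ_two, map_add, fF_mul, apply_act, apply_lact, fK_u, fF_u] at h1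
  simp at h1 ⊢
  field_simp at h1
  linear_combination -h1

/-- The relations with E and F express the off-diagonal entries, and then the last one, through the
first entry; K⁻¹ cancels because it is invertible. -/
theorem IsEquivariant.eq_zero {p : Matrix (Fin 2) (Fin 2) (Dual s)} (hp : IsEquivariant p)
    (h0 : p 0 0 = 0) : p = 0 := by
  have hs := s.ne_zero
  obtain ⟨h1, -, h3⟩ := hp.apply_fE
  have h4 := hp.apply_fF
  have hr {x : Dual s} (hx : x * fKinv s = 0) : x = 0 := by
    rw [← mul_one x, ← fKinv_mul_fK, ← mul_assoc, hx, zero_mul]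
  have hl {x : Dual s} (hx : fKinv s * x = 0) : x = 0 := by
    rw [← one_mul x, ← fK_mul_fKinv, mul_assoc, hx, mul_zero]
  rw [h0, mul_zero, zero_mul, zero_add, eq_comm, smul_eq_zero_iff_right hs] at h1
  rw [h0, mul_zero, zero_mul, zero_add, eq_comm, smul_eq_zero_iff_right hs] at h4
  have h10 := hl h4
  rw [h0, h10, mul_zero, mul_zero, zero_mul, smul_zero, smul_zero, zero_add, zero_add] at h3
  ext1 i j
  fin_cases i <;> fin_cases j
  · exact h0
  · exact hr h1
  · exact h10
  · exact hr h3

theorem IsEquivariant.ext {p p' : Matrix (Fin 2) (Fin 2) (Dual s)} (hp : IsEquivariant p)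
    (hp' : IsEquivariant p') (h0 : p 0 0 = p' 0 0) : p = p' := by
  have h1 : p + (-1 : ℂ) • p' = 0 := by
    refine (hp.add (hp'.smul (-1))).eq_zero ?_
    rw [Matrix.add_apply, Matrix.smul_apply, h0]
    module
  have h2 : p = (p + (-1 : ℂ) • p') + p' := by module
  rw [h2, h1, zero_add]

/-! ### Normal form of equivariant symbols -/

open Polynomial in
theorem evalZKHom_C (ν : ℤˣ) (P : ℂ[X]) : evalZKHom s ν (C P) = aeval (eZ s ν) P := by
  simp [evalZKHom]

open Polynomial in
theorem evalZKHom_X (ν : ℤˣ) : evalZKHom s ν Polynomial.X = eK s ν := by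
  simp [evalZKHom]

open Polynomial in
theorem evalZKHom_C_C_mul (ν : ℤˣ) (z : ℂ) (p : ℂ[X][X]) :
    evalZKHom s ν (C (C z) * p) = z • evalZKHom s ν p := by
  rw [map_mul, evalZKHom_C, aeval_C, ← Algebra.smul_def]

open Polynomial in
theorem fE_mul_evalZKHom (h : NotRootOfUnity s) (ν : ℤˣ) (p : ℂ[X][X]) :
    fE s * evalZKHom s ν p =
      evalZKHom s ν (p.comp (C (C (qq s ^ 2)) * Polynomial.X)) * fE s := by
  have hmul {p p' : ℂ[X][X]}
      (hp : fE s * evalZKHom s ν p =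
        evalZKHom s ν (p.comp (C (C (qq s ^ 2)) * Polynomial.X)) * fE s)
      (hp' : fE s * evalZKHom s ν p' =
        evalZKHom s ν (p'.comp (C (C (qq s ^ 2)) * Polynomial.X)) * fE s) :
      fE s * evalZKHom s ν (p * p') =
        evalZKHom s ν ((p * p').comp (C (C (qq s ^ 2)) * Polynomial.X)) * fE s := by
    rw [map_mul, ← mul_assoc, hp, mul_assoc, hp', mul_comp, map_mul, mul_assoc]
  have hX : fE s * evalZKHom s ν Polynomial.X =
      evalZKHom s ν ((Polynomial.X : ℂ[X][X]).comp (C (C (qq s ^ 2)) * Polynomial.X)) * fE s := by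
    rw [X_comp, evalZKHom_C_C_mul, evalZKHom_X, fE_mul_eK, smul_mul_assoc]
  induction p using Polynomial.induction_on with
  | C P =>
    rw [C_comp, evalZKHom_C]
    induction P using Polynomial.induction_on' with
    | add P Q hP hQ =>
      rw [map_add, mul_add, add_mul]
      exact congrArg₂ _ hP hQ
    | monomial n z =>
      rw [aeval_monomial]
      exact ((Algebra.commute_algebraMap_right _ _).mul_right
        ((commute_fE_eZ h ν).pow_right n)).eq
  | add p p' hp hp' => rw [map_add, mul_add, hp, hp', add_comp, map_add, add_mul]
  | monomial n P hP => rw [pow_succ _ n, ← mul_assoc]; exact hmul hP hX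

open Polynomial in
-- The first entry is P(Z, κ). Moving E across it replaces κ by q²κ, so the first relation with E
-- gives q^{1/2} p₁₂ = (P(q²κ) - P(κ)) E K. The second relation, E p₁₂ = q p₁₂ E, then becomes
-- P(q⁴κ) - P(q²κ) = q² (P(q²κ) - P(κ)) after cancelling E².
theorem exists_symNF_of_isEquivariant (h : NotRootOfUnity s) {ν : ℤˣ}
    {p : Matrix (Fin 2) (Fin 2) (Dual s)} (hX : p 0 0 ∈ Xalg s ν) (hp : IsEquivariant p) :
    ∃ P₀ P₁ : ℂ[X], p = symNF s ν P₀ P₁ := by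
  have hs := s.ne_zero
  have hq := qq_ne_zero s
  have hh := h.qhat_ne_zero
  obtain ⟨P, hP⟩ := exists_evalZK_of_mem_torusAlg (mem_torusAlg_of_commute h hX hp.apply_fK)
  rw [← evalZKHom_apply] at hP
  obtain ⟨h1, h2, -⟩ := hp.apply_fE
  set τ : ℂ[X][X] := C (C (qq s ^ 2)) * Polynomial.X with hτ
  have e1 := fE_mul_evalZKHom h ν P
  have e2 := fE_mul_evalZKHom h ν (P.comp τ)
  rw [← hτ] at e1 e2
  have h01 : (s : ℂ) • p 0 1 = (evalZKHom s ν (P.comp τ - P) * fE s) * fK s := by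
    rw [map_sub, sub_mul, ← e1, hP, h1, add_sub_cancel_left, smul_mul_assoc, mul_assoc,
      fKinv_mul_fK, mul_one]
  have e3 := fE_mul_evalZKHom h ν (P.comp τ - P)
  rw [← hτ, sub_comp] at e3
  have h3 : evalZKHom s ν ((P.comp τ).comp τ - P.comp τ) * (fE s * fE s) =
      evalZKHom s ν (C (C (qq s ^ 2)) * (P.comp τ - P)) * (fE s * fE s) := by
    have h4 : fE s * ((s : ℂ) • p 0 1) = qq s • (((s : ℂ) • p 0 1) * fE s) := by
      rw [mul_smul_comm, h2, smul_mul_assoc, smul_comm]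
    rw [h01, ← mul_assoc, ← mul_assoc, e3, mul_assoc _ (fK s), fK_mul_fE, mul_smul_comm,
      smul_smul] at h4
    have h5 := congrArg (· * fKinv s) h4
    simp only [smul_mul_assoc, mul_assoc, fK_mul_fKinv, mul_one] at h5
    rw [h5, evalZKHom_C_C_mul, smul_mul_assoc, pow_two (qq s)]
  have h6 := eq_zero_of_evalZK_mul_eq_zero h ν
    (((P.comp τ).comp τ - P.comp τ) - C (C (qq s ^ 2)) * (P.comp τ - P))
    (by rw [← evalZKHom_apply, map_sub (evalZKHom s ν) _ (C (C _) * _), sub_mul, h3, sub_self])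
  -- On κ^j the difference equation is multiplication by (q^{2j} - 1)(q^{2j} - q²), which vanishes
  -- only for j = 0 and j = 1.
  have h7 (j : ℕ) (hj : 2 ≤ j) : P.coeff j = 0 := by
    have h8 := congrArg (fun f => f.coeff j) h6
    simp only [hτ, coeff_sub, comp_C_mul_X_coeff, coeff_C_mul, coeff_zero] at h8
    have h9 : P.coeff j * C ((qq s ^ (2 * j) - 1) * (qq s ^ (2 * j) - qq s ^ 2)) = 0 := by
      rw [← h8]
      simp only [map_mul, map_sub, map_pow, map_one]
      ring
    rcases mul_eq_zero.mp h9 with h9 | h9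
    · exact h9
    rw [C_eq_zero] at h9
    rcases mul_eq_zero.mp h9 with h9 | h9
    · exact absurd (sub_eq_zero.mp h9) (h _ (by omega))
    · have := h.pow_injective (sub_eq_zero.mp h9)
      omega
  have hP2 : P = C (P.coeff 0) + C (P.coeff 1) * Polynomial.X := by
    ext1 j
    match j with
    | 0 => simp
    | 1 => simp
    | j + 2 =>
      rw [h7 _ (by omega)]
      simp
  -- The factor compensates the first entry (q^{1/2}/q̂) κ of W; agreement of the first entries is
  -- enough.
  refine ⟨P.coeff 0, C (qhat s / (s : ℂ)) * P.coeff 1, hp.ext (isEquivariant_symNF h ν _ _) ?_⟩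
  rw [← hP, hP2]
  simp [symNF, evalZKHom, symW, Matrix.mul_apply, mul_smul_comm, Algebra.algebraMap_eq_smul_one,
    smul_mul_assoc, smul_smul, hs, hh]

open Polynomial in
-- The off-diagonal entry is P₁(Z) times `eE`, and E is `eE` times another functional, so P₁(Z) E² =
-- 0 and P₁ = 0. The diagonal entry then gives P₀ = 0.
theorem symNF_eq_zero (h : NotRootOfUnity s) {ν : ℤˣ} {P₀ P₁ : ℂ[X]}
    (hp : symNF s ν P₀ P₁ = 0) : P₀ = 0 ∧ P₁ = 0 := by
  have key {P : ℂ[X]} (hP : aeval (eZ s ν) P * (fE s * fE s) = 0) : P = 0 := by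
    have h1 := eq_zero_of_evalZK_mul_eq_zero h ν (C P)
      (by rw [← evalZKHom_apply, ← hP]; simp [evalZKHom])
    exact C_eq_zero.mp h1
  have h01 := congrFun (congrFun hp 0) 1
  have h1 : aeval (eZ s ν) P₁ * eE s ν = 0 := by
    simpa [symNF, symW, Matrix.mul_apply] using h01
  have h2 : fE s = qq s • (eE s ν * (fEps s ν * fK s)) := by
    simp only [eE, mul_fEps_assoc, mul_assoc, fKinv_mul_fE_assoc, fKinv_mul_fK,
      fEps_mul_fEps_assoc, mul_one, mul_smul_comm, smul_smul, mul_inv_cancel₀ (qq_ne_zero s),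
      one_smul]
  have hP₁ : P₁ = 0 := by
    refine key ?_
    rw [← mul_assoc]
    nth_rewrite 1 [h2]
    rw [mul_smul_comm, ← mul_assoc, h1, zero_mul, smul_zero, zero_mul]
  refine ⟨key ?_, hP₁⟩
  have h00 := congrFun (congrFun hp 0) 0
  have h3 : aeval (eZ s ν) P₀ = 0 := by simpa [symNF, hP₁] using h00
  rw [h3, zero_mul]

/-! ### The algebra of invariant differential operators -/

theorem xshift_mem_Xalg (ν : ℤˣ) (i j : Fin 2) : Xshift s ν i j ∈ Xalg s ν :=
  add_mem (Algebra.subset_adjoin ⟨_, rfl⟩) (Subalgebra.smul_mem _ (one_mem _) _)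

theorem generators_mem_Xalg (h : NotRootOfUnity s) (ν : ℤˣ) :
    eE s ν ∈ Xalg s ν ∧ eK s ν ∈ Xalg s ν ∧ eF s ν ∈ Xalg s ν ∧ eZ s ν ∈ Xalg s ν := by
  have hs := s.ne_zero
  have hh := h.qhat_ne_zero
  have hx := xshift_mem_Xalg (s := s) ν
  simp only [xshift_eq h] at hx
  have hK : eK s ν ∈ Xalg s ν := by
    simpa [smul_smul, hh] using Subalgebra.smul_mem _ (hx 0 1) (qhat s)
  refine ⟨?_, hK, ?_, ?_⟩
  · simpa [smul_smul, hs, -neg_smul] using Subalgebra.smul_mem _ (hx 0 0) (-(s : ℂ)⁻¹)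
  · simpa [smul_smul, hs] using Subalgebra.smul_mem _ (hx 1 1) (s : ℂ)
  · have h1 : eZ s ν = (-(qhat s)⁻¹) • ((-(qhat s)) • eZ s ν + ((qq s)⁻¹ / qhat s) • eK s ν)
        + ((qq s)⁻¹ / qhat s ^ 2) • eK s ν := by
      match_scalars <;> field_simp
      ring
    rw [h1]
    exact add_mem (Subalgebra.smul_mem _ (hx 1 0) _) (Subalgebra.smul_mem _ hK _)

/-- The algebra of symbols of invariant differential operators. -/
def symAlg (s : ℂˣ) (ν : ℤˣ) : Subalgebra ℂ (Matrix (Fin 2) (Fin 2) (Dual s)) where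
  carrier := {p | (∀ i j, p i j ∈ Xalg s ν) ∧ IsEquivariant p}
  mul_mem' hp hp' := ⟨fun i j => by
    rw [Matrix.mul_apply]
    exact sum_mem fun k _ => mul_mem (hp.1 i k) (hp'.1 k j), hp.2.mul hp'.2⟩
  add_mem' hp hp' := ⟨fun i j => add_mem (hp.1 i j) (hp'.1 i j), hp.2.add hp'.2⟩
  algebraMap_mem' z := by
    rw [Algebra.algebraMap_eq_smul_one]
    refine ⟨fun i j => ?_, isEquivariant_one.smul z⟩
    rw [Matrix.smul_apply, Matrix.one_apply]
    split_ifs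
    · exact Subalgebra.smul_mem _ (one_mem _) _
    · exact Subalgebra.smul_mem _ (zero_mem _) _

theorem symW_mem (h : NotRootOfUnity s) (ν : ℤˣ) : symW s ν ∈ symAlg s ν := by
  obtain ⟨hE, hK, hF, hZ⟩ := generators_mem_Xalg h ν
  refine ⟨fun i j => ?_, isEquivariant_symW h ν⟩
  fin_cases i <;> fin_cases j
  · exact Subalgebra.smul_mem _ hK _
  · exact hE
  · exact hF
  · exact add_mem (Subalgebra.smul_mem _ hZ _) (Subalgebra.smul_mem _ hK _)

theorem scalar_eZ_mem (h : NotRootOfUnity s) (ν : ℤˣ) :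
    Matrix.scalar (Fin 2) (eZ s ν) ∈ symAlg s ν := by
  obtain ⟨-, -, -, hZ⟩ := generators_mem_Xalg h ν
  refine ⟨fun i j => ?_, isEquivariant_scalar_eZ h ν⟩
  fin_cases i <;> fin_cases j
  · simpa using hZ
  · simp
  · simp
  · simpa using hZ

/-- The symbol of `∂₀`, as an element of `symAlg`. -/
def symX (h : NotRootOfUnity s) (ν : ℤˣ) : symAlg s ν :=
  ((s : ℂ) * qhat s / two s) • ⟨_, scalar_eZ_mem h ν⟩

/-- The symbol of `∂₁`, as an element of `symAlg`. -/
def symY (h : NotRootOfUnity s) (ν : ℤˣ) : symAlg s ν := ⟨_, symW_mem h ν⟩ - symX h ν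

theorem coe_symX (h : NotRootOfUnity s) (ν : ℤˣ) :
    (symX h ν : Matrix (Fin 2) (Fin 2) (Dual s)) = symbolOf s (D0 s ν) :=
  (symbolOf_D0 h ν).symm

theorem symX_add_symY (h : NotRootOfUnity s) (ν : ℤˣ) :
    symX h ν + symY h ν = ⟨_, symW_mem h ν⟩ :=
  add_sub_cancel (symX h ν) _

theorem coe_symY (h : NotRootOfUnity s) (ν : ℤˣ) :
    (symY h ν : Matrix (Fin 2) (Fin 2) (Dual s)) = symbolOf s (D1 s ν) := by
  have h1 : (symX h ν : Matrix (Fin 2) (Fin 2) (Dual s)) + symY h ν = symW s ν :=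
    congrArg Subtype.val (symX_add_symY h ν)
  rw [← symbolOf_D0_add_D1 h ν, coe_symX] at h1
  exact add_left_cancel h1

/-! ### Commutativity and presentation of the algebra of symbols -/

open Polynomial in
theorem coe_aeval_scalar (h : NotRootOfUnity s) (ν : ℤˣ) (P : ℂ[X]) :
    ((aeval (⟨_, scalar_eZ_mem h ν⟩ : symAlg s ν) P : symAlg s ν) :
      Matrix (Fin 2) (Fin 2) (Dual s)) = Matrix.scalar (Fin 2) (aeval (eZ s ν) P) := by
  have h1 := aeval_algHom_apply (symAlg s ν).val ⟨_, scalar_eZ_mem h ν⟩ P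
  have h2 := aeval_algHom_apply (Matrix.scalarAlgHom (Fin 2) ℂ (α := Dual s)) (eZ s ν) P
  exact h1.symm.trans h2

/-- Every element is P₀(Z) + P₁(Z) W, and Z commutes with the entries of W. -/
theorem symAlg_mul_comm (h : NotRootOfUnity s) (ν : ℤˣ) (p p' : symAlg s ν) : p * p' = p' * p := by
  obtain ⟨p, hp⟩ := p
  obtain ⟨p', hp'⟩ := p'
  refine Subtype.ext ?_
  change Commute p p'
  have hmem (P : Polynomial ℂ) : Polynomial.aeval (eZ s ν) P ∈ Algebra.adjoin ℂ {eZ s ν} :=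
    Polynomial.aeval_mem_adjoin_singleton ℂ _
  have hZZ (P Q : Polynomial ℂ) : Commute (Matrix.scalar (Fin 2) (Polynomial.aeval (eZ s ν) P))
      (Matrix.scalar (Fin 2) (Polynomial.aeval (eZ s ν) Q)) := by
    rw [commute_iff_eq, ← map_mul, ← map_mul, ← map_mul, ← map_mul, mul_comm]
  have hZW (P : Polynomial ℂ) := commute_scalar_symW h ν (hmem P)
  obtain ⟨P₀, P₁, rfl⟩ := exists_symNF_of_isEquivariant h (hp.1 0 0) hp.2
  obtain ⟨Q₀, Q₁, rfl⟩ := exists_symNF_of_isEquivariant h (hp'.1 0 0) hp'.2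
  have hW := Commute.refl (symW s ν)
  exact ((hZZ _ _).add_left ((hZZ _ _).mul_left (hZW _).symm)).add_right
    (((hZZ _ _).mul_right (hZW _)).add_left
      (((hZZ _ _).mul_right (hZW _)).mul_left ((hZW _).symm.mul_right hW)))

/-- `symAlg` is commutative. -/
abbrev symAlgCommRing (h : NotRootOfUnity s) (ν : ℤˣ) : CommRing (symAlg s ν) :=
  { (inferInstance : Ring (symAlg s ν)) with mul_comm := symAlg_mul_comm h ν }

/-- The homomorphism from polynomials in two variables, given by `symX` and `symY`. -/
def symPolyHom (h : NotRootOfUnity s) (ν : ℤˣ) : MvPolynomial (Fin 2) ℂ →ₐ[ℂ] symAlg s ν :=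
  letI := symAlgCommRing h ν
  MvPolynomial.aeval (R := ℂ) (S₁ := symAlg s ν) ![symX h ν, symY h ν]

theorem symPolyHom_X_zero (h : NotRootOfUnity s) (ν : ℤˣ) :
    symPolyHom h ν (MvPolynomial.X 0) = symX h ν :=
  letI := symAlgCommRing h ν
  MvPolynomial.aeval_X (R := ℂ) (S₁ := symAlg s ν) ![symX h ν, symY h ν] 0

theorem symPolyHom_X_one (h : NotRootOfUnity s) (ν : ℤˣ) :
    symPolyHom h ν (MvPolynomial.X 1) = symY h ν :=
  letI := symAlgCommRing h ν
  MvPolynomial.aeval_X (R := ℂ) (S₁ := symAlg s ν) ![symX h ν, symY h ν] 1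

/-- The polynomial that maps to the symbol of `∂₀ + ∂₁`. -/
def polyW : MvPolynomial (Fin 2) ℂ := MvPolynomial.X 0 + MvPolynomial.X 1

/-- The polynomial that maps to the scalar matrix of the Casimir functional. -/
def polyZ (s : ℂˣ) : MvPolynomial (Fin 2) ℂ :=
  MvPolynomial.C (two s / ((s : ℂ) * qhat s)) * MvPolynomial.X 0

theorem symPolyHom_polyW (h : NotRootOfUnity s) (ν : ℤˣ) :
    symPolyHom h ν polyW = ⟨_, symW_mem h ν⟩ := by
  rw [polyW, map_add, symPolyHom_X_zero, symPolyHom_X_one, symX_add_symY]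

theorem symPolyHom_polyZ (h : NotRootOfUnity s) (ν : ℤˣ) :
    symPolyHom h ν (polyZ s) = ⟨_, scalar_eZ_mem h ν⟩ := by
  have hs := s.ne_zero
  have hh := h.qhat_ne_zero
  have h2 := h.two_ne_zero
  rw [polyZ, MvPolynomial.C_mul', map_smul, symPolyHom_X_zero, symX, smul_smul]
  have h1 : two s / (s * qhat s) * (s * qhat s / two s) = 1 := by field_simp
  rw [h1, one_smul]

/-- The defining polynomial in terms of `polyW` and `polyZ`. -/
theorem relPoly_eq (h : NotRootOfUnity s) : relPoly s = polyW * polyW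
    - MvPolynomial.C ((s : ℂ)⁻¹ * qhat s) * (polyZ s * polyW)
    + MvPolynomial.C ((qq s)⁻¹ / qhat s ^ 2) := by
  have hs := s.ne_zero
  have hh := h.qhat_ne_zero
  have hq := qq_ne_zero s
  have h1 : MvPolynomial.C (σ := Fin 2) ((s : ℂ)⁻¹ * qhat s) * polyZ s =
      (1 + MvPolynomial.C ((qq s)⁻¹ ^ 2)) * MvPolynomial.X 0 := by
    rw [polyZ, ← mul_assoc, ← map_mul, ← MvPolynomial.C_1, ← map_add]
    congr 2
    rw [two]
    field_simp
    rw [qq]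
  have h2 : MvPolynomial.C (σ := Fin 2) ((qq s)⁻¹ * qhat s) =
      1 - MvPolynomial.C ((qq s)⁻¹ ^ 2) := by
    rw [← MvPolynomial.C_1, ← map_sub]
    congr 1
    rw [qhat]
    field_simp
  rw [← mul_assoc, h1, relPoly, h2, polyW]
  ring

theorem symPolyHom_relPoly (h : NotRootOfUnity s) (ν : ℤˣ) :
    symPolyHom h ν (relPoly s) = 0 := by
  have h1 := symW_mul_self h ν
  rw [relPoly_eq h, map_add, map_sub, map_mul, symPolyHom_polyW, MvPolynomial.C_mul', map_smul,
    map_mul, symPolyHom_polyZ, symPolyHom_polyW, ← MvPolynomial.algebraMap_eq,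
    AlgHom.commutes, Algebra.algebraMap_eq_smul_one]
  refine Subtype.ext ?_
  change symW s ν * symW s ν - ((s : ℂ)⁻¹ * qhat s) • (Matrix.scalar (Fin 2) (eZ s ν) * symW s ν)
    + ((qq s)⁻¹ / qhat s ^ 2) • 1 = 0
  rw [h1]
  module

open Polynomial in
/-- The polynomial `P₀(z) + P₁(z) w`, with `z = polyZ` and `w = polyW`. -/
def polyNF (s : ℂˣ) (P₀ P₁ : ℂ[X]) : MvPolynomial (Fin 2) ℂ :=
  aeval (polyZ s) P₀ + aeval (polyZ s) P₁ * polyW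

open Polynomial in
theorem symPolyHom_polyNF (h : NotRootOfUnity s) (ν : ℤˣ) (P₀ P₁ : ℂ[X]) :
    (symPolyHom h ν (polyNF s P₀ P₁) : Matrix (Fin 2) (Fin 2) (Dual s)) = symNF s ν P₀ P₁ := by
  rw [polyNF, map_add, map_mul, ← aeval_algHom_apply, ← aeval_algHom_apply, symPolyHom_polyZ,
    symPolyHom_polyW, symNF, ← coe_aeval_scalar h, ← coe_aeval_scalar h]
  rfl

open Polynomial in
-- The variables z and w are linear coordinates in place of x and y, and the relation is monic of
-- degree two in w. Hence 1 and w span the quotient over ℂ[z].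
theorem exists_polyNF (h : NotRootOfUnity s) (f : MvPolynomial (Fin 2) ℂ) :
    ∃ P₀ P₁ : ℂ[X], f - polyNF s P₀ P₁ ∈ Ideal.span {relPoly s} := by
  have hs := s.ne_zero
  have hh := h.qhat_ne_zero
  have h2 := h.two_ne_zero
  have hX0 : (MvPolynomial.X 0 : MvPolynomial (Fin 2) ℂ) =
      MvPolynomial.C ((s : ℂ) * qhat s / two s) * polyZ s := by
    rw [polyZ, ← mul_assoc, ← map_mul]
    have h1 : (s * qhat s / two s) * (two s / (s * qhat s)) = 1 := by field_simp
    rw [h1, MvPolynomial.C_1, one_mul]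
  induction f using MvPolynomial.induction_on with
  | C z => exact ⟨C z, 0, by simp [polyNF, MvPolynomial.algebraMap_eq]⟩
  | add f g hf hg =>
    obtain ⟨P₀, P₁, hP⟩ := hf
    obtain ⟨Q₀, Q₁, hQ⟩ := hg
    refine ⟨P₀ + Q₀, P₁ + Q₁, ?_⟩
    convert add_mem hP hQ using 1
    simp only [polyNF, map_add]
    ring
  | mul_X f i hf =>
    obtain ⟨P₀, P₁, hP⟩ := hf
    set α : ℂ := (s : ℂ) * qhat s / two s
    have hZ : ∃ Q₀ Q₁ : ℂ[X], f * MvPolynomial.X 0 - polyNF s Q₀ Q₁ ∈ Ideal.span {relPoly s} := by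
      refine ⟨C α * Polynomial.X * P₀, C α * Polynomial.X * P₁, ?_⟩
      convert Ideal.mul_mem_right (MvPolynomial.X 0) _ hP using 1
      rw [hX0]
      simp only [polyNF, map_mul, aeval_X, aeval_C, MvPolynomial.algebraMap_eq]
      ring
    have hW : ∃ Q₀ Q₁ : ℂ[X], f * polyW - polyNF s Q₀ Q₁ ∈ Ideal.span {relPoly s} := by
      -- The product P₀ w + P₁ w² is reduced by w² = q^{-1/2} q̂ z w - q⁻¹/q̂².
      refine ⟨-(C ((qq s)⁻¹ / qhat s ^ 2) * P₁),
        P₀ + C ((s : ℂ)⁻¹ * qhat s) * Polynomial.X * P₁, ?_⟩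
      convert add_mem (Ideal.mul_mem_right polyW _ hP) (Ideal.mul_mem_left _ (aeval (polyZ s) P₁)
        (Ideal.subset_span (Set.mem_singleton (relPoly s)))) using 1
      rw [relPoly_eq h]
      simp only [polyNF, map_add, map_neg, map_mul _ (C _), map_mul _ (C _ * _), aeval_X, aeval_C,
        MvPolynomial.algebraMap_eq]
      ring
    fin_cases i
    · exact hZ
    -- Multiplication by y is multiplication by w minus multiplication by x.
    · obtain ⟨Q₀, Q₁, hQ⟩ := hZ
      obtain ⟨R₀, R₁, hR⟩ := hW
      refine ⟨R₀ - Q₀, R₁ - Q₁, ?_⟩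
      convert sub_mem hR hQ using 1
      simp only [polyNF, map_sub, polyW]
      simp only [Fin.mk_one, Fin.isValue]
      ring

/-- The presentation of the algebra of symbols. -/
def symEquiv (h : NotRootOfUnity s) (ν : ℤˣ) :
    (MvPolynomial (Fin 2) ℂ ⧸ Ideal.span {relPoly s}) ≃ₐ[ℂ] symAlg s ν :=
  AlgEquiv.ofBijective
    (Ideal.Quotient.liftₐ (Ideal.span {relPoly s}) (symPolyHom h ν) (by
      intro f hf
      obtain ⟨g, rfl⟩ := Ideal.mem_span_singleton.mp hf
      rw [map_mul, symPolyHom_relPoly, zero_mul])) (by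
    constructor
    · rw [injective_iff_map_eq_zero]
      intro f hf
      obtain ⟨f, rfl⟩ := Ideal.Quotient.mk_surjective f
      -- Normal forms correspond on the two sides, so uniqueness of the coefficients for symbols
      -- gives injectivity, and existence of the normal form for symbols gives surjectivity.
      obtain ⟨P₀, P₁, hP⟩ := exists_polyNF h f
      have h1 := Ideal.Quotient.eq.mpr hP
      rw [h1] at hf ⊢
      have h2 : symPolyHom h ν (polyNF s P₀ P₁) = 0 := hf
      obtain ⟨rfl, rfl⟩ := symNF_eq_zero h (ν := ν) (P₀ := P₀) (P₁ := P₁) (by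
        rw [← symPolyHom_polyNF h, h2]; rfl)
      simp [polyNF]
    · rintro ⟨p, hp⟩
      obtain ⟨P₀, P₁, rfl⟩ := exists_symNF_of_isEquivariant h (hp.1 0 0) hp.2
      exact ⟨Ideal.Quotient.mk _ (polyNF s P₀ P₁), Subtype.ext (symPolyHom_polyNF h ν P₀ P₁)⟩)

theorem mem_map_opHom_iff (h : NotRootOfUnity s) (ν : ℤˣ) {c : ℂ} (hc : c ≠ 0)
    (d : Module.End ℂ (S0plus s ν c)) :
    d ∈ (symAlg s ν).map (opHom h ν hc) ↔ IsInvariantDO s ν c (spinCoaction h ν hc) d := by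
  rw [Subalgebra.mem_map]
  constructor
  · rintro ⟨p, hp, rfl⟩
    exact ⟨⟨p, hp.1, (hasSymbol_iff h ν hc p _).mpr rfl⟩, (opHom_comm_iff h ν hc p).mpr hp.2⟩
  · rintro ⟨⟨p, hp, hs⟩, hd⟩
    obtain rfl := (hasSymbol_iff h ν hc p _).mp hs
    exact ⟨p, ⟨hp, (opHom_comm_iff h ν hc p).mp hd⟩, rfl⟩

end QSpin

end

open QSpin in
theorem mainTheorem1 (q : ℂ) (hq : ∀ n : ℕ, 0 < n → q ^ n ≠ 1)
    (s : ℂˣ) (hs : (s : ℂ) ^ 2 = q) (ν : ℤˣ) (c : ℂ) (hc : c ≠ 0) :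
    ∃ ΔR : S0plus s ν c →ₗ[ℂ] TensorProduct ℂ (S0plus s ν c) (Atilde (s ^ 2)),
      IsSpinCoaction s ν c ΔR ∧
      ∃ d₀ d₁ : Module.End ℂ (S0plus s ν c),
        HasSymbol s ν c (symbolOf s (D0 s ν)) d₀ ∧
        HasSymbol s ν c (symbolOf s (D1 s ν)) d₁ ∧
        ∃ D : Subalgebra ℂ (Module.End ℂ (S0plus s ν c)),
          (∀ d, d ∈ D ↔ IsInvariantDO s ν c ΔR d) ∧
          ∃ φ : (MvPolynomial (Fin 2) ℂ ⧸ Ideal.span {relPoly s}) ≃ₐ[ℂ] D,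
            (φ (Ideal.Quotient.mk _ (MvPolynomial.X 0)) : Module.End ℂ (S0plus s ν c)) = d₀ ∧
            (φ (Ideal.Quotient.mk _ (MvPolynomial.X 1)) : Module.End ℂ (S0plus s ν c)) = d₁ := by
  have h : NotRootOfUnity s := by
    intro n hn
    rw [qq, hs]
    exact hq n hn
  refine ⟨spinCoaction h ν hc, isSpinCoaction_spinCoaction h ν hc, _, _,
    (hasSymbol_iff h ν hc _ _).mpr rfl, (hasSymbol_iff h ν hc _ _).mpr rfl,
    (symAlg s ν).map (opHom h ν hc), mem_map_opHom_iff h ν hc,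
    (symEquiv h ν).trans ((symAlg s ν).equivMapOfInjective _ (opHom_injective h ν hc)), ?_, ?_⟩
  · rw [← coe_symX h, ← symPolyHom_X_zero]
    rfl
  · rw [← coe_symY h, ← symPolyHom_X_one]
    rfl
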